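/- Let $0<\alpha<1$ and let $L=(L(t))_{t\ge 0}$ be an $\alpha$-selfsimilar subordinator: $L$ starts at $0$, has stationary, independent, non-negative increments, is continuous in probability, has (almost surely) càdlàg paths, and satisfies $$\mathbf E\big[e^{-\omega L(t)}\big]=\exp\Big\{-t\int_0^\infty(1-e^{-\omega x})\frac{\alpha}{x^{1+\alpha}}\,dx\Big\},\qquad \omega\ge 0,\ t\ge 0.$$ Let $X_1(t)\ge X_2(t)\ge\cdots$ denote the flights (jumps) of $L$ during $[0,t]$ in decreasing order, and put $$G_\alpha(\omega)=\alpha\int_0^1\frac{1-e^{-\omega u}}{u^{1+\alpha}}\,du ,\qquad \omega\ge 0 .$$ There is exactly one probability law $\mathcal G_\alpha$ on $[0,\infty)$ with Laplace transform $\omega\mapsto \dfrac{1}{1+G_\alpha(\omega)}$, $\omega\ge 0$. Let $n\ge 0$ be an integer. For every $t>0$ we have $X_{n+1}(t)>0$ almost surely, and the law of the random vector $$\left(\frac{L(t)-(X_1(t)+\cdots+X_{n+1}(t))}{X_{n+1}(t)}\,;\ \frac{X_1(t)}{X_{n+1}(t)},\dots,\frac{X_n(t)}{X_{n+1}(t)}\right)$$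 does not depend on $t>0$. It is the law of $$\big(\xi_1+\cdots+\xi_{n+1}\,;\ Y_{(1)},\dots,Y_{(n)}\big),$$ where $\xi_1,\dots,\xi_{n+1},Y_1,\dots,Y_n$ are independent random variables, each $\xi_i$ is $\mathcal G_\alpha$-distributed, each $Y_j$ is Pareto$(\alpha)$-distributed, that is $\mathbf P(Y_j>y)=y^{-\alpha}$ for $y\ge 1$, and $Y_{(1)}\ge\cdots\ge Y_{(n)}$ are the order statistics of $Y_1,\dots,Y_n$ in decreasing order. Moreover, for every $t>0$: (i) $X_{n+1}(t)/L(t)$ is equal in law to $\left(1+\xi_1+\cdots+\xi_{n+1}+Y_1+\cdots+Y_n\right)^{-1}$; hence for all $u\in[0,1]$ $$\mathbf P\left(\frac{X_{n+1}(t)}{L(t)}\le u\right)=\mathbf P\left(\xi_1+\cdots+\xi_{n+1}+Y_1+\cdots+Y_n\ge \frac1u-1\right).$$ (ii) If $n\ge 1$, then $(X_1(t)+\cdots+X_n(t))/L(t)$ is equal in law to $\left(1+\dfrac{1+\xi_1+\cdots+\xi_{n+1}}{Y_1+\cdots+Y_n}\right)^{-1}$; hence for all $u\in[0,1]$ $$\mathbf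 P\left(\frac{X_1(t)+\cdots+X_n(t)}{L(t)}\le u\right)=\mathbf P\left(\frac{1+\xi_1+\cdots+\xi_{n+1}}{Y_1+\cdots+Y_n}\ge \frac1u-1\right).$$ For $u=0$ the right-hand sides in (i) and (ii) are read with $\frac10=\infty$, i.e. as $0$. -/

import Mathlib

open MeasureTheory ProbabilityTheory Filter Topology Set
open scoped NNReal ENNReal

namespace LevyFlights

noncomputable section

/-- A one-sided Lévy process (subordinator): a real process indexed by `[0, ∞)`, started at `0`,
with stationary and independent increments, continuous in probability, with non-negative increments
and (as usual for Lévy processes, so that its jumps make sense) with almost surely càdlàg paths. -/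
structure IsOLP {Ω : Type*} [MeasurableSpace Ω] (L : ℝ≥0 → Ω → ℝ) (P : Measure Ω) : Prop where
  measurable : ∀ t, Measurable (L t)
  start : ∀ᵐ ω ∂P, L 0 ω = 0
  indep : HasIndepIncrements L P
  stationary : ∀ s h : ℝ≥0, IdentDistrib (fun ω => L (s + h) ω - L s ω) (L h) P P
  continuous_in_prob : ∀ t, TendstoInMeasure P L (𝓝 t) (L t)
  nonneg_incr : ∀ s t : ℝ≥0, s ≤ t → ∀ᵐ ω ∂P, L s ω ≤ L t ω
  cadlag : ∀ᵐ ω ∂P, ∀ t : ℝ≥0, ContinuousWithinAt (fun s => L s ω) (Ici t) t ∧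
    ∃ l : ℝ, Tendsto (fun s => L s ω) (𝓝[<] t) (𝓝 l)

/-- The Lévy characteristic `Ψ(w) = ∫_{(0,∞)} (1 - exp(-w x)) lam(dx)` of a Lévy measure. -/
def levyCharacteristic (lam : Measure ℝ) (w : ℝ) : ℝ :=
  ∫ x in Ioi (0 : ℝ), (1 - Real.exp (-(w * x))) ∂lam

/-- The Lévy measure `α x^{-(1+α)} dx` on `(0, ∞)`; its flight tail is `Λ(x) = 1 / x^α`. -/
def selfsimilarLevyMeasure (α : ℝ) : Measure ℝ :=
  (volume.restrict (Ioi 0)).withDensity fun x => ENNReal.ofReal (α / x ^ (1 + α))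

/-- An `α`-selfsimilar OLP: an OLP whose Laplace transform is `E exp(-w L(t)) = exp(-Ψ(w) t)`, where
`Ψ` is the Lévy characteristic of the Lévy measure `α x^{-(1+α)} dx`. -/
structure IsSelfsimilarOLP {Ω : Type*} [MeasurableSpace Ω] (α : ℝ) (L : ℝ≥0 → Ω → ℝ)
    (P : Measure Ω) : Prop extends IsOLP L P where
  laplace : ∀ (t : ℝ≥0) (w : ℝ), 0 ≤ w → ∫ ω, Real.exp (-(w * L t ω)) ∂P =
    Real.exp (-(levyCharacteristic (selfsimilarLevyMeasure α) w * t))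

/-- The jump (flight) of a path at time `s`; it is `0` at time `0`. -/
def jump (p : ℝ≥0 → ℝ) (s : ℝ≥0) : ℝ := p s - Function.leftLim p s

/-- `Π(t; I)`: the number of flights of the path during `[0, t]` with size in `I ⊆ (0, ∞)`. -/
def flightCount (p : ℝ≥0 → ℝ) (t : ℝ≥0) (I : Set ℝ) : ℕ∞ :=
  {s : ℝ≥0 | s ≤ t ∧ jump p s ∈ I}.encard

/-- The `k`-th largest flight (`k ≥ 1`, with multiplicity) of a path during `[0, t]`: the largest
`x > 0` such that at least `k` flights have size at least `x` (and `0` if there are fewer than `k`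
flights). -/
def largestFlight (p : ℝ≥0 → ℝ) (t : ℝ≥0) (k : ℕ) : ℝ :=
  sSup {x : ℝ | 0 < x ∧ (k : ℕ∞) ≤ flightCount p t (Ici x)}

/-- The random variable `X_k(t)`, the `k`-th largest flight of `L` up to time `t`. -/
def flight {Ω : Type*} (L : ℝ≥0 → Ω → ℝ) (k : ℕ) (t : ℝ≥0) (ω : Ω) : ℝ :=
  largestFlight (fun s => L s ω) t k

/-- The vector `((L(t) - (X_1(t)+⋯+X_{n+1}(t))) / X_{n+1}(t); X_1(t)/X_{n+1}(t), …,
X_n(t)/X_{n+1}(t))`. -/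
def ratioVector {Ω : Type*} (L : ℝ≥0 → Ω → ℝ) (n : ℕ) (t : ℝ≥0) (ω : Ω) : ℝ × (Fin n → ℝ) :=
  ((L t ω - ∑ k ∈ Finset.Icc 1 (n + 1), flight L k t ω) / flight L (n + 1) t ω,
    fun i => flight L ((i : ℕ) + 1) t ω / flight L (n + 1) t ω)

/-- `G_α(w) = α ∫_0^1 (1 - exp(-w u)) / u^{1+α} du`. -/
def G (α w : ℝ) : ℝ := α * ∫ u in (0 : ℝ)..1, (1 - Real.exp (-(w * u))) / u ^ (1 + α)

/-- `μ` is a probability law on `[0, ∞)` with Laplace transform `1 / (1 + G_α(w))`, `w ≥ 0`. -/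
structure IsGLaw (α : ℝ) (μ : Measure ℝ) : Prop where
  prob : IsProbabilityMeasure μ
  nonneg : μ (Iio 0) = 0
  laplace : ∀ w : ℝ, 0 ≤ w → ∫ x, Real.exp (-(w * x)) ∂μ = 1 / (1 + G α w)

/-- The order statistics of `y_1, …, y_n` in decreasing order: index `0` carries the largest. -/
def orderStat {n : ℕ} (y : Fin n → ℝ) (i : Fin n) : ℝ := y (Tuple.sort y i.rev)

end

end LevyFlights

open LevyFlights

/-!
The proof replaces the path of `L` on `[0, t]` by its increments over a grid of `m` intervals of
length `t / m`, computes with these independent identically distributed variables, and lets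
`m → ∞`.

*From increments to flights.* For a monotone right-continuous path, the `k`-th largest increment
converges to the `k`-th largest jump (`tendsto_topStat_gridIncrement`). So the ratios formed with the
ordered increments converge almost surely to the ratios formed with the flights.

*Small times.* The Laplace transform of `L (t / m)` determines the limit of the measures
`m (1 - exp (-x)) P(L (t / m) ∈ dx)`, by Weierstrass approximation in the variable `exp (-x)`. This
gives `m P(L (t / m) > x) → t / x ^ α`, together with a bound of the same form
(`isStableArray_of_laplace`).

*Order statistics.* The increments have the law of `Q(V₁), …, Q(V_m)`, where `Q` is the quantile
function of `L (t / m)` and the `Vᵢ` are independent and uniform on `(0, 1)`, so that ties do not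
matter. A symmetric function of the `Vᵢ` is uncorrelated with every event on their ranks
(`setIntegral_symmetric_eq`). Choose the event that `n` given variables are smaller, and `r` given
variables are larger, than a distinguished one, whose value is `v`: given `v`, the `n` variables are
uniform on `(0, v)` and the `r` variables uniform on `(v, 1)`, and both groups are independent. On
the scale `v = y / m` one has `Q(y / m) → (t / y) ^ (1 / α)`. Hence the ratios of the `n` largest
entries to the next one converge to `U ^ (-1/α)` with `U` uniform, which is a Pareto variable, and
the `r` small entries contribute the factor
`(1 - y (1 + G α w) / m) ^ r → exp (-(1 + G α w) y)`. Integrating this against `y ^ n / n!` gives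
`1 / (1 + G α w) ^ (n + 1)`, which factors off
(`IsStableArray.tendsto_integral_ratioFunctional`, `IsSelfsimilarOLP.integral_ratioVector`).

*Conclusion.* Laplace transforms determine laws on the half-line (`identDistrib_of_laplace`), which
identifies the law of the vector of ratios. The case `n = 0` shows that there is a law with Laplace
transform `1 / (1 + G α w)`. The statements (i) and (ii) follow, because the two quotients are
functions of the vector of ratios.
-/

open scoped BoundedContinuousFunction Pointwise

namespace LevyFlights

/-! ### Order statistics of finite families -/

/-- The number of entries of a finite family that are at least `c`. -/
noncomputable def levelCount {ι : Type*} [Fintype ι] (x : ι → ℝ) (c : ℝ) : ℕ :=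
  (Finset.univ.filter fun j => c ≤ x j).card

/-- The `k`-th order statistic in decreasing order of a finite family with an arbitrary index type,
counted from `k = 0` (the largest entry); it is `0` if the family has at most `k` entries. -/
noncomputable def topStat {ι : Type*} [Fintype ι] (x : ι → ℝ) (k : ℕ) : ℝ :=
  sSup {c | k < levelCount x c}

section OrderStatistics

variable {ι κ : Type*} [Fintype ι] [Fintype κ]

lemma levelCount_comp_equiv (x : ι → ℝ) (e : κ ≃ ι) (c : ℝ) :
    levelCount (x ∘ e) c = levelCount x c := by
  unfold levelCount
  exact Finset.card_equiv e (by simp)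

lemma topStat_comp_equiv (x : ι → ℝ) (e : κ ≃ ι) (k : ℕ) :
    topStat (x ∘ e) k = topStat x k := by
  simp only [topStat, levelCount_comp_equiv]

lemma le_orderStat_iff {n : ℕ} (y : Fin n → ℝ) (i : Fin n) (c : ℝ) :
    c ≤ orderStat y i ↔ (i : ℕ) < levelCount y c := by
  have hmono : Monotone (y ∘ Tuple.sort y) := Tuple.monotone_sort y
  rw [← levelCount_comp_equiv y (Tuple.sort y)]
  unfold orderStat levelCount
  constructor
  · intro h
    have hsub : Finset.Ici i.rev ⊆ Finset.univ.filter fun j => c ≤ (y ∘ Tuple.sort y) j := by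
      intro j hj
      simp only [Finset.mem_filter, Finset.mem_univ, true_and]
      exact h.trans (hmono (Finset.mem_Ici.1 hj))
    have := Finset.card_le_card hsub
    rw [Fin.card_Ici, Fin.val_rev] at this
    have := i.2
    omega
  · intro h
    by_contra! hlt
    have hsub : (Finset.univ.filter fun j => c ≤ (y ∘ Tuple.sort y) j) ⊆ Finset.Ioi i.rev := by
      intro j hj
      simp only [Finset.mem_filter, Finset.mem_univ, true_and] at hj
      rw [Finset.mem_Ioi]
      by_contra! hji
      exact absurd (hmono hji) (not_le.2 (hlt.trans_le hj))
    have := Finset.card_le_card hsub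
    rw [Fin.card_Ioi, Fin.val_rev] at this
    have := i.2
    omega

lemma topStat_eq_orderStat {n : ℕ} (y : Fin n → ℝ) (i : Fin n) :
    topStat y i = orderStat y i := by
  have : {c | (i : ℕ) < levelCount y c} = Iic (orderStat y i) := by
    ext c
    simp [le_orderStat_iff]
  rw [topStat, this, csSup_Iic]

lemma topStat_eq_orderStat_comp (x : ι → ℝ) (i : Fin (Fintype.card ι)) :
    topStat x i = orderStat (x ∘ (Fintype.equivFin ι).symm) i := by
  rw [← topStat_eq_orderStat, topStat_comp_equiv]

lemma le_topStat_iff (x : ι → ℝ) {k : ℕ} (hk : k < Fintype.card ι) (c : ℝ) :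
    c ≤ topStat x k ↔ k < levelCount x c := by
  have := topStat_eq_orderStat_comp x ⟨k, hk⟩
  simp only at this
  rw [this, le_orderStat_iff, levelCount_comp_equiv]

lemma topStat_of_card_le (x : ι → ℝ) {k : ℕ} (hk : Fintype.card ι ≤ k) : topStat x k = 0 := by
  have : {c | k < levelCount x c} = ∅ := by
    ext c
    simp only [mem_ofPred_eq, mem_empty_iff_false, iff_false, not_lt]
    exact (Finset.card_le_univ _).trans hk
  rw [topStat, this, Real.sSup_empty]

lemma sum_topStat (x : ι → ℝ) :
    ∑ k ∈ Finset.range (Fintype.card ι), topStat x k = ∑ i, x i := by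
  rw [Finset.sum_range]
  simp_rw [topStat_eq_orderStat_comp]
  unfold orderStat
  refine (Equiv.sum_comp Fin.revPerm fun i =>
    (x ∘ (Fintype.equivFin ι).symm) (Tuple.sort (x ∘ (Fintype.equivFin ι).symm) i)).trans ?_
  rw [Equiv.sum_comp (Tuple.sort _), ← Equiv.sum_comp (Fintype.equivFin ι).symm x]
  rfl

lemma topStat_nonneg {x : ι → ℝ} (hx : ∀ i, 0 ≤ x i) (k : ℕ) : 0 ≤ topStat x k := by
  rcases lt_or_ge k (Fintype.card ι) with hk | hk
  · rw [le_topStat_iff x hk]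
    unfold levelCount
    rwa [Finset.filter_true_of_mem (by simpa using hx), Finset.card_univ]
  · rw [topStat_of_card_le x hk]

lemma sum_range_topStat_le {x : ι → ℝ} (hx : ∀ i, 0 ≤ x i) {n : ℕ} (hn : n ≤ Fintype.card ι) :
    ∑ k ∈ Finset.range n, topStat x k ≤ ∑ i, x i := by
  rw [← sum_topStat x]
  exact Finset.sum_le_sum_of_subset_of_nonneg (Finset.range_mono hn)
    fun k _ _ => topStat_nonneg hx k

lemma topStat_sub_le {x y : ι → ℝ} {ε : ℝ} (h : ∀ i, x i - ε ≤ y i) {k : ℕ}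
    (hk : k < Fintype.card ι) : topStat x k - ε ≤ topStat y k := by
  rw [le_topStat_iff y hk]
  refine ((le_topStat_iff x hk _).1 le_rfl).trans_le (Finset.card_le_card ?_)
  intro j hj
  simp only [Finset.mem_filter, Finset.mem_univ, true_and] at hj ⊢
  linarith [h j]

lemma continuous_topStat (k : ℕ) : Continuous fun x : ι → ℝ => topStat x k := by
  rcases lt_or_ge k (Fintype.card ι) with hk | hk
  · refine (LipschitzWith.of_le_add fun x y => ?_).continuous
    have : ∀ i, x i - dist x y ≤ y i := fun i => by
      have := (le_abs_self _).trans ((Real.dist_eq (x i) (y i)).symm.le.trans (dist_le_pi_dist x y i))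
      linarith
    linarith [topStat_sub_le this hk]
  · simp only [topStat_of_card_le _ hk]
    exact continuous_const

lemma measurable_topStat (k : ℕ) : Measurable fun x : ι → ℝ => topStat x k :=
  (continuous_topStat k).measurable

lemma topStat_const_mul {a : ℝ} (ha : 0 < a) (x : ι → ℝ) (k : ℕ) :
    topStat (fun i => a * x i) k = a * topStat x k := by
  rcases lt_or_ge k (Fintype.card ι) with hk | hk
  · refine eq_of_forall_le_iff fun c => ?_
    rw [le_topStat_iff _ hk, ← div_le_iff₀' ha, le_topStat_iff _ hk]
    simp only [levelCount, div_le_iff₀' ha]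
  · rw [topStat_of_card_le _ hk, topStat_of_card_le _ hk, mul_zero]

lemma levelCount_sumElim (x : ι → ℝ) (y : κ → ℝ) (c : ℝ) :
    levelCount (Sum.elim x y) c = levelCount x c + levelCount y c := by
  simp only [levelCount, Finset.card_filter, Fintype.sum_sum_type]
  rfl

lemma levelCount_eq_card {x : ι → ℝ} {c : ℝ} (h : ∀ i, c ≤ x i) :
    levelCount x c = Fintype.card ι := by
  unfold levelCount
  rw [Finset.filter_true_of_mem (by simpa using h), Finset.card_univ]

lemma levelCount_eq_zero {x : ι → ℝ} {c : ℝ} (h : ∀ i, x i < c) : levelCount x c = 0 := by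
  unfold levelCount
  rw [Finset.filter_false_of_mem (by simpa using h), Finset.card_empty]

lemma levelCount_le_card (x : ι → ℝ) (c : ℝ) : levelCount x c ≤ Fintype.card ι :=
  Finset.card_le_univ _

/-- If one group of entries lies above `q`, one entry equals `q` and the others lie below `q`, then
the largest entries are those of the first group. -/
lemma topStat_sumElim_of_lt {a : ι → ℝ} {q : ℝ} {b : κ → ℝ} (ha : ∀ i, q ≤ a i)
    (hb : ∀ i, b i ≤ q) {k : ℕ} (hk : k < Fintype.card ι) :
    topStat (Sum.elim (fun _ : Unit => q) (Sum.elim a b)) k = topStat a k := by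
  refine eq_of_forall_le_iff fun c => ?_
  rw [le_topStat_iff _ (by simp; omega), le_topStat_iff _ hk, levelCount_sumElim,
    levelCount_sumElim]
  rcases le_or_gt c q with hc | hc
  · have h1 := levelCount_eq_card fun i => hc.trans (ha i)
    omega
  · have h1 := levelCount_eq_zero fun i => (hb i).trans_lt hc
    have h2 := levelCount_eq_zero (x := fun _ : Unit => q) fun _ => hc
    omega

lemma topStat_sumElim_eq {a : ι → ℝ} {q : ℝ} {b : κ → ℝ} (ha : ∀ i, q ≤ a i)
    (hb : ∀ i, b i ≤ q) :
    topStat (Sum.elim (fun _ : Unit => q) (Sum.elim a b)) (Fintype.card ι) = q := by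
  refine eq_of_forall_le_iff fun c => ?_
  rw [le_topStat_iff _ (by simp; omega), levelCount_sumElim, levelCount_sumElim]
  rcases le_or_gt c q with hc | hc
  · have h1 := levelCount_eq_card fun i => hc.trans (ha i)
    have h2 := levelCount_eq_card (x := fun _ : Unit => q) fun _ => hc
    simp only [Fintype.card_unit] at h2
    simp only [hc, iff_true]
    omega
  · have h1 := levelCount_eq_zero fun i => (hb i).trans_lt hc
    have h2 := levelCount_eq_zero (x := fun _ : Unit => q) fun _ => hc
    have h3 := levelCount_le_card a c
    rw [iff_false_right (not_le.2 hc)]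
    omega

end OrderStatistics


/-! ### Flights of a path as limits of ordered increments -/

/-- The grid point `i t / m`. -/
noncomputable def grid (t : ℝ≥0) (m i : ℕ) : ℝ≥0 := t * i / m

/-- The increments of a path over the `m` intervals of length `t / m` that partition `[0, t]`. -/
noncomputable def gridIncrement (p : ℝ≥0 → ℝ) (t : ℝ≥0) (m : ℕ) (i : Fin m) : ℝ :=
  p (grid t m (i + 1)) - p (grid t m i)

section Paths

variable {p : ℝ≥0 → ℝ} {t : ℝ≥0}

lemma grid_mono (t : ℝ≥0) (m : ℕ) : Monotone (grid t m) := fun i j hij => by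
  unfold grid
  gcongr

lemma grid_zero (t : ℝ≥0) (m : ℕ) : grid t m 0 = 0 := by simp [grid]

lemma grid_self (t : ℝ≥0) {m : ℕ} (hm : m ≠ 0) : grid t m m = t := by
  simp [grid, hm]

lemma grid_le (t : ℝ≥0) {m i : ℕ} (hi : i ≤ m) : grid t m i ≤ t := by
  rcases eq_or_ne m 0 with rfl | hm
  · simp [grid]
  · exact (grid_mono t m hi).trans (grid_self t hm).le

lemma coe_grid_succ (t : ℝ≥0) (m i : ℕ) :
    (grid t m (i + 1) : ℝ) = grid t m i + t / m := by
  simp only [grid]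
  push_cast
  ring

lemma grid_succ (t : ℝ≥0) (m i : ℕ) : grid t m (i + 1) = grid t m i + t / m := by
  simp only [grid]
  push_cast
  ring

lemma sum_gridIncrement (p : ℝ≥0 → ℝ) (t : ℝ≥0) {m : ℕ} (hm : m ≠ 0) :
    ∑ i, gridIncrement p t m i = p t - p 0 := by
  unfold gridIncrement
  rw [Fin.sum_univ_eq_sum_range fun i => p (grid t m (i + 1)) - p (grid t m i),
    Finset.sum_range_sub fun i => p (grid t m i), grid_self t hm, grid_zero]

lemma gridIncrement_nonneg (hp : Monotone p) (t : ℝ≥0) (m : ℕ) (i : Fin m) :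
    0 ≤ gridIncrement p t m i :=
  sub_nonneg.2 (hp (grid_mono t m (Nat.le_succ _)))

lemma le_leftLim_zero (hp : Monotone p) (s : ℝ≥0) : p 0 ≤ Function.leftLim p s := by
  rcases eq_or_ne s 0 with rfl | hs
  · exact (leftLim_eq_of_isBot (f := p) isBot_bot).ge
  · exact hp.le_leftLim (pos_iff_ne_zero.2 hs)

lemma jump_zero (p : ℝ≥0 → ℝ) : jump p 0 = 0 := by
  exact sub_eq_zero.2 (leftLim_eq_of_isBot (f := p) isBot_bot).symm

/-- Near every time, a monotone right-continuous path moves little, except by its jump there. -/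
lemma exists_ball_increment_lt (hp : Monotone p)
    (hrc : ∀ s, ContinuousWithinAt p (Ici s) s) (s : ℝ≥0) {η : ℝ} (hη : 0 < η) :
    ∃ ε > 0, ∀ a ∈ Metric.ball s ε, ∀ b ∈ Metric.ball s ε, a ≤ b →
      (¬ (a < s ∧ s ≤ b) → p b - p a < η) ∧ p b - p a < jump p s + 2 * η := by
  have hr : ∀ᶠ x in 𝓝[≥] s, p x < p s + η :=
    (hrc s).eventually (gt_mem_nhds (by linarith))
  have hl : ∀ᶠ x in 𝓝[<] s, Function.leftLim p s - η < p x :=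
    (hp.tendsto_leftLim s).eventually (lt_mem_nhds (by linarith))
  rw [eventually_nhdsWithin_iff, Metric.eventually_nhds_iff_ball] at hr hl
  obtain ⟨ε₁, hε₁, h1⟩ := hr
  obtain ⟨ε₂, hε₂, h2⟩ := hl
  refine ⟨min ε₁ ε₂, lt_min hε₁ hε₂, fun a ha b hb hab => ?_⟩
  have hb1 := h1 b (Metric.ball_subset_ball (min_le_left _ _) hb)
  have ha2 := h2 a (Metric.ball_subset_ball (min_le_right _ _) ha)
  simp only [mem_Ici, mem_Iio] at hb1 ha2
  have hls : Function.leftLim p s ≤ p s := hp.leftLim_le le_rfl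
  unfold jump
  rcases lt_or_ge a s with has | has <;> rcases lt_or_ge b s with hbs | hbs
  · have h3 : p b ≤ Function.leftLim p s := hp.le_leftLim hbs
    have h4 := ha2 has
    exact ⟨fun _ => by linarith, by linarith⟩
  · have h3 := ha2 has
    have h4 := hb1 hbs
    exact ⟨fun h => absurd ⟨has, hbs⟩ h, by linarith⟩
  · exact absurd hab (not_le.2 (hbs.trans_le has))
  · have h3 := hb1 hbs
    have h4 : p s ≤ p a := hp has
    exact ⟨fun _ => by linarith, by linarith⟩

lemma tendsto_div_natCast (t : ℝ≥0) : Tendsto (fun m : ℕ => (t : ℝ) / m) atTop (𝓝 0) :=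
  tendsto_const_div_atTop_nhds_zero_nat _

lemma eventually_levelCount_le_flightCount (hp : Monotone p)
    (hrc : ∀ s, ContinuousWithinAt p (Ici s) s) (t : ℝ≥0) {η : ℝ} (hη : 0 < η) :
    ∀ᶠ m : ℕ in atTop, ∀ c, 2 * η < c →
      (levelCount (gridIncrement p t m) c : ℕ∞) ≤ flightCount p t (Ici (c - 2 * η)) := by
  choose ε hε h using fun s => exists_ball_increment_lt hp hrc s hη
  obtain ⟨δ, hδ, hcov⟩ := lebesgue_number_lemma_of_metric (isCompact_Icc (a := (0 : ℝ≥0)) (b := t))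
    (c := fun s => Metric.ball s (ε s)) (fun s => Metric.isOpen_ball)
    (fun s _ => mem_iUnion.2 ⟨s, Metric.mem_ball_self (hε s)⟩)
  filter_upwards [(tendsto_div_natCast t).eventually (gt_mem_nhds hδ)] with m hm c hc
  have key : ∀ i : Fin m, ∃ s, c ≤ gridIncrement p t m i →
      grid t m i < s ∧ s ≤ grid t m (i + 1) ∧ c - 2 * η ≤ jump p s := by
    intro i
    obtain ⟨s, hs⟩ := hcov (grid t m i) ⟨zero_le, grid_le t i.2.le⟩
    refine ⟨s, fun hci => ?_⟩
    have hb : grid t m (i + 1) ∈ Metric.ball (grid t m i) δ := by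
      rw [Metric.mem_ball, NNReal.dist_eq, coe_grid_succ, add_sub_cancel_left,
        abs_of_nonneg (by positivity)]
      exact hm
    obtain ⟨h1, h2⟩ := h s _ (hs (Metric.mem_ball_self hδ)) _ (hs hb)
      (grid_mono t m (Nat.le_succ _))
    unfold gridIncrement at hci
    by_cases hmem : grid t m i < s ∧ s ≤ grid t m (i + 1)
    · exact ⟨hmem.1, hmem.2, by linarith⟩
    · linarith [h1 hmem]
  choose s hs using key
  unfold levelCount flightCount
  rw [← Set.encard_coe_eq_coe_finsetCard]
  refine Set.encard_le_encard_of_injOn (f := s) ?_ ?_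
  · intro i hi
    obtain ⟨-, h2, h3⟩ := hs i (by simpa using hi)
    exact ⟨h2.trans (grid_le t i.2), h3⟩
  · intro i hi j hj hij
    obtain ⟨hi1, hi2, -⟩ := hs i (by simpa using hi)
    obtain ⟨hj1, hj2, -⟩ := hs j (by simpa using hj)
    rw [hij] at hi1 hi2
    by_contra hne
    rcases lt_or_gt_of_ne hne with hlt | hlt
    · exact absurd (hj1.trans_le hi2) (not_lt.2 (grid_mono t m (Nat.succ_le_of_lt hlt)))
    · exact absurd (hi1.trans_le hj2) (not_lt.2 (grid_mono t m (Nat.succ_le_of_lt hlt)))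

lemma exists_grid_lt_le {m : ℕ} (hm : m ≠ 0) {s : ℝ≥0} (hs : 0 < s) (hst : s ≤ t) :
    ∃ i : Fin m, grid t m i < s ∧ s ≤ grid t m (i + 1) := by
  classical
  have hex : ∃ j, s ≤ grid t m j := ⟨m, hst.trans (grid_self t hm).ge⟩
  have h0 : Nat.find hex ≠ 0 := fun h => by
    have := Nat.find_spec hex
    rw [h, grid_zero] at this
    exact absurd hs (not_lt.2 this)
  have hle : Nat.find hex ≤ m := Nat.find_min' hex (hst.trans (grid_self t hm).ge)
  refine ⟨⟨Nat.find hex - 1, by omega⟩, ?_, ?_⟩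
  · exact not_le.1 (Nat.find_min hex (m := Nat.find hex - 1) (by omega))
  · have := Nat.find_spec hex
    simpa only [Nat.sub_add_cancel (Nat.one_le_iff_ne_zero.2 h0)] using this

lemma eventually_le_levelCount (hp : Monotone p) {x : ℝ} (hx : 0 < x) {k : ℕ}
    (hk : (k : ℕ∞) ≤ flightCount p t (Ici x)) :
    ∀ᶠ m : ℕ in atTop, k ≤ levelCount (gridIncrement p t m) x := by
  obtain ⟨F, hF, hFk⟩ := Set.exists_subset_encard_eq hk
  have hfin : F.Finite := Set.finite_of_encard_eq_coe hFk
  have hgap : ∀ᶠ m : ℕ in atTop, ∀ s ∈ F, ∀ s' ∈ F, s ≠ s' → (t : ℝ) / m < dist s s' := by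
    rw [eventually_all_finite hfin]
    intro s _
    rw [eventually_all_finite hfin]
    intro s' _
    rcases eq_or_ne s s' with rfl | hne
    · simp
    · filter_upwards [(tendsto_div_natCast t).eventually (gt_mem_nhds (dist_pos.2 hne))]
        with m hm _ using hm
  filter_upwards [hgap, eventually_ne_atTop 0] with m hm hm0
  have key : ∀ s : ℝ≥0, ∃ i : Fin m, s ∈ F → grid t m i < s ∧ s ≤ grid t m (i + 1) := by
    intro s
    by_cases hs : s ∈ F
    · have hs0 : 0 < s := by
        refine pos_iff_ne_zero.2 fun h0 => ?_
        have := (hF hs).2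
        rw [h0, jump_zero] at this
        exact absurd hx (not_lt.2 this)
      obtain ⟨i, hi⟩ := exists_grid_lt_le hm0 hs0 (hF hs).1
      exact ⟨i, fun _ => hi⟩
    · exact ⟨⟨0, Nat.pos_of_ne_zero hm0⟩, fun h => absurd h hs⟩
  choose f hf using key
  have hle : F.encard ≤
      ((Finset.univ.filter fun i => x ≤ gridIncrement p t m i : Finset (Fin m)) :
        Set (Fin m)).encard := by
    refine Set.encard_le_encard_of_injOn (f := f) ?_ ?_
    · intro s hs
      obtain ⟨h1, h2⟩ := hf s hs
      have h3 : p (grid t m (f s)) ≤ Function.leftLim p s := hp.le_leftLim h1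
      have h4 : p s ≤ p (grid t m (f s + 1)) := hp h2
      have h5 : x ≤ p s - Function.leftLim p s := (hF hs).2
      refine Finset.mem_coe.2 (Finset.mem_filter.2 ⟨Finset.mem_univ _, ?_⟩)
      unfold gridIncrement
      linarith
    · intro s hs s' hs' hss
      by_contra hne
      obtain ⟨h1, h2⟩ := hf s hs
      obtain ⟨h3, h4⟩ := hf s' hs'
      have h5 := hm s hs s' hs' hne
      rw [← hss] at h3 h4
      rw [grid_succ] at h2 h4
      rw [NNReal.dist_eq] at h5
      rw [← NNReal.coe_le_coe] at h2 h4
      rw [← NNReal.coe_lt_coe] at h1 h3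
      push_cast at h2 h4
      exact absurd h5 (not_lt.2 (abs_sub_le_iff.2 ⟨by linarith, by linarith⟩))
  rw [hFk, Set.encard_coe_eq_coe_finsetCard] at hle
  exact_mod_cast hle

lemma largestFlight_nonneg (p : ℝ≥0 → ℝ) (t : ℝ≥0) (k : ℕ) : 0 ≤ largestFlight p t k :=
  Real.sSup_nonneg fun _ hx => hx.1.le

lemma bddAbove_flight_levels (hp : Monotone p) (t : ℝ≥0) (k : ℕ) :
    BddAbove {x : ℝ | 0 < x ∧ ((k + 1 : ℕ) : ℕ∞) ≤ flightCount p t (Ici x)} := by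
  refine ⟨p t - p 0, fun x hx => ?_⟩
  have hne : {s : ℝ≥0 | s ≤ t ∧ jump p s ∈ Ici x}.Nonempty := by
    rw [← Set.encard_pos]
    exact lt_of_lt_of_le (by exact_mod_cast Nat.succ_pos k) hx.2
  obtain ⟨s, hst, hs⟩ := hne
  have h1 : x ≤ p s - Function.leftLim p s := hs
  have h2 := le_leftLim_zero hp s
  have h3 := hp hst
  linarith

/-- Along finer and finer grids, the `k`-th largest increment of a monotone right-continuous path
converges to its `k`-th largest jump: distinct jumps are eventually caught by distinct increments,
and, by compactness, every large increment contains a jump of almost the same size. -/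
lemma tendsto_topStat_gridIncrement (hp : Monotone p)
    (hrc : ∀ s, ContinuousWithinAt p (Ici s) s) (t : ℝ≥0) (k : ℕ) :
    Tendsto (fun m => topStat (gridIncrement p t m) k) atTop (𝓝 (largestFlight p t (k + 1))) := by
  have hbdd := bddAbove_flight_levels hp t k
  refine tendsto_order.2 ⟨fun a ha => ?_, fun b hb => ?_⟩
  · rcases lt_or_ge a 0 with ha0 | ha0
    · exact Eventually.of_forall fun m =>
        ha0.trans_le (topStat_nonneg (gridIncrement_nonneg hp t m) k)
    · have hne : {x : ℝ | 0 < x ∧ ((k + 1 : ℕ) : ℕ∞) ≤ flightCount p t (Ici x)}.Nonempty := by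
        by_contra! hemp
        rw [largestFlight, hemp, Real.sSup_empty] at ha
        exact absurd ha (not_lt.2 ha0)
      obtain ⟨x, hx, hax⟩ := exists_lt_of_lt_csSup hne ha
      filter_upwards [eventually_le_levelCount hp hx.1 hx.2, eventually_gt_atTop k] with m hm hkm
      exact hax.trans_le ((le_topStat_iff _ (by simpa using hkm) _).2 hm)
  · have hη : 0 < (b - largestFlight p t (k + 1)) / 4 := by linarith
    filter_upwards [eventually_levelCount_le_flightCount hp hrc t hη, eventually_gt_atTop k]
      with m hm hkm
    by_contra! hle
    have h0 := largestFlight_nonneg p t (k + 1)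
    have hlev := (le_topStat_iff _ (by simpa using hkm) _).1 hle
    have hcount := hm b (by linarith)
    have hmem : b - 2 * ((b - largestFlight p t (k + 1)) / 4) ∈
        {x : ℝ | 0 < x ∧ ((k + 1 : ℕ) : ℕ∞) ≤ flightCount p t (Ici x)} :=
      ⟨by linarith, le_trans (by exact_mod_cast hlev) hcount⟩
    have := le_csSup hbdd hmem
    change _ ≤ largestFlight p t (k + 1) at this
    linarith

end Paths


/-! ### Ranks of exchangeable families -/

section Exchangeable

variable {ι κ : Type*} [Fintype ι] [Fintype κ]

lemma exists_perm_lt_iff_lt {v v' : ι → ℝ} (hv : Function.Injective v)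
    (hv' : Function.Injective v') :
    ∃ τ : Equiv.Perm ι, ∀ i j, v i < v j ↔ v' (τ i) < v' (τ j) := by
  let e := Fintype.equivFin ι
  have key : ∀ u : ι → ℝ, Function.Injective u →
      StrictMono ((u ∘ e.symm) ∘ Tuple.sort (u ∘ e.symm)) := fun u hu =>
    (Tuple.monotone_sort _).strictMono_of_injective
      ((hu.comp e.symm.injective).comp (Equiv.injective _))
  have h1 := key v hv
  have h2 := key v' hv'
  set σ := Tuple.sort (v ∘ e.symm)
  set σ' := Tuple.sort (v' ∘ e.symm)
  refine ⟨((e.trans σ.symm).trans σ').trans e.symm, fun i j => ?_⟩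
  have h3 := h1.lt_iff_lt (a := σ.symm (e i)) (b := σ.symm (e j))
  have h4 := h2.lt_iff_lt (a := σ.symm (e i)) (b := σ.symm (e j))
  simp only [Function.comp_apply, Equiv.apply_symm_apply, Equiv.symm_apply_apply] at h3
  simp only [Function.comp_apply] at h4
  simpa using h3.trans h4.symm

/-- A symmetric function of an exchangeable family without ties is uncorrelated with every event
that depends only on the ranks: summing over all permutations of the entries, the rank event occurs
for a number of permutations that does not depend on the values of the family. -/
lemma setIntegral_symmetric_eq {ρ : Measure (ι → ℝ)} [IsProbabilityMeasure ρ]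
    (hρ : ∀ σ : Equiv.Perm ι, MeasurePreserving (fun v : ι → ℝ => v ∘ σ) ρ ρ)
    (hinj : ∀ᵐ v ∂ρ, Function.Injective v) {A : Set (ι → ℝ)} (hAm : MeasurableSet A)
    (hA : ∀ v v' : ι → ℝ, (∀ i j, v i < v j ↔ v' i < v' j) → (v ∈ A ↔ v' ∈ A))
    {H : (ι → ℝ) → ℝ} (hH : Integrable H ρ) (hsymm : ∀ (σ : Equiv.Perm ι) v, H (v ∘ σ) = H v) :
    ∫ v in A, H v ∂ρ = (∫ v, H v ∂ρ) * ρ.real A := by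
  classical
  obtain ⟨v₀, hv₀⟩ := hinj.exists
  let N : (ι → ℝ) → ℝ := fun v => ∑ σ : Equiv.Perm ι, A.indicator 1 (v ∘ σ)
  have hN : ∀ v, Function.Injective v → N v = N v₀ := by
    intro v hv
    obtain ⟨τ, hτ⟩ := exists_perm_lt_iff_lt hv hv₀
    have : ∀ σ : Equiv.Perm ι, A.indicator (1 : (ι → ℝ) → ℝ) (v ∘ σ) =
        A.indicator 1 (v₀ ∘ (τ * σ : Equiv.Perm ι)) := by
      intro σ
      have := hA (v ∘ σ) (v₀ ∘ (τ * σ : Equiv.Perm ι)) fun i j => hτ _ _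
      simp only [Set.indicator, this]
      rfl
    simp only [N, this]
    exact Equiv.sum_comp (Equiv.mulLeft τ) fun σ => A.indicator 1 (v₀ ∘ σ)
  have key : ∀ K : (ι → ℝ) → ℝ, Integrable K ρ → (∀ (σ : Equiv.Perm ι) v, K (v ∘ σ) = K v) →
      (Fintype.card (Equiv.Perm ι) : ℝ) * ∫ v in A, K v ∂ρ = N v₀ * ∫ v, K v ∂ρ := by
    intro K hK hKs
    have h1 : ∀ σ : Equiv.Perm ι, ∫ v, A.indicator 1 (v ∘ σ) * K v ∂ρ = ∫ v in A, K v ∂ρ := by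
      intro σ
      rw [← integral_indicator hAm]
      have hmp := hρ σ
      have := integral_map (μ := ρ) hmp.measurable.aemeasurable (f := A.indicator K)
        (by rw [hmp.map_eq]; exact (hK.indicator hAm).aestronglyMeasurable)
      rw [hmp.map_eq] at this
      rw [this]
      refine integral_congr_ae (Eventually.of_forall fun v => ?_)
      by_cases hv : v ∘ σ ∈ A
      · simp [hv, hKs]
      · simp [hv]
    have h2 : ∀ σ : Equiv.Perm ι, Integrable (fun v => A.indicator 1 (v ∘ σ) * K v) ρ := by
      intro σ
      have : (fun v => A.indicator 1 (v ∘ σ) * K v) =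
          ((fun v : ι → ℝ => v ∘ σ) ⁻¹' A).indicator K := by
        ext v
        by_cases hv : v ∘ σ ∈ A
        · simp [hv]
        · simp [hv]
      rw [this]
      exact hK.indicator ((hρ σ).measurable hAm)
    rw [← integral_const_mul (N v₀), ← nsmul_eq_mul, ← Finset.card_univ, ← Finset.sum_const]
    rw [← Finset.sum_congr rfl fun σ _ => h1 σ, ← integral_finsetSum _ fun σ _ => h2 σ]
    refine integral_congr_ae ?_
    filter_upwards [hinj] with v hv
    rw [← hN v hv, Finset.sum_mul]
  have h1 := key H hH hsymm
  have h2 := key (fun _ => 1) (integrable_const _) fun _ _ => rfl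
  simp only [measureReal_restrict_apply_univ, smul_eq_mul, mul_one, integral_const, probReal_univ] at h2
  have hc : (Fintype.card (Equiv.Perm ι) : ℝ) ≠ 0 := by
    exact_mod_cast Fintype.card_ne_zero
  rw [← h2] at h1
  refine mul_left_cancel₀ hc (h1.trans ?_)
  ring

lemma measurePreserving_comp_equiv (μ : Measure ℝ) [SigmaFinite μ] (e : ι ≃ κ) :
    MeasurePreserving (fun v : κ → ℝ => v ∘ e) (Measure.pi fun _ : κ => μ)
      (Measure.pi fun _ : ι => μ) := by
  have := measurePreserving_piCongrLeft (fun _ : ι => μ) e.symm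
  have h : (fun v : κ → ℝ => v ∘ e) = MeasurableEquiv.piCongrLeft (fun _ : ι => ℝ) e.symm := by
    ext v i
    obtain ⟨j, rfl⟩ := e.symm.surjective i
    rw [MeasurableEquiv.piCongrLeft_apply_apply]
    simp
  rw [h]
  exact this

/-- The uniform distribution on the unit interval. -/
noncomputable def unif : Measure ℝ := volume.restrict (Ioo 0 1)

instance : IsProbabilityMeasure unif := ⟨by simp [unif]⟩

lemma pi_unif (ι : Type*) [Fintype ι] :
    (Measure.pi fun _ : ι => unif) = volume.restrict (Set.univ.pi fun _ => Ioo 0 1) := by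
  rw [volume_pi, Measure.restrict_pi_pi]
  rfl

lemma ae_injective_pi_unif (ι : Type*) [Fintype ι] :
    ∀ᵐ v ∂(Measure.pi fun _ : ι => unif), Function.Injective v := by
  rw [pi_unif]
  refine ae_restrict_of_ae ?_
  have : ∀ i j : ι, i ≠ j → ∀ᵐ v : ι → ℝ, v i ≠ v j := by
    intro i j hij
    classical
    let S : Submodule ℝ (ι → ℝ) := LinearMap.ker
      (LinearMap.proj (R := ℝ) (φ := fun _ : ι => ℝ) i - LinearMap.proj j)
    have hS : S ≠ ⊤ := by
      intro h
      have : Pi.single i (1 : ℝ) ∈ S := h ▸ Submodule.mem_top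
      simp [S, hij.symm] at this
    have h0 := Measure.addHaar_submodule volume S hS
    rw [ae_iff]
    convert h0 using 2
    ext v
    simp [S, sub_eq_zero]
  have h2 : ∀ᵐ v : ι → ℝ, ∀ i j : ι, i ≠ j → v i ≠ v j := by
    rw [ae_all_iff]
    intro i
    rw [ae_all_iff]
    intro j
    by_cases hij : i = j
    · simp [hij]
    · filter_upwards [this i j hij] with v hv _ using hv
  filter_upwards [h2] with v hv i j hij
  by_contra hne
  exact hv i j hne hij

end Exchangeable

/-! ### Quantile functions -/

/-- The quantile function of `ν` in terms of the upper tail: the smallest `x` such that `ν` puts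
mass at most `v` on `(x, ∞)`. It is used for `0 < v < 1` and set to `0` elsewhere. -/
noncomputable def quantile (ν : Measure ℝ) (v : ℝ) : ℝ :=
  open Classical in if v ∈ Ioo (0 : ℝ) 1 then sInf {x | ν.real (Ioi x) ≤ v} else 0

section Quantile

variable {ν : Measure ℝ} [IsProbabilityMeasure ν]

lemma tail_eq_one_sub_cdf (ν : Measure ℝ) [IsProbabilityMeasure ν] (x : ℝ) :
    ν.real (Ioi x) = 1 - cdf ν x := by
  rw [cdf_eq_real, ← compl_Iic, probReal_compl_eq_one_sub measurableSet_Iic]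

lemma quantile_le_iff {v : ℝ} (hv : v ∈ Ioo (0 : ℝ) 1) (x : ℝ) :
    quantile ν v ≤ x ↔ ν.real (Ioi x) ≤ v := by
  have hanti : Antitone fun x => ν.real (Ioi x) := fun x y hxy =>
    measureReal_mono (Ioi_subset_Ioi hxy)
  have hne : {x | ν.real (Ioi x) ≤ v}.Nonempty := by
    obtain ⟨x, hx⟩ := (((tendsto_cdf_atTop ν).const_sub 1).eventually_lt_const
      (u := v) (by simpa using hv.1)).exists
    exact ⟨x, by rw [Set.mem_ofPred_eq, tail_eq_one_sub_cdf]; exact hx.le⟩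
  have hbdd : BddBelow {x | ν.real (Ioi x) ≤ v} := by
    obtain ⟨y, hy⟩ := (((tendsto_cdf_atBot ν).const_sub 1).eventually_const_lt
      (u := v) (by simpa using hv.2)).exists
    refine ⟨y, fun x hx => ?_⟩
    by_contra! hlt
    have h1 := hanti hlt.le
    simp only [tail_eq_one_sub_cdf] at h1
    rw [Set.mem_ofPred_eq, tail_eq_one_sub_cdf] at hx
    linarith
  rw [quantile, if_pos hv]
  constructor
  · intro h
    have hx : ∀ y, x < y → ν.real (Ioi y) ≤ v := by
      intro y hy
      obtain ⟨z, hz, hzy⟩ := exists_lt_of_csInf_lt hne (h.trans_lt hy)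
      exact (hanti hzy.le).trans hz
    have hlim : Tendsto (fun y => 1 - cdf ν y) (𝓝[>] x) (𝓝 (1 - cdf ν x)) :=
      (((cdf ν).right_continuous x).mono Ioi_subset_Ici_self).const_sub 1
    rw [tail_eq_one_sub_cdf]
    refine le_of_tendsto hlim ?_
    filter_upwards [self_mem_nhdsWithin] with y hy
    rw [← tail_eq_one_sub_cdf]
    exact hx y hy
  · intro h
    exact csInf_le hbdd h

lemma measurable_quantile : Measurable (quantile ν) := by
  refine measurable_of_Iic fun x => ?_
  have : quantile ν ⁻¹' Iic x = (Ioo 0 1 ∩ Ici (ν.real (Ioi x))) ∪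
      ((Ioo 0 1)ᶜ ∩ {_v | (0 : ℝ) ≤ x}) := by
    ext v
    by_cases hv : v ∈ Ioo (0 : ℝ) 1
    · simp only [mem_preimage, mem_Iic, quantile_le_iff hv, mem_union, mem_inter_iff, hv, true_and,
        mem_Ici, mem_compl_iff, not_true, false_and, or_false]
    · have h0 : quantile ν v = 0 := if_neg hv
      simp [h0, hv]
  rw [this]
  exact (measurableSet_Ioo.inter measurableSet_Ici).union
    (measurableSet_Ioo.compl.inter (MeasurableSet.const _))

lemma map_quantile_unif : unif.map (quantile ν) = ν := by
  have : IsProbabilityMeasure (unif.map (quantile ν)) :=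
    Measure.isProbabilityMeasure_map measurable_quantile.aemeasurable
  refine Measure.ext_of_Iic _ _ fun x => ?_
  rw [Measure.map_apply measurable_quantile measurableSet_Iic, unif,
    Measure.restrict_apply (measurable_quantile measurableSet_Iic)]
  have h0 : 0 ≤ ν.real (Ioi x) := measureReal_nonneg
  have h1 : ν.real (Ioi x) ≤ 1 := measureReal_le_one
  have heq : (quantile ν ⁻¹' Iic x ∩ Ioo 0 1 : Set ℝ) =ᵐ[volume] Ioo (ν.real (Ioi x)) 1 := by
    have : quantile ν ⁻¹' Iic x ∩ Ioo 0 1 = Ici (ν.real (Ioi x)) ∩ Ioo 0 1 := by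
      ext v
      simp only [mem_inter_iff, mem_preimage, mem_Iic, mem_Ici]
      exact and_congr_left fun hv => quantile_le_iff hv x
    rw [this]
    have h2 : Ioi (ν.real (Ioi x)) ∩ Ioo 0 1 = Ioo (ν.real (Ioi x)) 1 := by
      ext v
      simp only [mem_inter_iff, mem_Ioi, mem_Ioo]
      exact ⟨fun h => ⟨h.1, h.2.2⟩, fun h => ⟨h.1, h0.trans_lt h.1, h.2⟩⟩
    rw [← h2]
    exact (Ioi_ae_eq_Ici.symm).inter (ae_eq_refl _)
  rw [measure_congr heq, Real.volume_Ioo, tail_eq_one_sub_cdf, sub_sub_cancel, ofReal_cdf]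

lemma quantile_nonneg (hν : ν (Iio 0) = 0) (v : ℝ) : 0 ≤ quantile ν v := by
  by_cases hv : v ∈ Ioo (0 : ℝ) 1
  · by_contra! hlt
    obtain ⟨x, hx1, hx2⟩ := exists_between hlt
    have h1 := (quantile_le_iff hv x).1 hx1.le
    have h2 : ν (Iic x) = 0 := measure_mono_null (fun y hy => lt_of_le_of_lt hy hx2) hν
    rw [tail_eq_one_sub_cdf, cdf_eq_real, measureReal_def, h2] at h1
    simp only [ENNReal.toReal_zero, sub_zero] at h1
    linarith [hv.2]
  · exact (if_neg hv).ge

lemma quantile_anti {u v : ℝ} (hu : u ∈ Ioo (0 : ℝ) 1) (hv : v ∈ Ioo (0 : ℝ) 1) (h : u ≤ v) :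
    quantile ν v ≤ quantile ν u := by
  rw [quantile_le_iff hv]
  exact ((quantile_le_iff hu _).1 le_rfl).trans h

end Quantile


/-! ### Ratios of order statistics of an independent family -/

/-- For a finite family `x` with order statistics `x₀ ≥ x₁ ≥ ⋯`, the vector
`((∑ x - (x₀ + ⋯ + xₙ)) / xₙ; x₀ / xₙ, …, xₙ₋₁ / xₙ)`. -/
noncomputable def ratioStat {ι : Type*} [Fintype ι] (n : ℕ) (x : ι → ℝ) : ℝ × (Fin n → ℝ) :=
  ((∑ i, x i - ∑ k ∈ Finset.range (n + 1), topStat x k) / topStat x n,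
    fun i => topStat x i / topStat x n)

/-- The test functional `ψ(xₙ) φ(x₀ / xₙ, …, xₙ₋₁ / xₙ) exp(-w R)`, where `R` is the first component
of `ratioStat n x`. -/
noncomputable def ratioFunctional {ι : Type*} [Fintype ι] {n : ℕ} (ψ : ℝ →ᵇ ℝ)
    (φ : (Fin n → ℝ) →ᵇ ℝ) (w : ℝ) (x : ι → ℝ) : ℝ :=
  ψ (topStat x n) * φ (ratioStat n x).2 * Real.exp (-(w * (ratioStat n x).1))

section RatioFunctional

variable {ι κ : Type*} [Fintype ι] [Fintype κ] {n : ℕ} (ψ : ℝ →ᵇ ℝ) (φ : (Fin n → ℝ) →ᵇ ℝ) (w : ℝ)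

lemma ratioStat_comp_equiv (x : ι → ℝ) (e : κ ≃ ι) : ratioStat n (x ∘ e) = ratioStat n x := by
  simp only [ratioStat, topStat_comp_equiv, Function.comp_apply, Equiv.sum_comp e x]

lemma ratioFunctional_comp_equiv (x : ι → ℝ) (e : κ ≃ ι) :
    ratioFunctional ψ φ w (x ∘ e) = ratioFunctional ψ φ w x := by
  simp only [ratioFunctional, ratioStat_comp_equiv, topStat_comp_equiv]

lemma measurable_ratioStat : Measurable fun x : ι → ℝ => ratioStat n x := by
  unfold ratioStat
  have := fun k => measurable_topStat (ι := ι) k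
  fun_prop

lemma measurable_ratioFunctional : Measurable fun x : ι → ℝ => ratioFunctional ψ φ w x := by
  unfold ratioFunctional
  have h1 := measurable_ratioStat (ι := ι) (n := n)
  have h2 := measurable_topStat (ι := ι) n
  exact ((ψ.continuous.measurable.comp h2).mul (φ.continuous.measurable.comp h1.snd)).mul
    (Real.measurable_exp.comp (h1.fst.const_mul w).neg)

lemma ratioStat_fst_nonneg {x : ι → ℝ} (hx : ∀ i, 0 ≤ x i) (hn : n < Fintype.card ι) :
    0 ≤ (ratioStat n x).1 :=
  div_nonneg (sub_nonneg.2 (sum_range_topStat_le hx hn)) (topStat_nonneg hx n)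

variable {w} in
lemma abs_ratioFunctional_le (hw : 0 ≤ w) {x : ι → ℝ} (hx : ∀ i, 0 ≤ x i)
    (hn : n < Fintype.card ι) : |ratioFunctional ψ φ w x| ≤ ‖ψ‖ * ‖φ‖ := by
  unfold ratioFunctional
  have h1 : Real.exp (-(w * (ratioStat n x).1)) ≤ 1 :=
    Real.exp_le_one_iff.2 (neg_nonpos.2 (mul_nonneg hw (ratioStat_fst_nonneg hx hn)))
  rw [abs_mul, abs_mul, Real.abs_exp]
  refine (mul_le_of_le_one_right (by positivity) h1).trans ?_
  exact mul_le_mul (ψ.norm_coe_le_norm _) (φ.norm_coe_le_norm _) (abs_nonneg _) (norm_nonneg _)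

lemma ratioStat_sumElim {r : ℕ} {a : Fin n → ℝ} {q : ℝ} {b : Fin r → ℝ} (ha : ∀ i, q ≤ a i)
    (hb : ∀ i, b i ≤ q) :
    ratioStat n (Sum.elim (fun _ : Unit => q) (Sum.elim a b)) =
      ((∑ k, b k) / q, fun i : Fin n => topStat a i / q) := by
  have h1 : topStat (Sum.elim (fun _ : Unit => q) (Sum.elim a b)) n = q := by
    simpa using topStat_sumElim_eq ha hb
  have h2 : ∀ k < n, topStat (Sum.elim (fun _ : Unit => q) (Sum.elim a b)) k = topStat a k :=
    fun k hk => topStat_sumElim_of_lt ha hb (by simpa using hk)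
  have h3 : ∑ k ∈ Finset.range n, topStat (Sum.elim (fun _ : Unit => q) (Sum.elim a b)) k =
      ∑ i, a i := by
    rw [Finset.sum_congr rfl fun k hk => h2 k (Finset.mem_range.1 hk)]
    simpa using sum_topStat a
  unfold ratioStat
  rw [Finset.sum_range_succ, h3, h1]
  refine Prod.ext ?_ (funext fun i => ?_)
  · simp only [Fintype.sum_sum_type, Sum.elim_inl, Sum.elim_inr, Finset.univ_unique,
      Finset.sum_singleton]
    congr 1
    ring
  · simp only [h2 i i.2]

lemma ratioFunctional_sumElim {r : ℕ} {a : Fin n → ℝ} {q : ℝ} {b : Fin r → ℝ}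
    (ha : ∀ i, q ≤ a i) (hb : ∀ i, b i ≤ q) :
    ratioFunctional ψ φ w (Sum.elim (fun _ : Unit => q) (Sum.elim a b)) =
      ψ q * φ (fun i : Fin n => topStat a i / q) * ∏ k, Real.exp (-(w * (b k / q))) := by
  have h1 : topStat (Sum.elim (fun _ : Unit => q) (Sum.elim a b)) n = q := by
    simpa using topStat_sumElim_eq ha hb
  rw [ratioFunctional, ratioStat_sumElim ha hb, h1, ← Real.exp_sum]
  simp only [Finset.sum_neg_distrib, ← Finset.mul_sum, Finset.sum_div]

end RatioFunctional

/-- The event that, in a family made of one distinguished entry, `n` entries and `r` entries, the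
`n` entries are smaller and the `r` entries are larger than the distinguished one. -/
def rankEvent (n r : ℕ) : Set (Unit ⊕ (Fin n ⊕ Fin r) → ℝ) :=
  {v | (∀ i, v (.inr (.inl i)) < v (.inl ())) ∧ ∀ k, v (.inl ()) < v (.inr (.inr k))}

section RankEvent

variable {n r : ℕ}

lemma measurableSet_rankEvent : MeasurableSet (rankEvent n r) := by
  simp only [rankEvent, Set.ofPred_and, Set.ofPred_forall]
  exact (MeasurableSet.iInter fun i => measurableSet_lt (by fun_prop) (by fun_prop)).inter
    (MeasurableSet.iInter fun i => measurableSet_lt (by fun_prop) (by fun_prop))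

lemma integral_pi_sumElim {ι κ : Type*} [Fintype ι] [Fintype κ] (μ : Measure ℝ)
    [IsProbabilityMeasure μ] (f : (ι ⊕ κ → ℝ) → ℝ) :
    ∫ v, f v ∂(Measure.pi fun _ => μ) =
      ∫ z : (ι → ℝ) × (κ → ℝ), f (Sum.elim z.1 z.2)
        ∂((Measure.pi fun _ => μ).prod (Measure.pi fun _ => μ)) := by
  have h := measurePreserving_sumPiEquivProdPi_symm (X := fun _ : ι ⊕ κ => ℝ) fun _ => μ
  rw [← h.integral_comp']
  refine integral_congr_ae (Eventually.of_forall fun z => ?_)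
  change f _ = f _
  congr 1

/-- Integration over a rank event: given the value `v` of the distinguished entry, the other entries
are independent and uniform on `(0, v)` or `(v, 1)`. -/
lemma setIntegral_rankEvent {F : ℝ → (Fin n → ℝ) → ℝ} {k : ℝ → ℝ → ℝ}
    (hF : Measurable (Function.uncurry F)) (hk : Measurable (Function.uncurry k)) {C : ℝ}
    (hFC : ∀ v a, |F v a| ≤ C) (hk1 : ∀ v s, |k v s| ≤ 1) :
    ∫ v in rankEvent n r, F (v (.inl ())) (fun i => v (.inr (.inl i))) *
        ∏ j, k (v (.inl ())) (v (.inr (.inr j))) ∂(Measure.pi fun _ => unif) =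
      ∫ v in Ioo 0 1, (∫ a in Set.univ.pi fun _ => Ioo 0 v, F v a) * (∫ s in Ioo v 1, k v s) ^ r := by
  classical
  set πn : Measure (Fin n → ℝ) := Measure.pi fun _ => unif with hπn
  set πr : Measure (Fin r → ℝ) := Measure.pi fun _ => unif with hπr
  let F' : ℝ → (Fin n → ℝ) → ℝ := fun v a => ({a : Fin n → ℝ | ∀ i, a i < v}).indicator (F v) a
  let k' : ℝ → ℝ → ℝ := fun v s => (Ioi v).indicator (k v) s
  have hC : 0 ≤ C := (abs_nonneg _).trans (hFC 0 0)
  have hF'm : Measurable (Function.uncurry F') := by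
    have hS : MeasurableSet {z : ℝ × (Fin n → ℝ) | ∀ i, z.2 i < z.1} := by
      simp only [Set.ofPred_forall]
      exact MeasurableSet.iInter fun i => measurableSet_lt (by fun_prop) (by fun_prop)
    exact hF.indicator hS
  have hk'm : Measurable (Function.uncurry k') := by
    have hS : MeasurableSet {z : ℝ × ℝ | z.1 < z.2} := measurableSet_lt measurable_fst measurable_snd
    exact hk.indicator hS
  have hF'C : ∀ v a, |F' v a| ≤ C := fun v a => by
    simp only [F', Set.indicator]
    split_ifs
    · exact hFC v a
    · simpa using hC
  have hk'1 : ∀ v s, |k' v s| ≤ 1 := fun v s => by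
    simp only [k', Set.indicator]
    split_ifs
    · exact hk1 v s
    · simp
  have hmeas : Measurable fun z : ℝ × ((Fin n → ℝ) × (Fin r → ℝ)) =>
      F' z.1 z.2.1 * ∏ j, k' z.1 (z.2.2 j) := by
    refine Measurable.mul (hF'm.comp (measurable_fst.prodMk (measurable_fst.comp measurable_snd))) ?_
    refine Finset.measurable_fun_prod _ fun j _ => ?_
    exact hk'm.comp (measurable_fst.prodMk
      ((measurable_pi_apply j).comp (measurable_snd.comp measurable_snd)))
  have hint : Integrable (fun z : ℝ × ((Fin n → ℝ) × (Fin r → ℝ)) =>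
      F' z.1 z.2.1 * ∏ j, k' z.1 (z.2.2 j)) (unif.prod (πn.prod πr)) := by
    refine Integrable.of_bound hmeas.aestronglyMeasurable C (Eventually.of_forall fun z => ?_)
    rw [Real.norm_eq_abs, abs_mul, Finset.abs_prod]
    refine (mul_le_of_le_one_right (abs_nonneg _) ?_).trans (hF'C _ _)
    exact Finset.prod_le_one (fun _ _ => abs_nonneg _) fun j _ => hk'1 _ _
  have hA : ∀ v : Unit ⊕ (Fin n ⊕ Fin r) → ℝ,
      (rankEvent n r).indicator (fun v => F (v (.inl ())) (fun i => v (.inr (.inl i))) *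
        ∏ j, k (v (.inl ())) (v (.inr (.inr j)))) v =
      F' (v (.inl ())) (fun i => v (.inr (.inl i))) *
        ∏ j, k' (v (.inl ())) (v (.inr (.inr j))) := by
    intro v
    by_cases h1 : ∀ i, v (.inr (.inl i)) < v (.inl ())
    · by_cases h2 : ∀ j, v (.inl ()) < v (.inr (.inr j))
      · have : v ∈ rankEvent n r := ⟨h1, h2⟩
        simp [this, F', k', h1, h2]
      · have : v ∉ rankEvent n r := fun h => h2 h.2
        push Not at h2
        obtain ⟨j, hj⟩ := h2
        rw [Set.indicator_of_notMem this, Finset.prod_eq_zero (Finset.mem_univ j), mul_zero]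
        simp [k', hj]
    · have : v ∉ rankEvent n r := fun h => h1 h.1
      simp [this, F', h1]
  rw [← integral_indicator measurableSet_rankEvent]
  simp_rw [hA]
  rw [integral_pi_sumElim unif]
  have h2 := (measurePreserving_sumPiEquivProdPi_symm (X := fun _ : Fin n ⊕ Fin r => ℝ)
    fun _ => unif)
  have h1 := (measurePreserving_funUnique unif Unit).symm
  have h12 := h1.prod h2
  have e : ∫ z : (Unit → ℝ) × (Fin n ⊕ Fin r → ℝ), F' (Sum.elim z.1 z.2 (.inl ()))
        (fun i => Sum.elim z.1 z.2 (.inr (.inl i))) *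
        ∏ j, k' (Sum.elim z.1 z.2 (.inl ())) (Sum.elim z.1 z.2 (.inr (.inr j)))
        ∂((Measure.pi fun _ => unif).prod (Measure.pi fun _ => unif)) =
      ∫ z : ℝ × ((Fin n → ℝ) × (Fin r → ℝ)), F' z.1 z.2.1 * ∏ j, k' z.1 (z.2.2 j)
        ∂(unif.prod (πn.prod πr)) := by
    rw [← h12.map_eq, integral_map h12.measurable.aemeasurable]
    · rfl
    · refine Measurable.aestronglyMeasurable ?_
      refine hmeas.comp (g := fun z : ℝ × ((Fin n → ℝ) × (Fin r → ℝ)) =>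
        F' z.1 z.2.1 * ∏ j, k' z.1 (z.2.2 j)) (f := fun z : (Unit → ℝ) × (Fin n ⊕ Fin r → ℝ) =>
        (z.1 (), ((fun i => z.2 (.inl i)), fun j => z.2 (.inr j)))) ?_
      fun_prop
  rw [e, integral_prod _ hint]
  rw [unif]
  refine setIntegral_congr_fun measurableSet_Ioo fun v hv => ?_
  change ∫ z : (Fin n → ℝ) × (Fin r → ℝ), F' v z.1 * ∏ j, k' v (z.2 j) ∂(πn.prod πr) = _
  rw [integral_prod_mul (fun a => F' v a) fun b : Fin r → ℝ => ∏ j, k' v (b j), hπr,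
    integral_fintype_prod_eq_pow, Fintype.card_fin]
  congr 1
  · have hS : MeasurableSet {a : Fin n → ℝ | ∀ i, a i < v} := by
      simp only [Set.ofPred_forall]
      exact MeasurableSet.iInter fun i => measurableSet_lt (by fun_prop) (by fun_prop)
    rw [hπn, pi_unif, integral_indicator hS, Measure.restrict_restrict hS]
    congr 2
    ext a
    simp only [mem_inter_iff, Set.mem_ofPred_eq, Set.mem_univ_pi, mem_Ioo]
    exact ⟨fun h i => ⟨(h.2 i).1, h.1 i⟩, fun h => ⟨fun i => (h i).2,
      fun i => ⟨(h i).1, (h i).2.trans hv.2⟩⟩⟩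
  · congr 1
    rw [unif, integral_indicator measurableSet_Ioi, Measure.restrict_restrict measurableSet_Ioi]
    congr 2
    ext s
    simp only [mem_inter_iff, mem_Ioi, mem_Ioo]
    exact ⟨fun h => ⟨h.1, h.2.2⟩, fun h => ⟨h.1, hv.1.trans h.1, h.2⟩⟩

lemma setIntegral_pi_Ioo (f : (Fin n → ℝ) → ℝ) {v : ℝ} (hv : 0 < v) :
    ∫ a in Set.univ.pi fun _ => Ioo 0 v, f a =
      v ^ n * ∫ u, f (fun i => v * u i) ∂(Measure.pi fun _ => unif) := by
  have h := Measure.setIntegral_comp_smul_of_pos (volume : Measure (Fin n → ℝ)) f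
    (Set.univ.pi fun _ => Ioo 0 1) hv
  have hs : v • (Set.univ.pi fun _ : Fin n => Ioo (0 : ℝ) 1) = Set.univ.pi fun _ => Ioo 0 v := by
    ext a
    rw [Set.mem_smul_set_iff_inv_smul_mem₀ hv.ne']
    simp only [Set.mem_univ_pi, Pi.smul_apply, smul_eq_mul, mem_Ioo]
    refine forall_congr' fun i => ?_
    rw [← div_eq_inv_mul, div_lt_one hv, lt_div_iff₀ hv, zero_mul]
  rw [hs, Module.finrank_fin_fun, smul_eq_mul] at h
  rw [pi_unif]
  symm
  change v ^ n * ∫ u in Set.univ.pi fun _ => Ioo 0 1, f (v • u) = _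
  rw [h, mul_inv_cancel_left₀ (pow_ne_zero _ hv.ne')]

end RankEvent


section RatioIdentity

variable {n : ℕ} (ψ : ℝ →ᵇ ℝ) (φ : (Fin n → ℝ) →ᵇ ℝ) {w : ℝ} {ν : Measure ℝ}
  [IsProbabilityMeasure ν]

/-- The conditional expectation of `ψ(q) φ(a₀ / q, …, aₙ₋₁ / q)` where `q` is the quantile at level
`v` and `a₀ ≥ ⋯ ≥ aₙ₋₁` are the ordered quantiles at independent uniform levels in `(0, v)`. -/
noncomputable def topFactor (ν : Measure ℝ) (ψ : ℝ →ᵇ ℝ) (φ : (Fin n → ℝ) →ᵇ ℝ) (v : ℝ) : ℝ :=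
  ∫ u : Fin n → ℝ, ψ (quantile ν v) *
    φ (fun i : Fin n => topStat (fun j : Fin n => quantile ν (v * u j)) i / quantile ν v)
    ∂(Measure.pi fun _ => unif)

/-- The joint law of the `n + 1` largest of `n + 1 + r` independent variables with law `ν` and of the
sum of the others, tested against `ratioFunctional`; `v` is the level of the `(n + 1)`-th largest
one. Conditioning on the ranks avoids all binomial coefficients. -/
lemma integral_ratioFunctional_mul (hν : ν (Iio 0) = 0) (hw : 0 ≤ w) (r : ℕ) :
    (∫ x, ratioFunctional ψ φ w x ∂(Measure.pi fun _ : Fin (n + 1 + r) => ν)) *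
        ∫ v in Ioo (0 : ℝ) 1, v ^ n * (1 - v) ^ r =
      ∫ v in Ioo (0 : ℝ) 1, v ^ n * topFactor ν ψ φ v *
        (∫ s in Ioo v 1, Real.exp (-(w * (quantile ν s / quantile ν v)))) ^ r := by
  let ι := Unit ⊕ (Fin n ⊕ Fin r)
  set Q := quantile ν with hQdef
  have hQm : Measurable Q := measurable_quantile
  have hQ0 : ∀ v, 0 ≤ Q v := quantile_nonneg hν
  have hcard : Fintype.card ι = n + 1 + r := by
    simp only [ι, Fintype.card_sum, Fintype.card_unit, Fintype.card_fin]
    omega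
  have hnι : n < Fintype.card ι := by omega
  let e : ι ≃ Fin (n + 1 + r) := Fintype.equivFinOfCardEq hcard
  let ρ : Measure (ι → ℝ) := Measure.pi fun _ => unif
  let H : (ι → ℝ) → ℝ := fun v => ratioFunctional ψ φ w (Q ∘ v)
  have hcompm : Measurable fun v : ι → ℝ => Q ∘ v :=
    measurable_pi_lambda _ fun i => hQm.comp (measurable_pi_apply i)
  have hHm : Measurable H := (measurable_ratioFunctional ψ φ w).comp hcompm
  have hHint : Integrable H ρ :=
    Integrable.of_bound hHm.aestronglyMeasurable (‖ψ‖ * ‖φ‖) (Eventually.of_forall fun v =>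
      abs_ratioFunctional_le ψ φ hw (fun i => hQ0 _) hnι)
  have hHtot : ∫ v, H v ∂ρ =
      ∫ x, ratioFunctional ψ φ w x ∂(Measure.pi fun _ : Fin (n + 1 + r) => ν) := by
    have h1 : (Measure.pi fun _ : ι => ν) = ρ.map fun v => Q ∘ v := by
      have := Measure.pi_map_pi (ι := ι) (μ := fun _ => unif) (f := fun _ => Q)
        (fun _ => hQm.aemeasurable)
      rw [map_quantile_unif] at this
      exact this.symm
    have h2 := measurePreserving_comp_equiv ν e
    rw [← integral_map (f := fun x => ratioFunctional ψ φ w x) hcompm.aemeasurable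
      (measurable_ratioFunctional ψ φ w).aestronglyMeasurable, ← h1, ← h2.map_eq,
      integral_map h2.measurable.aemeasurable
        (measurable_ratioFunctional ψ φ w).aestronglyMeasurable]
    simp only [ratioFunctional_comp_equiv]
  have hsym := setIntegral_symmetric_eq (ρ := ρ)
    (fun σ => measurePreserving_comp_equiv unif σ) (ae_injective_pi_unif ι)
    (A := rankEvent n r) measurableSet_rankEvent
    (fun v v' h => and_congr (forall_congr' fun _ => h _ _) (forall_congr' fun _ => h _ _)) hHint
    (fun σ v => ratioFunctional_comp_equiv ψ φ w (Q ∘ v) σ)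
  have hA : ρ.real (rankEvent n r) = ∫ v in Ioo (0 : ℝ) 1, v ^ n * (1 - v) ^ r := by
    have h := setIntegral_rankEvent (n := n) (r := r) (F := fun _ _ => 1) (k := fun _ _ => 1)
      measurable_const measurable_const (C := 1) (by simp) (by simp)
    simp only [Finset.prod_const_one, mul_one, integral_const, smul_eq_mul,
      measureReal_restrict_apply_univ] at h
    rw [h]
    refine setIntegral_congr_fun measurableSet_Ioo fun v hv => ?_
    have h1 := setIntegral_pi_Ioo (n := n) (fun _ => 1) hv.1
    simp only [integral_const, smul_eq_mul, mul_one, probReal_univ,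
      measureReal_restrict_apply_univ] at h1
    simp only [h1, Real.volume_real_Ioo_of_le hv.2.le]
  have hB : ∫ v in rankEvent n r, H v ∂ρ = ∫ v in Ioo (0 : ℝ) 1, v ^ n * topFactor ν ψ φ v *
        (∫ s in Ioo v 1, Real.exp (-(w * (Q s / Q v)))) ^ r := by
    have hFm : Measurable (Function.uncurry fun (v : ℝ) (a : Fin n → ℝ) => ψ (Q v) *
        φ (fun i : Fin n => topStat (fun j : Fin n => Q (a j)) i / Q v)) := by
      refine Measurable.mul ?_ ?_
      · exact ψ.continuous.measurable.comp (hQm.comp measurable_fst)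
      · refine φ.continuous.measurable.comp (measurable_pi_lambda _ fun i => ?_)
        refine Measurable.div ?_ (hQm.comp measurable_fst)
        exact (measurable_topStat i).comp (measurable_pi_lambda _ fun j =>
          hQm.comp ((measurable_pi_apply j).comp measurable_snd))
    have hkm : Measurable (Function.uncurry fun v s : ℝ => Real.exp (-(w * (Q s / Q v)))) := by
      have h1 : Measurable fun z : ℝ × ℝ => Q z.1 := hQm.comp measurable_fst
      have h2 : Measurable fun z : ℝ × ℝ => Q z.2 := hQm.comp measurable_snd
      exact Real.measurable_exp.comp ((h2.div h1).const_mul w).neg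
    have h := setIntegral_rankEvent (n := n) (r := r) hFm hkm (C := ‖ψ‖ * ‖φ‖)
      (fun v a => by
        rw [abs_mul]
        exact mul_le_mul (ψ.norm_coe_le_norm _) (φ.norm_coe_le_norm _) (abs_nonneg _)
          (norm_nonneg _))
      (fun v s => by
        rw [Real.abs_exp, Real.exp_le_one_iff]
        exact neg_nonpos.2 (mul_nonneg hw (div_nonneg (hQ0 _) (hQ0 _))))
    have hmem : ∀ᵐ v ∂ρ, ∀ i, v i ∈ Ioo (0 : ℝ) 1 := by
      have : ρ = volume.restrict (Set.univ.pi fun _ => Ioo 0 1) := pi_unif ι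
      rw [this]
      filter_upwards [ae_restrict_mem (MeasurableSet.univ_pi fun _ => measurableSet_Ioo)]
        with v hv i using hv i (Set.mem_univ i)
    have h0 : ∫ v in rankEvent n r, H v ∂ρ = ∫ v in rankEvent n r,
        ψ (Q (v (.inl ()))) * φ (fun i : Fin n => topStat (fun j : Fin n =>
          Q (v (.inr (.inl j)))) i / Q (v (.inl ()))) *
        ∏ j, Real.exp (-(w * (Q (v (.inr (.inr j))) / Q (v (.inl ()))))) ∂ρ := by
      refine setIntegral_congr_ae measurableSet_rankEvent ?_
      filter_upwards [hmem] with v hv hvA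
      have hsplit : Q ∘ v = Sum.elim (fun _ : Unit => Q (v (.inl ())))
          (Sum.elim (fun i => Q (v (.inr (.inl i)))) fun j => Q (v (.inr (.inr j)))) := by
        ext i
        rcases i with i | i | i <;> rfl
      simp only [H]
      rw [hsplit, ratioFunctional_sumElim]
      · exact fun i => quantile_anti (hv _) (hv _) (hvA.1 i).le
      · exact fun j => quantile_anti (hv _) (hv _) (hvA.2 j).le
    rw [h0, h]
    refine setIntegral_congr_fun measurableSet_Ioo fun v hv => ?_
    rw [setIntegral_pi_Ioo _ hv.1]
    rfl
  rw [hHtot, hA, hB] at hsym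
  exact hsym.symm

lemma setIntegral_Ioo_comp_div (f : ℝ → ℝ) (a b : ℝ) {m : ℝ} (hm : 0 < m) :
    ∫ y in Ioo (m * a) (m * b), f (y / m) = m * ∫ v in Ioo a b, f v := by
  have h := Measure.setIntegral_comp_smul_of_pos (volume : Measure ℝ) (fun y => f (y / m))
    (Ioo a b) hm
  have hs : m • Ioo a b = Ioo (m * a) (m * b) := by
    rw [LinearOrderedField.smul_Ioo hm]
  simp only [smul_eq_mul, Module.finrank_self, pow_one, hs, mul_div_cancel_left₀ _ hm.ne'] at h
  rw [h, mul_inv_cancel_left₀ hm.ne']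

/-- The identity `integral_ratioFunctional_mul` on the scale `v = y / m` of the extreme order
statistics of `m` variables. -/
lemma integral_ratioFunctional_mul_scaled (hν : ν (Iio 0) = 0) (hw : 0 ≤ w) (r : ℕ) {m : ℝ}
    (hm : 0 < m) :
    (∫ x, ratioFunctional ψ φ w x ∂(Measure.pi fun _ : Fin (n + 1 + r) => ν)) *
        ∫ y in Ioo 0 m, y ^ n * (1 - y / m) ^ r =
      ∫ y in Ioo 0 m, y ^ n * topFactor ν ψ φ (y / m) *
        ((∫ z in Ioo y m, Real.exp (-(w * (quantile ν (z / m) / quantile ν (y / m))))) / m) ^ r := by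
  have h := integral_ratioFunctional_mul ψ φ hν hw r
  have h1 := setIntegral_Ioo_comp_div (fun v => (m * v) ^ n * (1 - v) ^ r) 0 1 hm
  have h2 := setIntegral_Ioo_comp_div (fun v => (m * v) ^ n * topFactor ν ψ φ v *
        (∫ s in Ioo v 1, Real.exp (-(w * (quantile ν s / quantile ν v)))) ^ r) 0 1 hm
  simp only [mul_div_cancel₀ _ hm.ne', mul_zero, mul_one, mul_pow, mul_assoc,
    integral_const_mul] at h1 h2
  simp only [mul_assoc] at h ⊢
  have h3 : ∀ y, ∫ s in Ioo (y / m) 1, Real.exp (-(w * (quantile ν s / quantile ν (y / m)))) =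
      (∫ z in Ioo y m, Real.exp (-(w * (quantile ν (z / m) / quantile ν (y / m))))) / m := by
    intro y
    have := setIntegral_Ioo_comp_div
      (fun s => Real.exp (-(w * (quantile ν s / quantile ν (y / m))))) (y / m) 1 hm
    rw [mul_div_cancel₀ _ hm.ne', mul_one] at this
    rw [this, mul_div_cancel_left₀ _ hm.ne']
  simp only [h3] at h2
  rw [h1, h2, ← h]
  ring

end RatioIdentity


/-! ### The limit of the order statistics of a triangular array -/

lemma image_mul_rpow_neg_Ioo {α y : ℝ} (hα0 : 0 < α) (hy : 0 < y) :
    (fun u => y * u ^ (-α)) '' Ioo 0 1 = Ioi y := by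
  ext z
  simp only [mem_image, mem_Ioo, mem_Ioi]
  constructor
  · rintro ⟨u, ⟨h0, h1⟩, rfl⟩
    exact lt_mul_of_one_lt_right hy (Real.one_lt_rpow_of_pos_of_lt_one_of_neg h0 h1 (by linarith))
  · intro hz
    have hz0 : 0 < z := hy.trans hz
    refine ⟨(z / y) ^ (-α⁻¹), ⟨by positivity, ?_⟩, ?_⟩
    · exact Real.rpow_lt_one_of_one_lt_of_neg ((one_lt_div hy).2 hz)
        (neg_neg_of_pos (inv_pos.2 hα0))
    · rw [← Real.rpow_mul (by positivity), neg_mul_neg, inv_mul_cancel₀ hα0.ne', Real.rpow_one,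
        mul_div_cancel₀ _ hy.ne']

/-- The function `G` as an integral over the levels `z > y` of the smaller jumps; the substitution is
`z = y u ^ (-α)`. -/
lemma integral_Ioi_one_sub_exp {α y : ℝ} (hα0 : 0 < α) (hy : 0 < y) (w : ℝ) :
    ∫ z in Ioi y, (1 - Real.exp (-(w * (y / z) ^ (1 / α)))) = y * G α w := by
  have hd : ∀ u ∈ Ioo (0 : ℝ) 1, HasDerivWithinAt (fun u => y * u ^ (-α))
      (y * (-α * u ^ (-α - 1))) (Ioo 0 1) u := fun u hu =>
    ((Real.hasDerivAt_rpow_const (Or.inl hu.1.ne')).const_mul y).hasDerivWithinAt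
  have hinj : InjOn (fun u => y * u ^ (-α)) (Ioo 0 1) := by
    intro u hu v hv huv
    have := mul_left_cancel₀ hy.ne' huv
    exact (Real.rpow_left_inj hu.1.le hv.1.le (by linarith)).1 this
  rw [← image_mul_rpow_neg_Ioo hα0 hy,
    integral_image_eq_integral_abs_deriv_smul measurableSet_Ioo hd hinj, G,
    intervalIntegral.integral_of_le zero_le_one, integral_Ioc_eq_integral_Ioo,
    ← integral_const_mul, ← integral_const_mul]
  refine setIntegral_congr_fun measurableSet_Ioo fun u hu => ?_
  have hu0 := hu.1
  have h1 : (y / (y * u ^ (-α))) ^ (1 / α) = u := by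
    rw [Real.rpow_neg hu0.le, ← div_eq_mul_inv, div_div_cancel₀ hy.ne', ← Real.rpow_mul hu0.le,
      mul_one_div_cancel hα0.ne', Real.rpow_one]
  have h2 : |y * (-α * u ^ (-α - 1))| = y * (α * u ^ (-α - 1)) := by
    rw [neg_mul, mul_neg, abs_neg, abs_of_nonneg (by positivity)]
  have h3 : u ^ (-α - 1) = (u ^ (1 + α))⁻¹ := by
    rw [← Real.rpow_neg hu0.le]
    congr 1
    ring
  simp only [smul_eq_mul, h1]
  rw [h2, h3]
  ring

lemma G_nonneg {α w : ℝ} (hα0 : 0 < α) (hw : 0 ≤ w) : 0 ≤ G α w := by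
  refine mul_nonneg hα0.le (intervalIntegral.integral_nonneg zero_le_one fun u hu => ?_)
  refine div_nonneg (sub_nonneg.2 (Real.exp_le_one_iff.2 ?_)) (Real.rpow_nonneg hu.1 _)
  exact neg_nonpos.2 (mul_nonneg hw hu.1)

lemma G_zero (α : ℝ) : G α 0 = 0 := by simp [G]

/-- A triangular array of laws on `[0, ∞)`, the `r`-th of which is used for `n + 1 + r` independent
variables, whose rescaled tails converge to `t / x ^ α` and are dominated by a multiple of it. -/
structure IsStableArray (α t C : ℝ) (n : ℕ) (ν : ℕ → Measure ℝ) : Prop where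
  prob : ∀ r, IsProbabilityMeasure (ν r)
  nonneg : ∀ r, ν r (Iio 0) = 0
  tendsto_tail : ∀ x, 0 < x →
    Tendsto (fun r : ℕ => ((n : ℝ) + 1 + r) * (ν r).real (Ioi x)) atTop (𝓝 (t / x ^ α))
  tail_le : ∀ (r : ℕ) (x : ℝ), 0 < x → ((n : ℝ) + 1 + r) * (ν r).real (Ioi x) ≤ C / x ^ α

section StableArray

variable {α t C : ℝ} {n : ℕ} {ν : ℕ → Measure ℝ}

lemma tendsto_size_atTop (n : ℕ) : Tendsto (fun r : ℕ => (n : ℝ) + 1 + r) atTop atTop :=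
  tendsto_atTop_add_const_left _ _ tendsto_natCast_atTop_atTop

lemma div_mem_Ioo {y m : ℝ} (hy : 0 < y) (hym : y < m) : y / m ∈ Ioo (0 : ℝ) 1 :=
  ⟨div_pos hy (hy.trans hym), (div_lt_one (hy.trans hym)).2 hym⟩

lemma div_rpow_one_div_rpow {α a y : ℝ} (hα0 : 0 < α) (ha : 0 ≤ a) (hy : 0 < y) :
    ((a / y) ^ (1 / α)) ^ α = a / y := by
  rw [← Real.rpow_mul (by positivity), one_div_mul_cancel hα0.ne', Real.rpow_one]

lemma quantile_le_of_tail_le {μ : Measure ℝ} [IsProbabilityMeasure μ] {y m x : ℝ} (hy : 0 < y)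
    (hym : y < m) (h : m * μ.real (Ioi x) ≤ y) : quantile μ (y / m) ≤ x := by
  rw [quantile_le_iff (div_mem_Ioo hy hym), le_div_iff₀' (hy.trans hym)]
  exact h

lemma lt_quantile_of_lt_tail {μ : Measure ℝ} [IsProbabilityMeasure μ] {y m x : ℝ} (hy : 0 < y)
    (hym : y < m) (h : y < m * μ.real (Ioi x)) : x < quantile μ (y / m) := by
  rw [← not_le, quantile_le_iff (div_mem_Ioo hy hym), le_div_iff₀' (hy.trans hym), not_le]
  exact h

lemma IsStableArray.quantile_le (h : IsStableArray α t C n ν) (hα0 : 0 < α) (hC : 0 < C) (r : ℕ)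
    {y : ℝ} (hy : 0 < y) (hym : y < (n : ℝ) + 1 + r) :
    quantile (ν r) (y / ((n : ℝ) + 1 + r)) ≤ (C / y) ^ (1 / α) := by
  have := h.prob r
  refine quantile_le_of_tail_le hy hym ((h.tail_le r _ (by positivity)).trans ?_)
  rw [div_rpow_one_div_rpow hα0 hC.le hy, div_div_cancel₀ hC.ne']

lemma IsStableArray.tendsto_quantile (h : IsStableArray α t C n ν) (hα0 : 0 < α) (ht : 0 < t)
    {y : ℝ} (hy : 0 < y) :
    Tendsto (fun r : ℕ => quantile (ν r) (y / ((n : ℝ) + 1 + r))) atTop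
      (𝓝 ((t / y) ^ (1 / α))) := by
  have hlarge := (tendsto_size_atTop n).eventually_gt_atTop y
  have hpos : 0 < (t / y) ^ (1 / α) := by positivity
  have hself : t / ((t / y) ^ (1 / α)) ^ α = y := by
    rw [div_rpow_one_div_rpow hα0 ht.le hy, div_div_cancel₀ ht.ne']
  refine tendsto_order.2 ⟨fun a ha => ?_, fun b hb => ?_⟩
  · obtain ⟨x, hax, hx⟩ := exists_between (max_lt ha hpos)
    have hx0 : 0 < x := (le_max_right _ _).trans_lt hax
    have hlt : y < t / x ^ α := by
      rw [← hself]
      gcongr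
    filter_upwards [(h.tendsto_tail x hx0).eventually_const_lt hlt, hlarge] with r hr hrl
    have := h.prob r
    exact ((le_max_left _ _).trans_lt hax).trans (lt_quantile_of_lt_tail hy hrl hr)
  · obtain ⟨x, hxl, hxb⟩ := exists_between hb
    have hx0 : 0 < x := hpos.trans hxl
    have hlt : t / x ^ α < y := by
      rw [← hself]
      gcongr
    filter_upwards [(h.tendsto_tail x hx0).eventually_lt_const hlt, hlarge] with r hr hrl
    have := h.prob r
    exact (quantile_le_of_tail_le hy hrl hr.le).trans_lt hxb

/-- The contribution of the smaller variables: dominated convergence, with a majorant that is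
integrable because `1 / α > 1`. -/
lemma IsStableArray.tendsto_integral_one_sub_exp (h : IsStableArray α t C n ν) (hα0 : 0 < α)
    (hα1 : α < 1) (ht : 0 < t) (hC : 0 < C) {w : ℝ} (hw : 0 ≤ w) {y : ℝ} (hy : 0 < y) :
    Tendsto (fun r : ℕ => ∫ z in Ioo y ((n : ℝ) + 1 + r),
      (1 - Real.exp (-(w * (quantile (ν r) (z / ((n : ℝ) + 1 + r)) /
        quantile (ν r) (y / ((n : ℝ) + 1 + r))))))) atTop (𝓝 (y * G α w)) := by
  rw [← integral_Ioi_one_sub_exp hα0 hy w]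
  have hq := h.tendsto_quantile hα0 ht hy
  set q := (t / y) ^ (1 / α) with hqdef
  have hqpos : 0 < q := by positivity
  have hform : ∀ r : ℕ, ∫ z in Ioo y ((n : ℝ) + 1 + r),
      (1 - Real.exp (-(w * (quantile (ν r) (z / ((n : ℝ) + 1 + r)) /
        quantile (ν r) (y / ((n : ℝ) + 1 + r)))))) =
      ∫ z in Ioi y, (Iio ((n : ℝ) + 1 + r)).indicator (fun z =>
        1 - Real.exp (-(w * (quantile (ν r) (z / ((n : ℝ) + 1 + r)) /
        quantile (ν r) (y / ((n : ℝ) + 1 + r)))))) z := by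
    intro r
    rw [integral_indicator measurableSet_Iio, Measure.restrict_restrict measurableSet_Iio,
      Iio_inter_Ioi]
  simp_rw [hform]
  refine tendsto_integral_filter_of_dominated_convergence
    (fun z => w * C ^ (1 / α) / (q / 2) * z ^ (-(1 / α))) ?_ ?_ ?_ ?_
  · refine Eventually.of_forall fun r => ?_
    have := h.prob r
    refine Measurable.aestronglyMeasurable (Measurable.indicator ?_ measurableSet_Iio)
    have : Measurable (quantile (ν r)) := measurable_quantile
    fun_prop
  · filter_upwards [hq.eventually_const_lt (half_lt_self hqpos)] with r hr
    have := h.prob r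
    refine (ae_restrict_iff' measurableSet_Ioi).2 (Eventually.of_forall fun z hz => ?_)
    have hz0 : 0 < z := hy.trans hz
    have hbd : 0 ≤ w * C ^ (1 / α) / (q / 2) * z ^ (-(1 / α)) := by positivity
    by_cases hzm : z < (n : ℝ) + 1 + r
    · rw [Set.indicator_of_mem (show z ∈ Iio _ from hzm)]
      have hQ := quantile_nonneg (h.nonneg r) (z / ((n : ℝ) + 1 + r))
      have hQC := h.quantile_le hα0 hC r hz0 hzm
      have hq' := hqpos.trans (show q < 2 * quantile (ν r) (y / ((n : ℝ) + 1 + r)) by linarith)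
      have harg : w * (quantile (ν r) (z / ((n : ℝ) + 1 + r)) /
          quantile (ν r) (y / ((n : ℝ) + 1 + r))) ≤
          w * C ^ (1 / α) / (q / 2) * z ^ (-(1 / α)) := by
        calc _ ≤ w * ((C / z) ^ (1 / α) / (q / 2)) := by gcongr
          _ = _ := by
            rw [Real.div_rpow hC.le hz0.le, Real.rpow_neg hz0.le]
            ring
      have harg0 : 0 ≤ w * (quantile (ν r) (z / ((n : ℝ) + 1 + r)) /
          quantile (ν r) (y / ((n : ℝ) + 1 + r))) :=
        mul_nonneg hw (div_nonneg hQ (by linarith))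
      have h1 := Real.add_one_le_exp (-(w * (quantile (ν r) (z / ((n : ℝ) + 1 + r)) /
          quantile (ν r) (y / ((n : ℝ) + 1 + r)))))
      rw [Real.norm_eq_abs, abs_of_nonneg
        (sub_nonneg.2 (Real.exp_le_one_iff.2 (neg_nonpos.2 harg0)))]
      linarith
    · rw [Set.indicator_of_notMem (show z ∉ Iio _ from hzm), norm_zero]
      exact hbd
  · refine Integrable.const_mul ?_ _
    exact integrableOn_Ioi_rpow_of_lt (neg_lt_neg ((one_lt_div hα0).2 hα1)) hy
  · refine (ae_restrict_iff' measurableSet_Ioi).2 (Eventually.of_forall fun z hz => ?_)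
    have hz0 : 0 < z := hy.trans hz
    have hlim : (t / z) ^ (1 / α) / q = (y / z) ^ (1 / α) := by
      rw [hqdef, ← Real.div_rpow (by positivity) (by positivity)]
      congr 1
      field_simp
    have h1 := ((h.tendsto_quantile hα0 ht hz0).div hq hqpos.ne').const_mul w
    rw [hlim] at h1
    have h2 := (Real.continuous_exp.tendsto _).comp h1.neg
    refine (h2.const_sub 1).congr' ?_
    filter_upwards [(tendsto_size_atTop n).eventually_gt_atTop z] with r hr
    rw [Set.indicator_of_mem (show z ∈ Iio _ from hr)]
    rfl

lemma setIntegral_Ioo_exp_eq {f : ℝ → ℝ} (hf : Measurable f) (hf0 : ∀ z, 0 ≤ f z) {y m : ℝ}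
    (hym : y ≤ m) : ∫ z in Ioo y m, Real.exp (-f z) =
      m - y - ∫ z in Ioo y m, (1 - Real.exp (-f z)) := by
  have hint : IntegrableOn (fun z => Real.exp (-f z)) (Ioo y m) :=
    Integrable.of_bound (Real.measurable_exp.comp hf.neg).aestronglyMeasurable 1
      (Eventually.of_forall fun z => by simpa using hf0 z)
  rw [integral_sub (integrable_const _) hint, setIntegral_const, smul_eq_mul, mul_one,
    Real.volume_real_Ioo_of_le hym]
  ring

lemma IsStableArray.tendsto_pow (h : IsStableArray α t C n ν) (hα0 : 0 < α)
    (hα1 : α < 1) (ht : 0 < t) (hC : 0 < C) {w : ℝ} (hw : 0 ≤ w) {y : ℝ} (hy : 0 < y) :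
    Tendsto (fun r : ℕ => ((∫ z in Ioo y ((n : ℝ) + 1 + r),
      Real.exp (-(w * (quantile (ν r) (z / ((n : ℝ) + 1 + r)) /
        quantile (ν r) (y / ((n : ℝ) + 1 + r)))))) / ((n : ℝ) + 1 + r)) ^ r) atTop
      (𝓝 (Real.exp (-((1 + G α w) * y)))) := by
  set D : ℕ → ℝ := fun r => ∫ z in Ioo y ((n : ℝ) + 1 + r),
      (1 - Real.exp (-(w * (quantile (ν r) (z / ((n : ℝ) + 1 + r)) /
        quantile (ν r) (y / ((n : ℝ) + 1 + r)))))) with hD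
  have hDlim : Tendsto D atTop (𝓝 (y * G α w)) :=
    h.tendsto_integral_one_sub_exp hα0 hα1 ht hC hw hy
  have hratio : Tendsto (fun r : ℕ => (r : ℝ) / ((n : ℝ) + 1 + r)) atTop (𝓝 1) := by
    have h1 : Tendsto (fun r : ℕ => 1 - ((n : ℝ) + 1) / ((n : ℝ) + 1 + r)) atTop (𝓝 (1 - 0)) :=
      (tendsto_const_nhds.div_atTop (tendsto_size_atTop n)).const_sub 1
    rw [sub_zero] at h1
    refine h1.congr fun r => ?_
    have : ((n : ℝ) + 1 + r) ≠ 0 := by positivity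
    field_simp
    ring
  have hg : Tendsto (fun r : ℕ => (r : ℝ) * (-(y + D r) / ((n : ℝ) + 1 + r))) atTop
      (𝓝 (-((1 + G α w) * y))) := by
    have h1 := hratio.mul (hDlim.const_add y).neg
    have e : (1 : ℝ) * -(y + y * G α w) = -((1 + G α w) * y) := by ring
    rw [e] at h1
    exact h1.congr fun r => by ring
  refine (Real.tendsto_one_add_pow_exp_of_tendsto hg).congr' ?_
  filter_upwards [(tendsto_size_atTop n).eventually_gt_atTop y] with r hr
  have := h.prob r
  have hm : ((n : ℝ) + 1 + r) ≠ 0 := by positivity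
  rw [setIntegral_Ioo_exp_eq (f := fun z => w * (quantile (ν r) (z / ((n : ℝ) + 1 + r)) /
        quantile (ν r) (y / ((n : ℝ) + 1 + r))))
    (by have : Measurable (quantile (ν r)) := measurable_quantile
        fun_prop)
    (fun z => mul_nonneg hw (div_nonneg (quantile_nonneg (h.nonneg r) _)
      (quantile_nonneg (h.nonneg r) _))) hr.le]
  congr 1
  change _ = (((n : ℝ) + 1 + r) - y - D r) / _
  field_simp
  ring

lemma IsStableArray.pow_le (h : IsStableArray α t C n ν) {w : ℝ} (hw : 0 ≤ w) {y : ℝ} (hy : 0 < y)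
    {r : ℕ} (hr : 1 ≤ r) (hym : y < (n : ℝ) + 1 + r) :
    |((∫ z in Ioo y ((n : ℝ) + 1 + r),
      Real.exp (-(w * (quantile (ν r) (z / ((n : ℝ) + 1 + r)) /
        quantile (ν r) (y / ((n : ℝ) + 1 + r)))))) / ((n : ℝ) + 1 + r)) ^ r| ≤
      Real.exp (-(1 / ((n : ℝ) + 2) * y)) := by
  have := h.prob r
  have hm : 0 < (n : ℝ) + 1 + r := by positivity
  have hQ := quantile_nonneg (h.nonneg r)
  have h0 : 0 ≤ ∫ z in Ioo y ((n : ℝ) + 1 + r),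
      Real.exp (-(w * (quantile (ν r) (z / ((n : ℝ) + 1 + r)) /
        quantile (ν r) (y / ((n : ℝ) + 1 + r))))) := integral_nonneg fun z => (Real.exp_pos _).le
  have h1 : ∫ z in Ioo y ((n : ℝ) + 1 + r),
      Real.exp (-(w * (quantile (ν r) (z / ((n : ℝ) + 1 + r)) /
        quantile (ν r) (y / ((n : ℝ) + 1 + r))))) ≤ (n : ℝ) + 1 + r - y := by
    have hnn : 0 ≤ ∫ z in Ioo y ((n : ℝ) + 1 + r),
      (1 - Real.exp (-(w * (quantile (ν r) (z / ((n : ℝ) + 1 + r)) /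
        quantile (ν r) (y / ((n : ℝ) + 1 + r)))))) := integral_nonneg fun z =>
          sub_nonneg.2 (Real.exp_le_one_iff.2 (neg_nonpos.2
            (mul_nonneg hw (div_nonneg (hQ _) (hQ _)))))
    rw [setIntegral_Ioo_exp_eq (f := fun z => w * (quantile (ν r) (z / ((n : ℝ) + 1 + r)) /
        quantile (ν r) (y / ((n : ℝ) + 1 + r))))
      (by have : Measurable (quantile (ν r)) := measurable_quantile
          fun_prop)
      (fun z => mul_nonneg hw (div_nonneg (hQ _) (hQ _))) hym.le]
    linarith
  rw [abs_of_nonneg (by positivity)]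
  have h2 : (∫ z in Ioo y ((n : ℝ) + 1 + r),
      Real.exp (-(w * (quantile (ν r) (z / ((n : ℝ) + 1 + r)) /
        quantile (ν r) (y / ((n : ℝ) + 1 + r)))))) / ((n : ℝ) + 1 + r) ≤
      Real.exp (-(y / ((n : ℝ) + 1 + r))) := by
    have h3 := Real.add_one_le_exp (-(y / ((n : ℝ) + 1 + r)))
    refine le_trans ?_ h3
    rw [div_le_iff₀ hm]
    have : (-(y / ((n : ℝ) + 1 + r)) + 1) * ((n : ℝ) + 1 + r) = (n : ℝ) + 1 + r - y := by
      field_simp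
      ring
    rw [this]
    exact h1
  refine (pow_le_pow_left₀ (by positivity) h2 r).trans ?_
  rw [← Real.exp_nat_mul, Real.exp_le_exp, mul_neg, neg_le_neg_iff]
  have h3 : 1 / ((n : ℝ) + 2) ≤ r / ((n : ℝ) + 1 + r) := by
    rw [div_le_div_iff₀ (by positivity) hm]
    have : (1 : ℝ) ≤ r := by exact_mod_cast hr
    nlinarith [(Nat.cast_nonneg n : (0 : ℝ) ≤ n)]
  calc 1 / ((n : ℝ) + 2) * y ≤ r / ((n : ℝ) + 1 + r) * y := by gcongr
    _ = r * (y / ((n : ℝ) + 1 + r)) := by ring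

end StableArray


section StableArrayLimit

variable {α t C : ℝ} {n : ℕ} {ν : ℕ → Measure ℝ}

lemma ae_pi_unif_mem (ι : Type*) [Fintype ι] :
    ∀ᵐ v ∂(Measure.pi fun _ : ι => unif), ∀ i, v i ∈ Ioo (0 : ℝ) 1 := by
  rw [pi_unif ι]
  filter_upwards [ae_restrict_mem (MeasurableSet.univ_pi fun _ => measurableSet_Ioo)]
    with v hv i using hv i (Set.mem_univ i)

lemma measurable_topFactor_integrand (ψ : ℝ →ᵇ ℝ) (φ : (Fin n → ℝ) →ᵇ ℝ) {Q : ℝ → ℝ}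
    (hQ : Measurable Q) : Measurable fun z : ℝ × (Fin n → ℝ) => ψ (Q z.1) *
      φ (fun i : Fin n => topStat (fun j : Fin n => Q (z.1 * z.2 j)) i / Q z.1) := by
  have h1 : Measurable fun z : ℝ × (Fin n → ℝ) => Q z.1 := hQ.comp measurable_fst
  refine (ψ.continuous.measurable.comp h1).mul
    (φ.continuous.measurable.comp (measurable_pi_lambda _ fun i => Measurable.div ?_ h1))
  exact (measurable_topStat i).comp (measurable_pi_lambda _ fun j => hQ.comp (by fun_prop))

lemma measurable_topFactor (ψ : ℝ →ᵇ ℝ) (φ : (Fin n → ℝ) →ᵇ ℝ) (μ : Measure ℝ)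
    [IsProbabilityMeasure μ] : Measurable (topFactor μ ψ φ) :=
  ((measurable_topFactor_integrand ψ φ
    measurable_quantile).stronglyMeasurable.integral_prod_right' (ν := Measure.pi fun _ => unif)).measurable

lemma abs_topFactor_le (ψ : ℝ →ᵇ ℝ) (φ : (Fin n → ℝ) →ᵇ ℝ) (μ : Measure ℝ) (v : ℝ) :
    |topFactor μ ψ φ v| ≤ ‖ψ‖ * ‖φ‖ := by
  unfold topFactor
  have := norm_integral_le_of_norm_le_const (μ := Measure.pi fun _ : Fin n => unif)
    (f := fun u : Fin n → ℝ => ψ (quantile μ v) *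
      φ (fun i : Fin n => topStat (fun j : Fin n => quantile μ (v * u j)) i / quantile μ v))
    (C := ‖ψ‖ * ‖φ‖) (Eventually.of_forall fun u => by
      rw [norm_mul]
      exact mul_le_mul (ψ.norm_coe_le_norm _) (φ.norm_coe_le_norm _) (norm_nonneg _)
        (norm_nonneg _))
  simpa using this

/-- The expectation of `φ` at the order statistics of `n` independent Pareto variables `U ^ (-1/α)`,
where `U` is uniform on `(0, 1)`. -/
noncomputable def paretoMean (α : ℝ) (φ : (Fin n → ℝ) →ᵇ ℝ) : ℝ :=
  ∫ u : Fin n → ℝ, φ (fun i : Fin n => topStat (fun j : Fin n => u j ^ (-(1 / α))) i)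
    ∂(Measure.pi fun _ => unif)

lemma IsStableArray.tendsto_topFactor (h : IsStableArray α t C n ν) (hα0 : 0 < α) (ht : 0 < t)
    (ψ : ℝ →ᵇ ℝ) (φ : (Fin n → ℝ) →ᵇ ℝ) {y : ℝ} (hy : 0 < y) :
    Tendsto (fun r : ℕ => topFactor (ν r) ψ φ (y / ((n : ℝ) + 1 + r))) atTop
      (𝓝 (ψ ((t / y) ^ (1 / α)) * paretoMean α φ)) := by
  have hq := h.tendsto_quantile hα0 ht hy
  set q := (t / y) ^ (1 / α) with hqdef
  have hqpos : 0 < q := by positivity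
  rw [paretoMean, ← integral_const_mul]
  refine tendsto_integral_filter_of_dominated_convergence (fun _ => ‖ψ‖ * ‖φ‖) ?_ ?_
    (integrable_const _) ?_
  · refine Eventually.of_forall fun r => ?_
    have := h.prob r
    exact ((measurable_topFactor_integrand ψ φ (measurable_quantile (ν := ν r))).comp
      (measurable_prodMk_left (x := y / ((n : ℝ) + 1 + r)))).aestronglyMeasurable
  · refine Eventually.of_forall fun r => Eventually.of_forall fun u => ?_
    rw [norm_mul]
    exact mul_le_mul (ψ.norm_coe_le_norm _) (φ.norm_coe_le_norm _) (norm_nonneg _)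
      (norm_nonneg _)
  · filter_upwards [ae_pi_unif_mem (Fin n)] with u hu
    refine ((ψ.continuous.tendsto _).comp hq).mul ((φ.continuous.tendsto _).comp ?_)
    refine tendsto_pi_nhds.2 fun i => ?_
    have hlim : Tendsto (fun r : ℕ => fun j : Fin n => quantile (ν r)
        (y / ((n : ℝ) + 1 + r) * u j)) atTop (𝓝 fun j => q * u j ^ (-(1 / α))) := by
      refine tendsto_pi_nhds.2 fun j => ?_
      have hu0 := (hu j).1
      have h1 := h.tendsto_quantile hα0 ht (mul_pos hy hu0)
      have h2 : (t / (y * u j)) ^ (1 / α) = q * u j ^ (-(1 / α)) := by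
        rw [hqdef, Real.rpow_neg hu0.le, ← Real.inv_rpow hu0.le,
          ← Real.mul_rpow (by positivity) (by positivity)]
        congr 1
        field_simp
      rw [h2] at h1
      refine h1.congr fun r => ?_
      congr 1
      ring
    have h3 := (((continuous_topStat (i : ℕ)).tendsto _).comp hlim).div hq hqpos.ne'
    rw [topStat_const_mul hqpos, mul_div_cancel_left₀ _ hqpos.ne'] at h3
    exact h3

lemma integrableOn_pow_mul_exp_neg {c : ℝ} (hc : 0 < c) (n : ℕ) :
    IntegrableOn (fun y : ℝ => y ^ n * Real.exp (-(c * y))) (Ioi 0) := by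
  have := integrableOn_rpow_mul_exp_neg_mul_rpow (p := 1) (s := n) (b := c)
    (by have : (0 : ℝ) ≤ n := Nat.cast_nonneg n
        linarith) one_pos hc
  simpa using this

lemma integral_pow_mul_exp_neg {c : ℝ} (hc : 0 < c) (n : ℕ) :
    ∫ y in Ioi (0 : ℝ), y ^ n * Real.exp (-(c * y)) = n.factorial / c ^ (n + 1) := by
  have h := Real.integral_rpow_mul_exp_neg_mul_Ioi (a := n + 1) (r := c) (by positivity) hc
  rw [Real.Gamma_nat_eq_factorial] at h
  simp only [add_sub_cancel_right, Real.rpow_natCast] at h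
  rw [h]
  have : ((n : ℝ) + 1) = ((n + 1 : ℕ) : ℝ) := by push_cast; ring
  rw [this, Real.rpow_natCast, one_div, inv_pow]
  ring

lemma IsStableArray.tendsto_scaled_integral (h : IsStableArray α t C n ν) (hα0 : 0 < α)
    (hα1 : α < 1) (ht : 0 < t) (hC : 0 < C) {w : ℝ} (hw : 0 ≤ w)
    (ψ : ℝ →ᵇ ℝ) (φ : (Fin n → ℝ) →ᵇ ℝ) :
    Tendsto (fun r : ℕ => ∫ y in Ioo 0 ((n : ℝ) + 1 + r),
        y ^ n * topFactor (ν r) ψ φ (y / ((n : ℝ) + 1 + r)) *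
        ((∫ z in Ioo y ((n : ℝ) + 1 + r),
          Real.exp (-(w * (quantile (ν r) (z / ((n : ℝ) + 1 + r)) /
            quantile (ν r) (y / ((n : ℝ) + 1 + r)))))) / ((n : ℝ) + 1 + r)) ^ r) atTop
      (𝓝 (∫ y in Ioi (0 : ℝ), y ^ n * (ψ ((t / y) ^ (1 / α)) * paretoMean α φ) *
        Real.exp (-((1 + G α w) * y)))) := by
  let J : ℕ → ℝ → ℝ := fun r y => y ^ n * topFactor (ν r) ψ φ (y / ((n : ℝ) + 1 + r)) *
        ((∫ z in Ioo y ((n : ℝ) + 1 + r),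
          Real.exp (-(w * (quantile (ν r) (z / ((n : ℝ) + 1 + r)) /
            quantile (ν r) (y / ((n : ℝ) + 1 + r)))))) / ((n : ℝ) + 1 + r)) ^ r
  change Tendsto (fun r : ℕ => ∫ y in Ioo 0 ((n : ℝ) + 1 + r), J r y) atTop _
  have hform : ∀ r : ℕ, ∫ y in Ioo 0 ((n : ℝ) + 1 + r), J r y =
      ∫ y in Ioi 0, (Iio ((n : ℝ) + 1 + r)).indicator (J r) y := by
    intro r
    rw [integral_indicator measurableSet_Iio, Measure.restrict_restrict measurableSet_Iio,
      Iio_inter_Ioi]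
  simp_rw [hform]
  refine tendsto_integral_filter_of_dominated_convergence
    (fun y => ‖ψ‖ * ‖φ‖ * (y ^ n * Real.exp (-(1 / ((n : ℝ) + 2) * y)))) ?_ ?_ ?_ ?_
  · refine Eventually.of_forall fun r => Measurable.aestronglyMeasurable
      (Measurable.indicator ?_ measurableSet_Iio)
    have := h.prob r
    have hQ : Measurable (quantile (ν r)) := measurable_quantile
    have h1 := measurable_topFactor ψ φ (ν r)
    have h2 : Measurable fun y => ∫ z in Ioo y ((n : ℝ) + 1 + r),
          Real.exp (-(w * (quantile (ν r) (z / ((n : ℝ) + 1 + r)) /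
            quantile (ν r) (y / ((n : ℝ) + 1 + r))))) := by
      have h3 : Measurable fun p : ℝ × ℝ => ({p : ℝ × ℝ | p.1 < p.2} ∩
          {p | p.2 < (n : ℝ) + 1 + r}).indicator (fun p : ℝ × ℝ =>
            Real.exp (-(w * (quantile (ν r) (p.2 / ((n : ℝ) + 1 + r)) /
            quantile (ν r) (p.1 / ((n : ℝ) + 1 + r)))))) p := by
        refine Measurable.indicator (by fun_prop) ?_
        exact (measurableSet_lt measurable_fst measurable_snd).inter
          (measurableSet_lt measurable_snd measurable_const)
      have h4 := (h3.stronglyMeasurable.integral_prod_right' (ν := volume)).measurable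
      refine (congrArg Measurable (funext fun y => ?_)).mpr h4
      rw [← integral_indicator measurableSet_Ioo]
      rfl
    exact ((measurable_id.pow_const n).mul (h1.comp (measurable_id.div_const _))).mul
      ((h2.div_const _).pow_const r)
  · filter_upwards [eventually_ge_atTop 1] with r hr
    refine (ae_restrict_iff' measurableSet_Ioi).2 (Eventually.of_forall fun y hy => ?_)
    have hy0 : 0 < y := hy
    by_cases hym : y < (n : ℝ) + 1 + r
    · rw [Set.indicator_of_mem (show y ∈ Iio _ from hym), Real.norm_eq_abs, abs_mul, abs_mul,
        abs_of_nonneg (pow_nonneg hy0.le n)]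
      calc _ ≤ y ^ n * (‖ψ‖ * ‖φ‖) * Real.exp (-(1 / ((n : ℝ) + 2) * y)) := by
            gcongr
            · exact abs_topFactor_le _ _ _ _
            · exact h.pow_le hw hy0 hr hym
        _ = _ := by ring
    · rw [Set.indicator_of_notMem (show y ∉ Iio _ from hym), norm_zero]
      positivity
  · exact (integrableOn_pow_mul_exp_neg (by positivity) n).const_mul _
  · refine (ae_restrict_iff' measurableSet_Ioi).2 (Eventually.of_forall fun y hy => ?_)
    have hlim := ((h.tendsto_topFactor hα0 ht ψ φ hy).const_mul (y ^ n)).mul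
      (h.tendsto_pow hα0 hα1 ht hC hw hy)
    refine hlim.congr' ?_
    filter_upwards [(tendsto_size_atTop n).eventually_gt_atTop y] with r hr
    rw [Set.indicator_of_mem (show y ∈ Iio _ from hr)]

/-- The limit of the joint law of the largest entries and the sum of the others. In the limit the
`(n + 1)`-th largest entry is `(t / Γ) ^ (1 / α)` with `Γ` having the Gamma law with density
`y ^ n exp(-y) / n!`. -/
theorem IsStableArray.tendsto_integral_ratioFunctional (h : IsStableArray α t C n ν) (hα0 : 0 < α)
    (hα1 : α < 1) (ht : 0 < t) (hC : 0 < C) {w : ℝ} (hw : 0 ≤ w)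
    (ψ : ℝ →ᵇ ℝ) (φ : (Fin n → ℝ) →ᵇ ℝ) :
    Tendsto (fun r : ℕ => ∫ x, ratioFunctional ψ φ w x
        ∂(Measure.pi fun _ : Fin (n + 1 + r) => ν r)) atTop
      (𝓝 ((∫ y in Ioi (0 : ℝ), y ^ n * (ψ ((t / y) ^ (1 / α)) * paretoMean α φ) *
        Real.exp (-((1 + G α w) * y))) / n.factorial)) := by
  have hlim := h.tendsto_scaled_integral hα0 hα1 ht hC hw ψ φ
  -- with constant test functions both sides reduce to the normalizing constant
  have hone := h.tendsto_scaled_integral hα0 hα1 ht hC (le_refl 0)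
    (BoundedContinuousFunction.const _ 1) (BoundedContinuousFunction.const _ 1)
  have hnorm : ∫ y in Ioi (0 : ℝ), y ^ n * ((BoundedContinuousFunction.const ℝ (1 : ℝ))
      ((t / y) ^ (1 / α)) * paretoMean α (BoundedContinuousFunction.const (Fin n → ℝ) 1)) *
        Real.exp (-((1 + G α 0) * y)) = n.factorial := by
    have := integral_pow_mul_exp_neg one_pos n
    simpa [paretoMean, G_zero] using this
  rw [hnorm] at hone
  have hid : ∀ (r : ℕ) (w' : ℝ) (_ : 0 ≤ w') (ψ' : ℝ →ᵇ ℝ) (φ' : (Fin n → ℝ) →ᵇ ℝ), _ :=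
    fun r w' hw' ψ' φ' =>
      have := h.prob r
      integral_ratioFunctional_mul_scaled ψ' φ' (h.nonneg r) hw' r (m := (n : ℝ) + 1 + r)
        (by positivity)
  have hone' : Tendsto (fun r : ℕ => ∫ y in Ioo 0 ((n : ℝ) + 1 + r),
      y ^ n * (1 - y / ((n : ℝ) + 1 + r)) ^ r) atTop (𝓝 n.factorial) := by
    refine hone.congr fun r => ?_
    have := h.prob r
    rw [← hid r 0 le_rfl]
    simp [ratioFunctional]
  have hfac : (n.factorial : ℝ) ≠ 0 := by exact_mod_cast n.factorial_ne_zero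
  refine (hlim.div hone' hfac).congr' ?_
  filter_upwards [hone'.eventually_ne hfac] with r hr
  rw [Pi.div_apply, ← hid r w hw ψ φ, mul_div_cancel_right₀ _ hr]

end StableArrayLimit


/-! ### Laplace transforms of measures on the half-line -/

section Laplace

lemma integrable_exp_neg_mul {μ : Measure ℝ} [IsFiniteMeasure μ] (hμ : μ (Iio 0) = 0) {c : ℝ}
    (hc : 0 ≤ c) : Integrable (fun x => Real.exp (-(c * x))) μ := by
  refine Integrable.of_bound (by fun_prop) 1 ?_
  have : ∀ᵐ x ∂μ, ¬ x < 0 := by rwa [ae_iff, show {x : ℝ | ¬¬ x < 0} = Iio 0 by ext; simp]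
  filter_upwards [this] with x hx
  rw [Real.norm_eq_abs, Real.abs_exp, Real.exp_le_one_iff]
  exact neg_nonpos.2 (mul_nonneg hc (not_lt.1 hx))

lemma ae_nonneg_of_Iio {μ : Measure ℝ} (hμ : μ (Iio 0) = 0) : ∀ᵐ x ∂μ, 0 ≤ x := by
  rwa [ae_iff, show {x : ℝ | ¬ 0 ≤ x} = Iio 0 by ext; simp]

/-- Convergence of Laplace transforms at the natural numbers implies convergence of the integrals of
continuous functions of `exp(-x)`, by the Weierstrass approximation theorem. -/
lemma tendsto_integral_comp_exp_neg {ι : Type*} {l : Filter ι} {κ : ι → Measure ℝ}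
    {κ' : Measure ℝ} [∀ i, IsFiniteMeasure (κ i)] [IsFiniteMeasure κ'] (hκ : ∀ i, κ i (Iio 0) = 0)
    (hκ' : κ' (Iio 0) = 0)
    (h : ∀ j : ℕ, Tendsto (fun i => ∫ x, Real.exp (-(j * x)) ∂κ i) l
      (𝓝 (∫ x, Real.exp (-(j * x)) ∂κ'))) {g : ℝ → ℝ} (hg : Continuous g) :
    Tendsto (fun i => ∫ x, g (Real.exp (-x)) ∂κ i) l (𝓝 (∫ x, g (Real.exp (-x)) ∂κ')) := by
  have hpoly : ∀ (p : Polynomial ℝ) (μ : Measure ℝ) [IsFiniteMeasure μ], μ (Iio 0) = 0 →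
      Integrable (fun x => p.eval (Real.exp (-x))) μ ∧
      ∫ x, p.eval (Real.exp (-x)) ∂μ =
        ∑ j ∈ Finset.range (p.natDegree + 1), p.coeff j * ∫ x, Real.exp (-(j * x)) ∂μ := by
    intro p μ _ hμ
    have hform : ∀ x, p.eval (Real.exp (-x)) =
        ∑ j ∈ Finset.range (p.natDegree + 1), p.coeff j * Real.exp (-(j * x)) := by
      intro x
      rw [Polynomial.eval_eq_sum_range]
      refine Finset.sum_congr rfl fun j _ => ?_
      rw [← Real.exp_nat_mul, mul_neg]
    have hint : ∀ j ∈ Finset.range (p.natDegree + 1),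
        Integrable (fun x => p.coeff j * Real.exp (-(j * x))) μ := fun j _ =>
      (integrable_exp_neg_mul hμ (Nat.cast_nonneg j)).const_mul _
    simp only [hform]
    exact ⟨integrable_finsetSum _ hint, by
      rw [integral_finsetSum _ hint]
      simp only [integral_const_mul]⟩
  have hmass : Tendsto (fun i => (κ i).real univ) l (𝓝 (κ'.real univ)) := by
    simpa using h 0
  rw [Metric.tendsto_nhds]
  intro ε hε
  set K := κ'.real univ + 1 with hK
  have hKpos : 0 < K := by positivity
  obtain ⟨p, hp⟩ := exists_polynomial_near_of_continuousOn 0 1 g hg.continuousOn (ε / (3 * K))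
    (by positivity)
  have hdiff : ∀ (μ : Measure ℝ) [IsFiniteMeasure μ], μ (Iio 0) = 0 → μ.real univ ≤ K →
      |∫ x, g (Real.exp (-x)) ∂μ - ∫ x, p.eval (Real.exp (-x)) ∂μ| ≤ ε / 3 := by
    intro μ _ hμ hμK
    have hmem : ∀ᵐ x ∂μ, Real.exp (-x) ∈ Icc (0 : ℝ) 1 := by
      filter_upwards [ae_nonneg_of_Iio hμ] with x hx
      exact ⟨(Real.exp_pos _).le, Real.exp_le_one_iff.2 (neg_nonpos.2 hx)⟩
    have hbd : ∀ᵐ x ∂μ, ‖g (Real.exp (-x)) - p.eval (Real.exp (-x))‖ ≤ ε / (3 * K) := by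
      filter_upwards [hmem] with x hx
      rw [Real.norm_eq_abs, abs_sub_comm]
      exact (hp _ hx).le
    have hi := (hpoly p μ hμ).1
    have hgi : Integrable (fun x => g (Real.exp (-x))) μ := by
      have : Integrable (fun x => g (Real.exp (-x)) - p.eval (Real.exp (-x))) μ :=
        Integrable.of_bound ((hg.comp (by fun_prop)).sub
          (p.continuous.comp (by fun_prop))).aestronglyMeasurable _ hbd
      exact (this.add hi).congr (Eventually.of_forall fun x => by simp)
    rw [← integral_sub hgi hi, ← Real.norm_eq_abs]
    refine (norm_integral_le_of_norm_le_const hbd).trans ?_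
    calc ε / (3 * K) * μ.real univ ≤ ε / (3 * K) * K := by gcongr
      _ = ε / 3 := by field_simp
  have hpl : Tendsto (fun i => ∫ x, p.eval (Real.exp (-x)) ∂κ i) l
      (𝓝 (∫ x, p.eval (Real.exp (-x)) ∂κ')) := by
    rw [(hpoly p κ' hκ').2]
    simp only [fun i => (hpoly p (κ i) (hκ i)).2]
    exact tendsto_finsetSum _ fun j _ => (h j).const_mul _
  filter_upwards [hmass.eventually_lt_const (show κ'.real univ < K by linarith),
    Metric.tendsto_nhds.1 hpl (ε / 3) (by positivity)] with i hi1 hi2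
  have h1 := hdiff (κ i) (hκ i) hi1.le
  have h2 := hdiff κ' hκ' (by linarith)
  rw [Real.dist_eq] at hi2 ⊢
  rw [abs_le] at h1 h2
  rw [abs_lt] at hi2 ⊢
  constructor <;> linarith [h1.1, h1.2, h2.1, h2.2, hi2.1, hi2.2]

/-- A finite measure on `[0, ∞)` is determined by its Laplace transform, even by the values of the
latter at the natural numbers. -/
lemma measure_ext_of_laplace {μ ν : Measure ℝ} [IsFiniteMeasure μ] [IsFiniteMeasure ν]
    (hμ : μ (Iio 0) = 0) (hν : ν (Iio 0) = 0)
    (h : ∀ j : ℕ, ∫ x, Real.exp (-(j * x)) ∂μ = ∫ x, Real.exp (-(j * x)) ∂ν) : μ = ν := by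
  have he : Measurable fun x : ℝ => Real.exp (-x) := by fun_prop
  have hmap : μ.map (fun x => Real.exp (-x)) = ν.map fun x => Real.exp (-x) := by
    refine ext_of_forall_integral_eq_of_IsFiniteMeasure fun g => ?_
    rw [integral_map he.aemeasurable g.continuous.aestronglyMeasurable,
      integral_map he.aemeasurable g.continuous.aestronglyMeasurable]
    have := tendsto_integral_comp_exp_neg (l := (atTop : Filter ℕ)) (κ := fun _ => μ) (κ' := ν)
      (fun _ => hμ) hν (fun j => by rw [h j]; exact tendsto_const_nhds) g.continuous
    exact tendsto_nhds_unique tendsto_const_nhds this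
  have hback : ∀ κ : Measure ℝ,
      (κ.map fun x => Real.exp (-x)).map (fun u => -Real.log u) = κ := by
    intro κ
    rw [Measure.map_map (by fun_prop) he]
    simp [Function.comp_def]
  rw [← hback μ, ← hback ν, hmap]

lemma integral_weight_map_fst {E : Type*} [MeasurableSpace E] (m : Measure (ℝ × E))
    {g : E → ℝ} (hg : Measurable g) (hg0 : ∀ z, 0 ≤ g z) {f : ℝ → ℝ} (hf : Measurable f) :
    ∫ x, f x ∂((m.withDensity fun z => ((g z.2).toNNReal : ℝ≥0∞)).map Prod.fst) =
      ∫ z, f z.1 * g z.2 ∂m := by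
  rw [integral_map measurable_fst.aemeasurable hf.aestronglyMeasurable,
    integral_withDensity_eq_integral_smul (by fun_prop)]
  refine integral_congr_ae (Eventually.of_forall fun z => ?_)
  simp only [NNReal.smul_def, smul_eq_mul, Real.coe_toNNReal _ (hg0 _)]
  ring

lemma prod_measure_ext_of_laplace {n : ℕ} {m m' : Measure (ℝ × (Fin n → ℝ))} [IsFiniteMeasure m]
    [IsFiniteMeasure m'] (hm : ∀ᵐ z ∂m, 0 ≤ z.1) (hm' : ∀ᵐ z ∂m', 0 ≤ z.1)
    (h : ∀ (j : ℕ) (φ : (Fin n → ℝ) →ᵇ ℝ),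
      ∫ z, φ z.2 * Real.exp (-(j * z.1)) ∂m = ∫ z, φ z.2 * Real.exp (-(j * z.1)) ∂m') : m = m' := by
  have hpos : ∀ (f : ℝ →ᵇ ℝ) (g : (Fin n → ℝ) →ᵇ ℝ), (∀ z, 0 ≤ g z) →
      ∫ z, f z.1 * g z.2 ∂m = ∫ z, f z.1 * g z.2 ∂m' := by
    intro f g hg0
    have hgm := g.continuous.measurable
    have hfin : ∀ (μ : Measure (ℝ × (Fin n → ℝ))) [IsFiniteMeasure μ],
        IsFiniteMeasure (μ.withDensity fun z => ((g z.2).toNNReal : ℝ≥0∞)) := by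
      intro μ _
      have hi : Integrable (fun z : ℝ × (Fin n → ℝ) => g z.2) μ :=
        Integrable.of_bound (hgm.comp measurable_snd).aestronglyMeasurable ‖g‖
          (Eventually.of_forall fun z => g.norm_coe_le_norm _)
      exact isFiniteMeasure_withDensity_ofReal hi.2
    have := hfin m
    have := hfin m'
    have hnull : ∀ μ : Measure (ℝ × (Fin n → ℝ)), (∀ᵐ z ∂μ, 0 ≤ z.1) →
        ((μ.withDensity fun z => ((g z.2).toNNReal : ℝ≥0∞)).map Prod.fst) (Iio 0) = 0 := by
      intro μ hμ
      rw [Measure.map_apply measurable_fst measurableSet_Iio]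
      refine withDensity_absolutelyContinuous _ _ ?_
      rw [ae_iff] at hμ
      convert hμ using 2
      ext z
      simp
    rw [← integral_weight_map_fst m hgm hg0 f.continuous.measurable,
      ← integral_weight_map_fst m' hgm hg0 f.continuous.measurable]
    congr 1
    refine measure_ext_of_laplace (hnull m hm) (hnull m' hm') fun j => ?_
    rw [integral_weight_map_fst m hgm hg0 (by fun_prop),
      integral_weight_map_fst m' hgm hg0 (by fun_prop)]
    simpa only [mul_comm] using h j g
  refine Measure.ext_of_integral_mul_prod_boundedContinuousFunction' fun f g => ?_
  have h1 := hpos f (g + BoundedContinuousFunction.const _ ‖g‖) fun z => by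
    have := neg_le_of_abs_le (g.norm_coe_le_norm z)
    simp only [BoundedContinuousFunction.coe_add, Pi.add_apply,
      BoundedContinuousFunction.const_apply]
    linarith
  have h2 := hpos f (BoundedContinuousFunction.const _ ‖g‖) fun z => by
    rw [BoundedContinuousFunction.const_apply]
    exact norm_nonneg _
  have hint : ∀ (g : (Fin n → ℝ) →ᵇ ℝ) (μ : Measure (ℝ × (Fin n → ℝ))) [IsFiniteMeasure μ],
      Integrable (fun z => f z.1 * g z.2) μ := by
    intro g μ _
    refine Integrable.of_bound ((f.continuous.comp continuous_fst).mul
      (g.continuous.comp continuous_snd)).aestronglyMeasurable (‖f‖ * ‖g‖)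
      (Eventually.of_forall fun z => ?_)
    rw [norm_mul]
    exact mul_le_mul (f.norm_coe_le_norm _) (g.norm_coe_le_norm _) (norm_nonneg _) (norm_nonneg _)
  simp only [BoundedContinuousFunction.coe_add, Pi.add_apply, mul_add] at h1
  rw [integral_add (hint _ m) (hint _ m), integral_add (hint _ m') (hint _ m'), h2] at h1
  exact add_right_cancel h1

lemma identDistrib_of_laplace {Ω Ω' : Type*} [MeasurableSpace Ω] [MeasurableSpace Ω'] {n : ℕ}
    {P : Measure Ω} {Q : Measure Ω'} [IsFiniteMeasure P] [IsFiniteMeasure Q]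
    {Z : Ω → ℝ × (Fin n → ℝ)} {Z' : Ω' → ℝ × (Fin n → ℝ)} (hZ : AEMeasurable Z P)
    (hZ' : AEMeasurable Z' Q) (h0 : ∀ᵐ ω ∂P, 0 ≤ (Z ω).1) (h0' : ∀ᵐ ω ∂Q, 0 ≤ (Z' ω).1)
    (h : ∀ (j : ℕ) (φ : (Fin n → ℝ) →ᵇ ℝ), ∫ ω, φ (Z ω).2 * Real.exp (-(j * (Z ω).1)) ∂P =
      ∫ ω, φ (Z' ω).2 * Real.exp (-(j * (Z' ω).1)) ∂Q) : IdentDistrib Z Z' P Q := by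
  refine ⟨hZ, hZ', ?_⟩
  have hS : MeasurableSet {z : ℝ × (Fin n → ℝ) | 0 ≤ z.1} :=
    measurableSet_le measurable_const measurable_fst
  refine prod_measure_ext_of_laplace ((ae_map_iff hZ hS).2 h0) ((ae_map_iff hZ' hS).2 h0')
    fun j φ => ?_
  have hm : Measurable fun z : ℝ × (Fin n → ℝ) => φ z.2 * Real.exp (-(j * z.1)) :=
    (φ.continuous.measurable.comp measurable_snd).mul (by fun_prop)
  rw [integral_map hZ hm.aestronglyMeasurable, integral_map hZ' hm.aestronglyMeasurable]
  exact h j φ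

end Laplace


/-! ### Tails of selfsimilar subordinators at small times -/

section Tail

variable {α : ℝ}

lemma measurable_stableDensity (α : ℝ) : Measurable fun x : ℝ => (α / x ^ (1 + α)).toNNReal :=
  (measurable_const.div (measurable_id.pow_const _)).real_toNNReal

lemma stableDensity_nonneg (hα0 : 0 < α) {x : ℝ} (hx : 0 < x) : 0 ≤ α / x ^ (1 + α) := by
  positivity

lemma integral_selfsimilarLevyMeasure (hα0 : 0 < α) (f : ℝ → ℝ) :
    ∫ x, f x ∂(selfsimilarLevyMeasure α) = ∫ x in Ioi 0, α / x ^ (1 + α) * f x := by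
  have h := integral_withDensity_eq_integral_smul (μ := volume.restrict (Ioi 0))
    (measurable_stableDensity α) f
  refine h.trans (setIntegral_congr_fun measurableSet_Ioi fun x hx => ?_)
  simp only [NNReal.smul_def, smul_eq_mul, Real.coe_toNNReal _ (stableDensity_nonneg hα0 hx)]

lemma integrable_selfsimilarLevyMeasure (hα0 : 0 < α) (f : ℝ → ℝ)
    (hf : IntegrableOn (fun x => α / x ^ (1 + α) * f x) (Ioi 0)) :
    Integrable f (selfsimilarLevyMeasure α) := by
  have h := integrable_withDensity_iff_integrable_smul (μ := volume.restrict (Ioi 0))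
    (measurable_stableDensity α) (g := f)
  refine h.2 (hf.congr ?_)
  refine (ae_restrict_iff' measurableSet_Ioi).2 (Eventually.of_forall fun x hx => ?_)
  simp only [NNReal.smul_def, smul_eq_mul, Real.coe_toNNReal _ (stableDensity_nonneg hα0 hx)]

lemma selfsimilarLevyMeasure_Iic (α : ℝ) : selfsimilarLevyMeasure α (Iic 0) = 0 := by
  refine withDensity_absolutelyContinuous _ _ ?_
  rw [Measure.restrict_apply measurableSet_Iic, Iic_inter_Ioi, Ioc_self, measure_empty]

lemma selfsimilarLevyMeasure_restrict (α : ℝ) :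
    (selfsimilarLevyMeasure α).restrict (Ioi 0) = selfsimilarLevyMeasure α := by
  refine Measure.restrict_eq_self_of_ae_mem ?_
  rw [ae_iff]
  convert selfsimilarLevyMeasure_Iic α using 2
  ext x
  simp

lemma levyCharacteristic_eq_integral (α w : ℝ) :
    levyCharacteristic (selfsimilarLevyMeasure α) w =
      ∫ x, (1 - Real.exp (-(w * x))) ∂(selfsimilarLevyMeasure α) := by
  rw [levyCharacteristic, selfsimilarLevyMeasure_restrict]

lemma div_rpow_one_add_eq (α : ℝ) {x : ℝ} (hx : 0 < x) :
    α / x ^ (1 + α) = α * x ^ (-(1 + α)) := by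
  rw [Real.rpow_neg hx.le, div_eq_mul_inv]

/-- The Lévy integral converges: near `0` because `α < 1`, and at infinity because `α > 0`. -/
lemma integrable_one_sub_exp (hα0 : 0 < α) (hα1 : α < 1) {w : ℝ} (hw : 0 ≤ w) :
    Integrable (fun x => 1 - Real.exp (-(w * x))) (selfsimilarLevyMeasure α) := by
  refine integrable_selfsimilarLevyMeasure hα0 _ ?_
  have hm : Measurable fun x : ℝ => α / x ^ (1 + α) * (1 - Real.exp (-(w * x))) :=
    (measurable_const.div (measurable_id.pow_const _)).mul (by fun_prop)
  have h01 : ∀ x : ℝ, 0 < x → 0 ≤ 1 - Real.exp (-(w * x)) := fun x hx =>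
    sub_nonneg.2 (Real.exp_le_one_iff.2 (neg_nonpos.2 (by positivity)))
  rw [← Ioc_union_Ioi_eq_Ioi zero_le_one]
  refine IntegrableOn.union ?_ ?_
  · have hi : IntegrableOn (fun x : ℝ => α * w * x ^ (-α)) (Ioc 0 1) := by
      have := (intervalIntegral.intervalIntegrable_rpow' (a := 0) (b := 1)
        (show -1 < -α by linarith)).const_mul (α * w)
      rwa [intervalIntegrable_iff_integrableOn_Ioc_of_le zero_le_one] at this
    refine Integrable.mono' hi hm.aestronglyMeasurable ?_
    refine (ae_restrict_iff' measurableSet_Ioc).2 (Eventually.of_forall fun x hx => ?_)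
    have hx0 := hx.1
    have h1 := Real.add_one_le_exp (-(w * x))
    rw [Real.norm_eq_abs, abs_of_nonneg (mul_nonneg (stableDensity_nonneg hα0 hx0) (h01 x hx0))]
    calc α / x ^ (1 + α) * (1 - Real.exp (-(w * x))) ≤ α / x ^ (1 + α) * (w * x) := by
          gcongr
          linarith
      _ = α * w * x ^ (-α) := by
          rw [div_rpow_one_add_eq α hx0]
          have : x ^ (-α) = x ^ (-(1 + α)) * x := by
            rw [← Real.rpow_add_one hx0.ne']
            congr 1
            ring
          rw [this]
          ring
  · have hi : IntegrableOn (fun x : ℝ => α * x ^ (-(1 + α))) (Ioi 1) :=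
      (integrableOn_Ioi_rpow_of_lt (by linarith) one_pos).const_mul α
    refine Integrable.mono' hi hm.aestronglyMeasurable ?_
    refine (ae_restrict_iff' measurableSet_Ioi).2 (Eventually.of_forall fun x hx => ?_)
    have hx0 : 0 < x := one_pos.trans hx
    rw [Real.norm_eq_abs, abs_of_nonneg (mul_nonneg (stableDensity_nonneg hα0 hx0) (h01 x hx0)),
      ← div_rpow_one_add_eq α hx0]
    exact mul_le_of_le_one_right (stableDensity_nonneg hα0 hx0)
      (by linarith [Real.exp_pos (-(w * x))])

lemma selfsimilarLevyMeasure_Ioi (hα0 : 0 < α) {a : ℝ} (ha : 0 < a) :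
    selfsimilarLevyMeasure α (Ioi a) = ENNReal.ofReal (1 / a ^ α) := by
  rw [selfsimilarLevyMeasure, withDensity_apply _ measurableSet_Ioi,
    Measure.restrict_restrict measurableSet_Ioi, inter_eq_self_of_subset_left
    (Ioi_subset_Ioi ha.le)]
  have hint : IntegrableOn (fun x : ℝ => α / x ^ (1 + α)) (Ioi a) := by
    refine ((integrableOn_Ioi_rpow_of_lt (a := -(1 + α)) (by linarith) ha).const_mul α).congr ?_
    refine (ae_restrict_iff' measurableSet_Ioi).2 (Eventually.of_forall fun x hx => ?_)
    exact (div_rpow_one_add_eq α (ha.trans hx)).symm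
  rw [← ofReal_integral_eq_lintegral_ofReal hint]
  · congr 1
    have h1 : ∫ x in Ioi a, α / x ^ (1 + α) = ∫ x in Ioi a, α * x ^ (-(1 + α)) :=
      setIntegral_congr_fun measurableSet_Ioi fun x hx => div_rpow_one_add_eq α (ha.trans hx)
    rw [h1, integral_const_mul, integral_Ioi_rpow_of_lt (by linarith) ha]
    have h2 : -(1 + α) + 1 = -α := by ring
    rw [h2, Real.rpow_neg ha.le]
    field_simp
  · refine (ae_restrict_iff' measurableSet_Ioi).2 (Eventually.of_forall fun x hx => ?_)
    exact stableDensity_nonneg hα0 (ha.trans hx)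

lemma levyCharacteristic_nonneg {w : ℝ} (hw : 0 ≤ w) :
    0 ≤ levyCharacteristic (selfsimilarLevyMeasure α) w :=
  setIntegral_nonneg measurableSet_Ioi fun _ hx =>
    sub_nonneg.2 (Real.exp_le_one_iff.2 (neg_nonpos.2 (mul_nonneg hw (le_of_lt hx))))

lemma levyCharacteristic_eq_rpow_mul (hα0 : 0 < α) {w : ℝ} (hw : 0 < w) :
    levyCharacteristic (selfsimilarLevyMeasure α) w =
      w ^ α * levyCharacteristic (selfsimilarLevyMeasure α) 1 := by
  rw [levyCharacteristic_eq_integral, levyCharacteristic_eq_integral,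
    integral_selfsimilarLevyMeasure hα0, integral_selfsimilarLevyMeasure hα0]
  have h := integral_comp_mul_left_Ioi
    (fun x => α / x ^ (1 + α) * (1 - Real.exp (-(1 * x)))) 0 hw
  rw [mul_zero, smul_eq_mul] at h
  have h2 : ∫ x in Ioi (0 : ℝ), α / x ^ (1 + α) * (1 - Real.exp (-(w * x))) =
      w ^ (1 + α) * ∫ x in Ioi (0 : ℝ), α / (w * x) ^ (1 + α) * (1 - Real.exp (-(1 * (w * x)))) := by
    rw [← integral_const_mul]
    refine setIntegral_congr_fun measurableSet_Ioi fun x hx => ?_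
    have hx0 : 0 < x := hx
    simp only [Real.mul_rpow hw.le hx0.le, one_mul]
    field_simp
  rw [h2, h, ← mul_assoc, Real.rpow_add hw, Real.rpow_one]
  congr 1
  field_simp

/-- A Markov type bound for the tail in terms of the Laplace transform. -/
lemma mul_tail_le_one_sub_laplace {ν : Measure ℝ} [IsProbabilityMeasure ν] (hν : ν (Iio 0) = 0)
    {x : ℝ} (hx : 0 < x) :
    (1 - Real.exp (-1)) * ν.real (Ioi x) ≤ 1 - ∫ y, Real.exp (-(1 / x * y)) ∂ν := by
  have hi := integrable_exp_neg_mul hν (show 0 ≤ 1 / x by positivity)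
  have h1 : 1 - ∫ y, Real.exp (-(1 / x * y)) ∂ν = ∫ y, (1 - Real.exp (-(1 / x * y))) ∂ν := by
    rw [integral_sub (integrable_const _) hi]
    simp
  have h2 : (1 - Real.exp (-1)) * ν.real (Ioi x) =
      ∫ y, (Ioi x).indicator (fun _ => 1 - Real.exp (-1)) y ∂ν := by
    rw [integral_indicator measurableSet_Ioi, setIntegral_const, smul_eq_mul, mul_comm]
  rw [h1, h2]
  refine integral_mono_ae ((integrable_const _).indicator measurableSet_Ioi)
    ((integrable_const _).sub hi) ?_
  filter_upwards [ae_nonneg_of_Iio hν] with y hy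
  by_cases hxy : x < y
  · rw [Set.indicator_of_mem (show y ∈ Ioi x from hxy)]
    refine sub_le_sub_left (Real.exp_le_exp.2 (neg_le_neg ?_)) 1
    rw [div_mul_eq_mul_div, one_mul, le_div_iff₀ hx]
    linarith
  · rw [Set.indicator_of_notMem (show y ∉ Ioi x from hxy)]
    exact sub_nonneg.2 (Real.exp_le_one_iff.2 (neg_nonpos.2 (by positivity)))

/-- A continuous function `g` of `u = exp(-x)` for which `(1 - exp(-x)) g(exp(-x))` lies between the
indicator functions of `(b, ∞)` and `(a, ∞)`. -/
noncomputable def tailTest (a b u : ℝ) : ℝ :=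
  max 0 (min 1 ((Real.exp (-a) - u) / (Real.exp (-a) - Real.exp (-b)))) /
    max (1 - u) (1 - Real.exp (-a))

lemma continuous_tailTest {a : ℝ} (ha : 0 < a) (b : ℝ) : Continuous (tailTest a b) := by
  unfold tailTest
  refine Continuous.div (by fun_prop) (by fun_prop) fun u => ?_
  have : Real.exp (-a) < 1 := Real.exp_lt_one_iff.2 (by linarith)
  exact (lt_max_of_lt_right (by linarith)).ne'

lemma tailTest_bounds {a b : ℝ} (ha : 0 < a) (hab : a < b) {x : ℝ} (hx : 0 ≤ x) :
    (Ioi b).indicator (fun _ => (1 : ℝ)) x ≤ (1 - Real.exp (-x)) * tailTest a b (Real.exp (-x)) ∧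
    (1 - Real.exp (-x)) * tailTest a b (Real.exp (-x)) ≤
      (Ioi a).indicator (fun _ => (1 : ℝ)) x := by
  have hA1 : Real.exp (-a) < 1 := Real.exp_lt_one_iff.2 (by linarith)
  have hAB : Real.exp (-b) < Real.exp (-a) := Real.exp_lt_exp.2 (by linarith)
  have hx1 : 0 ≤ 1 - Real.exp (-x) := sub_nonneg.2 (Real.exp_le_one_iff.2 (by linarith))
  have hden : 0 < max (1 - Real.exp (-x)) (1 - Real.exp (-a)) :=
    lt_max_of_lt_right (by linarith)
  have hnum0 : 0 ≤ max 0 (min 1 ((Real.exp (-a) - Real.exp (-x)) /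
      (Real.exp (-a) - Real.exp (-b)))) := le_max_left _ _
  have hnum1 : max 0 (min 1 ((Real.exp (-a) - Real.exp (-x)) /
      (Real.exp (-a) - Real.exp (-b)))) ≤ 1 := max_le zero_le_one (min_le_left _ _)
  unfold tailTest
  constructor
  · by_cases hbx : b < x
    · rw [Set.indicator_of_mem (show x ∈ Ioi b from hbx)]
      have hu : Real.exp (-x) < Real.exp (-b) := Real.exp_lt_exp.2 (by linarith)
      have h1 : 1 ≤ (Real.exp (-a) - Real.exp (-x)) / (Real.exp (-a) - Real.exp (-b)) := by
        rw [le_div_iff₀ (by linarith)]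
        linarith
      rw [min_eq_left h1, max_eq_right zero_le_one, max_eq_left (by linarith),
        mul_one_div_cancel (by linarith)]
    · rw [Set.indicator_of_notMem (show x ∉ Ioi b from hbx)]
      positivity
  · by_cases hax : a < x
    · rw [Set.indicator_of_mem (show x ∈ Ioi a from hax), mul_div_assoc', div_le_one hden]
      exact (mul_le_of_le_one_right hx1 hnum1).trans (le_max_left _ _)
    · rw [Set.indicator_of_notMem (show x ∉ Ioi a from hax)]
      have hu : Real.exp (-a) ≤ Real.exp (-x) := Real.exp_le_exp.2 (by linarith)
      have h1 : (Real.exp (-a) - Real.exp (-x)) / (Real.exp (-a) - Real.exp (-b)) ≤ 0 :=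
        div_nonpos_of_nonpos_of_nonneg (by linarith) (by linarith)
      rw [max_eq_left ((min_le_right _ _).trans h1), zero_div, mul_zero]

lemma integral_withDensity_one_sub_exp {μ : Measure ℝ} (hμ : ∀ᵐ x ∂μ, 0 ≤ x) {c : ℝ} (hc : 0 ≤ c)
    (f : ℝ → ℝ) :
    ∫ x, f x ∂(μ.withDensity fun x => ((c * (1 - Real.exp (-x))).toNNReal : ℝ≥0∞)) =
      c * ∫ x, (1 - Real.exp (-x)) * f x ∂μ := by
  rw [integral_withDensity_eq_integral_smul (by fun_prop), ← integral_const_mul]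
  refine integral_congr_ae ?_
  filter_upwards [hμ] with x hx
  have h1 : 0 ≤ 1 - Real.exp (-x) := sub_nonneg.2 (Real.exp_le_one_iff.2 (by linarith))
  simp only [NNReal.smul_def, smul_eq_mul, Real.coe_toNNReal _ (mul_nonneg hc h1), mul_assoc]

lemma isFiniteMeasure_withDensity_one_sub_exp {μ : Measure ℝ}
    (hμ : Integrable (fun x => 1 - Real.exp (-x)) μ) (c : ℝ) :
    IsFiniteMeasure (μ.withDensity fun x => ((c * (1 - Real.exp (-x))).toNNReal : ℝ≥0∞)) := by
  have hi := hμ.const_mul c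
  exact isFiniteMeasure_withDensity_ofReal hi.2

lemma tendsto_mul_exp_sub_exp {t : ℝ} (a b : ℝ) {m : ℕ → ℝ} (hm : Tendsto m atTop atTop) :
    Tendsto (fun r => m r * (Real.exp (-(a * (t / m r))) - Real.exp (-(b * (t / m r))))) atTop
      (𝓝 (t * (b - a))) := by
  have hinv : Tendsto (fun r => (m r)⁻¹) atTop (𝓝[≠] 0) :=
    tendsto_nhdsWithin_iff.2 ⟨hm.inv_tendsto_atTop, (hm.eventually_gt_atTop 0).mono fun r hr =>
      inv_ne_zero hr.ne'⟩
  have hd : HasDerivAt (fun s => Real.exp (-(a * (t * s))) - Real.exp (-(b * (t * s))))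
      (t * (b - a)) 0 := by
    have h1 : ∀ c : ℝ, HasDerivAt (fun s => Real.exp (-(c * (t * s))))
        (Real.exp (-(c * (t * 0))) * -(c * (t * 1))) 0 := fun c =>
      (((((hasDerivAt_id (0 : ℝ)).const_mul t).const_mul c).neg).exp)
    have h2 := (h1 a).sub (h1 b)
    refine h2.congr_deriv ?_
    simp
    ring
  have h := (hasDerivAt_iff_tendsto_slope.1 hd).comp hinv
  refine h.congr fun r => ?_
  simp [slope_def_field, div_eq_mul_inv]
  ring

/-- Laws on `[0, ∞)` with the Laplace transforms of a selfsimilar subordinator at the times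
`t / (n + 1 + r)` form a stable array: the rescaled laws converge vaguely on `(0, ∞)` to the Lévy
measure. -/
lemma isStableArray_of_laplace (hα0 : 0 < α) (hα1 : α < 1) {t : ℝ} (ht : 0 < t) {n : ℕ}
    {ν : ℕ → Measure ℝ} (hprob : ∀ r, IsProbabilityMeasure (ν r)) (hν : ∀ r, ν r (Iio 0) = 0)
    (hlap : ∀ (r : ℕ) (w : ℝ), 0 ≤ w → ∫ x, Real.exp (-(w * x)) ∂(ν r) =
      Real.exp (-(levyCharacteristic (selfsimilarLevyMeasure α) w * (t / ((n : ℝ) + 1 + r))))) :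
    IsStableArray α t (t * (levyCharacteristic (selfsimilarLevyMeasure α) 1 + 1) /
      (1 - Real.exp (-1))) n ν := by
  have he1 : 0 < 1 - Real.exp (-1) := sub_pos.2 (Real.exp_lt_one_iff.2 (by norm_num))
  set Ψ := levyCharacteristic (selfsimilarLevyMeasure α) with hΨ
  set m : ℕ → ℝ := fun r => (n : ℝ) + 1 + r with hm
  have hmpos : ∀ r, 0 < m r := fun r => by positivity
  have hmlim : Tendsto m atTop atTop := tendsto_size_atTop n
  have hΛ0 : ∀ᵐ x ∂(selfsimilarLevyMeasure α), 0 ≤ x := by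
    have := selfsimilarLevyMeasure_Iic α
    exact ae_nonneg_of_Iio (measure_mono_null Iio_subset_Iic_self this)
  have hΛi : Integrable (fun x => 1 - Real.exp (-x)) (selfsimilarLevyMeasure α) := by
    simpa using integrable_one_sub_exp hα0 hα1 zero_le_one
  have hνi : ∀ r, Integrable (fun x => 1 - Real.exp (-x)) (ν r) := fun r => by
    exact ((integrable_const (1 : ℝ)).sub (integrable_exp_neg_mul (hν r) zero_le_one)).congr
      (Eventually.of_forall fun x => by simp)
  let κ : ℕ → Measure ℝ := fun r =>
    (ν r).withDensity fun x => ((m r * (1 - Real.exp (-x))).toNNReal : ℝ≥0∞)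
  let κ' : Measure ℝ :=
    (selfsimilarLevyMeasure α).withDensity fun x => ((t * (1 - Real.exp (-x))).toNNReal : ℝ≥0∞)
  have hκf : ∀ r, IsFiniteMeasure (κ r) := fun r =>
    isFiniteMeasure_withDensity_one_sub_exp (hνi r) _
  have hκ'f : IsFiniteMeasure κ' := isFiniteMeasure_withDensity_one_sub_exp hΛi _
  have hκint : ∀ r (f : ℝ → ℝ), ∫ x, f x ∂(κ r) = m r * ∫ x, (1 - Real.exp (-x)) * f x ∂(ν r) :=
    fun r f => integral_withDensity_one_sub_exp (ae_nonneg_of_Iio (hν r)) (hmpos r).le f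
  have hκ'int : ∀ f : ℝ → ℝ, ∫ x, f x ∂κ' =
      t * ∫ x, (1 - Real.exp (-x)) * f x ∂(selfsimilarLevyMeasure α) :=
    fun f => integral_withDensity_one_sub_exp hΛ0 ht.le f
  have hexp : ∀ (j : ℕ) (x : ℝ), (1 - Real.exp (-x)) * Real.exp (-(j * x)) =
      Real.exp (-(j * x)) - Real.exp (-((j + 1 : ℕ) * x)) := by
    intro j x
    rw [sub_mul, one_mul, ← Real.exp_add]
    congr 2
    push_cast
    ring
  have hmom : ∀ j : ℕ, Tendsto (fun r => ∫ x, Real.exp (-(j * x)) ∂(κ r)) atTop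
      (𝓝 (∫ x, Real.exp (-(j * x)) ∂κ')) := by
    intro j
    have h1 : ∀ r, ∫ x, Real.exp (-(j * x)) ∂(κ r) = m r *
        (Real.exp (-(Ψ j * (t / m r))) - Real.exp (-(Ψ (j + 1 : ℕ) * (t / m r)))) := by
      intro r
      rw [hκint]
      simp only [hexp]
      rw [integral_sub (integrable_exp_neg_mul (hν r) (Nat.cast_nonneg j))
        (integrable_exp_neg_mul (hν r) (Nat.cast_nonneg _)), hlap r _ (Nat.cast_nonneg j),
        hlap r _ (Nat.cast_nonneg _)]
    have h2 : ∫ x, Real.exp (-(j * x)) ∂κ' = t * (Ψ (j + 1 : ℕ) - Ψ j) := by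
      rw [hκ'int, hΨ, levyCharacteristic_eq_integral, levyCharacteristic_eq_integral,
        ← integral_sub (integrable_one_sub_exp hα0 hα1 (Nat.cast_nonneg _))
          (integrable_one_sub_exp hα0 hα1 (Nat.cast_nonneg _))]
      congr 2
      ext x
      rw [hexp]
      ring
    rw [h2]
    simp only [h1]
    exact tendsto_mul_exp_sub_exp _ _ hmlim
  have hconv := fun (g : ℝ → ℝ) (hg : Continuous g) =>
    tendsto_integral_comp_exp_neg (l := (atTop : Filter ℕ)) (κ := κ) (κ' := κ')
      (fun r => withDensity_absolutelyContinuous _ _ (hν r))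
      (withDensity_absolutelyContinuous _ _
        (measure_mono_null Iio_subset_Iic_self (selfsimilarLevyMeasure_Iic α))) hmom hg
  -- comparison of the tails with the integrals of the test functions
  have hsand : ∀ (μ : Measure ℝ), (∀ᵐ x ∂μ, 0 ≤ x) → Integrable (fun x => 1 - Real.exp (-x)) μ →
      (∀ a, 0 < a → μ (Ioi a) ≠ ∞) → ∀ a b, 0 < a → a < b →
      μ.real (Ioi b) ≤ ∫ x, (1 - Real.exp (-x)) * tailTest a b (Real.exp (-x)) ∂μ ∧
      ∫ x, (1 - Real.exp (-x)) * tailTest a b (Real.exp (-x)) ∂μ ≤ μ.real (Ioi a) := by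
    intro μ hμ hμi hμf a b ha hab
    have hind : ∀ c, 0 < c → Integrable ((Ioi c).indicator fun _ => (1 : ℝ)) μ := fun c hc =>
      (integrable_indicator_iff measurableSet_Ioi).2 (integrableOn_const (hμf c hc))
    have hval : ∀ c, ∫ x, (Ioi c).indicator (fun _ => (1 : ℝ)) x ∂μ = μ.real (Ioi c) := fun c => by
      rw [integral_indicator measurableSet_Ioi, setIntegral_const, smul_eq_mul, mul_one]
    have hti : Integrable (fun x => (1 - Real.exp (-x)) * tailTest a b (Real.exp (-x))) μ := by
      refine (hind a ha).mono' ?_ ?_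
      · exact ((continuous_const.sub (by fun_prop)).mul
          ((continuous_tailTest ha b).comp (by fun_prop))).aestronglyMeasurable
      · filter_upwards [hμ] with x hx
        have h := tailTest_bounds ha hab hx
        rw [Real.norm_eq_abs, abs_of_nonneg]
        · exact h.2
        · exact le_trans (Set.indicator_nonneg (fun _ _ => zero_le_one) x) h.1
    rw [← hval a, ← hval b]
    refine ⟨integral_mono_ae (hind b (ha.trans hab)) hti ?_, integral_mono_ae hti (hind a ha) ?_⟩
    · filter_upwards [hμ] with x hx using (tailTest_bounds ha hab hx).1
    · filter_upwards [hμ] with x hx using (tailTest_bounds ha hab hx).2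
  have hΛtail : ∀ a, 0 < a → (selfsimilarLevyMeasure α).real (Ioi a) = 1 / a ^ α := fun a ha => by
    rw [measureReal_def, selfsimilarLevyMeasure_Ioi hα0 ha, ENNReal.toReal_ofReal (by positivity)]
  have hΛfin : ∀ a, 0 < a → selfsimilarLevyMeasure α (Ioi a) ≠ ∞ := fun a ha => by
    rw [selfsimilarLevyMeasure_Ioi hα0 ha]
    exact ENNReal.ofReal_ne_top
  have hcont : ∀ x, 0 < x → ContinuousAt (fun y : ℝ => t / y ^ α) x := fun x hx =>
    continuousAt_const.div (Real.continuousAt_rpow_const _ _ (Or.inl hx.ne')) (by positivity)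
  refine ⟨hprob, hν, fun x hx => ?_, fun r x hx => ?_⟩
  · refine tendsto_order.2 ⟨fun c hc => ?_, fun c hc => ?_⟩
    · have h1 : ∀ᶠ b in 𝓝[>] x, c < t / b ^ α :=
        ((hcont x hx).eventually_const_lt hc).filter_mono nhdsWithin_le_nhds
      obtain ⟨b, hb, hxb⟩ := (h1.and self_mem_nhdsWithin).exists
      have h2 := hconv _ (continuous_tailTest hx b)
      rw [hκ'int] at h2
      have h3 := (hsand _ hΛ0 hΛi hΛfin x b hx hxb).1
      rw [hΛtail b (hx.trans hxb)] at h3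
      have h4 : c < t * ∫ y, (1 - Real.exp (-y)) * tailTest x b (Real.exp (-y))
          ∂(selfsimilarLevyMeasure α) := by
        refine hb.trans_le (le_trans (le_of_eq ?_) (mul_le_mul_of_nonneg_left h3 ht.le))
        ring
      filter_upwards [h2.eventually_const_lt h4] with r hr
      rw [hκint] at hr
      have h5 := (hsand _ (ae_nonneg_of_Iio (hν r)) (hνi r) (fun _ _ => measure_ne_top _ _)
        x b hx hxb).2
      exact hr.trans_le (mul_le_mul_of_nonneg_left h5 (hmpos r).le)
    · have h1 : ∀ᶠ a in 𝓝[<] x, t / a ^ α < c :=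
        ((hcont x hx).eventually_lt_const hc).filter_mono nhdsWithin_le_nhds
      have h1' : ∀ᶠ a in 𝓝[<] x, 0 < a :=
        (eventually_gt_nhds hx).filter_mono nhdsWithin_le_nhds
      obtain ⟨a, ⟨ha, ha0⟩, hax⟩ := ((h1.and h1').and self_mem_nhdsWithin).exists
      have h2 := hconv _ (continuous_tailTest ha0 x)
      rw [hκ'int] at h2
      have h3 := (hsand _ hΛ0 hΛi hΛfin a x ha0 hax).2
      rw [hΛtail a ha0] at h3
      have h4 : t * ∫ y, (1 - Real.exp (-y)) * tailTest a x (Real.exp (-y))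
          ∂(selfsimilarLevyMeasure α) < c := by
        refine lt_of_le_of_lt (le_trans (mul_le_mul_of_nonneg_left h3 ht.le) (le_of_eq ?_)) ha
        ring
      filter_upwards [h2.eventually_lt_const h4] with r hr
      rw [hκint] at hr
      have h5 := (hsand _ (ae_nonneg_of_Iio (hν r)) (hνi r) (fun _ _ => measure_ne_top _ _)
        a x ha0 hax).1
      exact (mul_le_mul_of_nonneg_left h5 (hmpos r).le).trans_lt hr
  · have h1 := mul_tail_le_one_sub_laplace (hν r) hx
    rw [hlap r _ (by positivity)] at h1
    have h2 := Real.add_one_le_exp (-(Ψ (1 / x) * (t / m r)))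
    have h3 : Ψ (1 / x) = (1 / x) ^ α * Ψ 1 := levyCharacteristic_eq_rpow_mul hα0 (by positivity)
    have h4 : (1 / x) ^ α = 1 / x ^ α := by rw [Real.div_rpow zero_le_one hx.le, Real.one_rpow]
    have hxα : 0 < x ^ α := by positivity
    have h5 : (1 - Real.exp (-1)) * (ν r).real (Ioi x) ≤ Ψ (1 / x) * (t / m r) := by linarith
    have hmr := hmpos r
    have h6 : m r * ((1 - Real.exp (-1)) * (ν r).real (Ioi x)) ≤ 1 / x ^ α * Ψ 1 * t := by
      refine (mul_le_mul_of_nonneg_left h5 hmr.le).trans (le_of_eq ?_)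
      rw [h3, h4]
      field_simp
    change m r * (ν r).real (Ioi x) ≤ _
    have h7 : m r * (ν r).real (Ioi x) ≤ 1 / x ^ α * Ψ 1 * t / (1 - Real.exp (-1)) := by
      rw [le_div_iff₀ he1]
      linarith
    refine h7.trans ?_
    rw [div_div, mul_comm (1 - Real.exp (-1)) (x ^ α), ← div_div]
    gcongr
    rw [div_mul_eq_mul_div, div_mul_eq_mul_div, one_mul]
    refine div_le_div_of_nonneg_right ?_ hxα.le
    rw [mul_comm]
    exact mul_le_mul_of_nonneg_left (by linarith) ht.le

end Tail


/-! ### The largest flights of a selfsimilar subordinator -/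

lemma monotone_of_dense {p : ℝ≥0 → ℝ} (hrc : ∀ s, ContinuousWithinAt p (Ici s) s)
    {D : Set ℝ≥0} (hD : Dense D) (h : ∀ a ∈ D, ∀ b ∈ D, a ≤ b → p a ≤ p b) : Monotone p := by
  intro s t hst
  rcases hst.eq_or_lt with rfl | hlt
  · exact le_rfl
  by_contra! hcon
  obtain ⟨c, hc1, hc2⟩ := exists_between hcon
  have h1 : ∀ᶠ x in 𝓝[>] s, c < p x :=
    ((hrc s).mono Ioi_subset_Ici_self).eventually_const_lt hc2
  have h2 : ∀ᶠ x in 𝓝[>] t, p x < c :=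
    ((hrc t).mono Ioi_subset_Ici_self).eventually_lt_const hc1
  obtain ⟨u, hu, hus⟩ := mem_nhdsGT_iff_exists_Ioo_subset.1 h1
  obtain ⟨v, hv, hvs⟩ := mem_nhdsGT_iff_exists_Ioo_subset.1 h2
  obtain ⟨a, haD, ha⟩ := hD.exists_between (lt_min hu hlt)
  obtain ⟨b, hbD, hb⟩ := hD.exists_between hv
  have h3 : c < p a := hus ⟨ha.1, ha.2.trans_le (min_le_left _ _)⟩
  have h4 : p b < c := hvs hb
  have h5 := h a haD b hbD ((ha.2.le.trans (min_le_right _ _)).trans hb.1.le)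
  linarith

section Subordinator

variable {Ω : Type*} [MeasurableSpace Ω] {P : Measure Ω} {α : ℝ}
  {L : ℝ≥0 → Ω → ℝ}

lemma IsOLP.ae_regular (hL : IsOLP L P) :
    ∀ᵐ ω ∂P, L 0 ω = 0 ∧ Monotone (fun s => L s ω) ∧
      ∀ s, ContinuousWithinAt (fun s => L s ω) (Ici s) s := by
  obtain ⟨D, hDc, hDd⟩ := TopologicalSpace.exists_countable_dense ℝ≥0
  have h : ∀ᵐ ω ∂P, ∀ a ∈ D, ∀ b ∈ D, a ≤ b → L a ω ≤ L b ω := by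
    rw [ae_ball_iff hDc]
    intro a _
    rw [ae_ball_iff hDc]
    intro b _
    by_cases hab : a ≤ b
    · filter_upwards [hL.nonneg_incr a b hab] with ω hω _ using hω
    · simp [hab]
  filter_upwards [hL.start, hL.cadlag, h] with ω h0 h1 h2
  exact ⟨h0, monotone_of_dense (fun s => (h1 s).1) hDd h2, fun s => (h1 s).1⟩

lemma IsOLP.map_Iio_zero (hL : IsOLP L P) (t : ℝ≥0) : P.map (L t) (Iio 0) = 0 := by
  rw [Measure.map_apply (hL.measurable t) measurableSet_Iio]
  refine measure_mono_null (t := {ω | ¬ 0 ≤ L t ω}) (fun ω hω => not_le.2 hω) ?_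
  rw [← ae_iff]
  filter_upwards [hL.ae_regular] with ω hω
  rw [← hω.1]
  exact hω.2.1 zero_le

lemma IsOLP.measurable_gridIncrement (hL : IsOLP L P) (t : ℝ≥0) (m : ℕ) :
    Measurable fun ω => gridIncrement (fun s => L s ω) t m :=
  measurable_pi_lambda _ fun _ => (hL.measurable _).sub (hL.measurable _)

lemma IsOLP.map_gridIncrement [IsProbabilityMeasure P] (hL : IsOLP L P) (t : ℝ≥0) (m : ℕ) :
    P.map (fun ω => gridIncrement (fun s => L s ω) t m) =
      Measure.pi fun _ : Fin m => P.map (L (t / m)) := by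
  have hind := hL.indep m (fun i => grid t m i) fun i j hij => grid_mono t m hij
  have hm : ∀ i : Fin m, AEMeasurable
      (fun ω => L (grid t m (i.succ : Fin (m + 1))) ω - L (grid t m (i.castSucc : Fin (m + 1))) ω) P :=
    fun i => ((hL.measurable _).sub (hL.measurable _)).aemeasurable
  have h := (iIndepFun_iff_map_fun_eq_pi_map hm).1 hind
  have hlaw : ∀ i : Fin m, P.map (fun ω => L (grid t m (i.succ : Fin (m + 1))) ω -
      L (grid t m (i.castSucc : Fin (m + 1))) ω) = P.map (L (t / m)) := by
    intro i
    have := (hL.stationary (grid t m i) (t / m)).map_eq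
    rw [← grid_succ] at this
    simpa using this
  simp only [hlaw] at h
  rw [← h]
  rfl

lemma IsOLP.ae_tendsto_topStat (hL : IsOLP L P) (t : ℝ≥0) :
    ∀ᵐ ω ∂P, ∀ k, Tendsto (fun m => topStat (gridIncrement (fun s => L s ω) t m) k) atTop
      (𝓝 (flight L (k + 1) t ω)) := by
  filter_upwards [hL.ae_regular] with ω hω k
  exact tendsto_topStat_gridIncrement hω.2.1 hω.2.2 t k

lemma IsOLP.aemeasurable_flight (hL : IsOLP L P) (k : ℕ) (t : ℝ≥0) :
    AEMeasurable (flight L (k + 1) t) P := by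
  refine aemeasurable_of_tendsto_metrizable_ae atTop
    (f := fun m ω => topStat (gridIncrement (fun s => L s ω) t m) k)
    (fun m => ((measurable_topStat k).comp (hL.measurable_gridIncrement t m)).aemeasurable) ?_
  filter_upwards [hL.ae_tendsto_topStat t] with ω hω using hω k

lemma sum_Icc_one_eq (f : ℕ → ℝ) (n : ℕ) :
    ∑ k ∈ Finset.Icc 1 n, f k = ∑ k ∈ Finset.range n, f (k + 1) := by
  rw [Finset.range_eq_Ico, Finset.sum_Ico_add' f 0 n 1]
  rfl

lemma IsOLP.aemeasurable_ratioVector (hL : IsOLP L P) (n : ℕ) (t : ℝ≥0) :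
    AEMeasurable (ratioVector L n t) P := by
  unfold ratioVector
  simp only [sum_Icc_one_eq]
  refine AEMeasurable.prodMk ?_ ?_
  · refine AEMeasurable.div ((hL.measurable t).aemeasurable.sub ?_) (hL.aemeasurable_flight n t)
    exact Finset.aemeasurable_fun_sum _ fun k _ => hL.aemeasurable_flight k t
  · exact aemeasurable_pi_lambda _ fun i =>
      (hL.aemeasurable_flight i t).div (hL.aemeasurable_flight n t)

lemma IsOLP.ae_tendsto_ratioStat (hL : IsOLP L P) (n : ℕ) (t : ℝ≥0)
    (hpos : ∀ᵐ ω ∂P, 0 < flight L (n + 1) t ω) :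
    ∀ᵐ ω ∂P, Tendsto (fun m => ratioStat n (gridIncrement (fun s => L s ω) t m)) atTop
      (𝓝 (ratioVector L n t ω)) := by
  filter_upwards [hL.ae_regular, hL.ae_tendsto_topStat t, hpos] with ω hreg hlim hω
  refine Tendsto.prodMk_nhds ?_ (tendsto_pi_nhds.2 fun i => (hlim i).div (hlim n) hω.ne')
  refine Tendsto.div (Tendsto.sub ?_ ?_) (hlim n) hω.ne'
  · refine tendsto_const_nhds.congr' ?_
    filter_upwards [eventually_ne_atTop 0] with m hm
    rw [sum_gridIncrement _ _ hm, hreg.1, sub_zero]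
  · rw [sum_Icc_one_eq]
    exact tendsto_finsetSum _ fun k _ => hlim k

lemma IsOLP.ae_ratioVector_fst_nonneg (hL : IsOLP L P) (n : ℕ) (t : ℝ≥0)
    (hpos : ∀ᵐ ω ∂P, 0 < flight L (n + 1) t ω) : ∀ᵐ ω ∂P, 0 ≤ (ratioVector L n t ω).1 := by
  filter_upwards [hL.ae_regular, hL.ae_tendsto_ratioStat n t hpos] with ω hreg hlim
  refine ge_of_tendsto ((continuous_fst.tendsto _).comp hlim) ?_
  filter_upwards [eventually_gt_atTop n] with m hm
  exact ratioStat_fst_nonneg (gridIncrement_nonneg hreg.2.1 t m) (by simpa using hm)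

variable [IsProbabilityMeasure P]

lemma IsSelfsimilarOLP.isStableArray (hL : IsSelfsimilarOLP α L P) (hα0 : 0 < α) (hα1 : α < 1)
    {t : ℝ≥0} (ht : 0 < t) (n : ℕ) :
    ∃ C > 0, IsStableArray α t C n fun r => P.map (L (t / (n + 1 + r : ℕ))) := by
  have he1 : 0 < 1 - Real.exp (-1) := sub_pos.2 (Real.exp_lt_one_iff.2 (by norm_num))
  have ht' : (0 : ℝ) < t := ht
  refine ⟨_, ?_, isStableArray_of_laplace hα0 hα1 ht'
    (fun r => Measure.isProbabilityMeasure_map (hL.measurable _).aemeasurable)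
    (fun r => hL.map_Iio_zero _) fun r w hw => ?_⟩
  · have := levyCharacteristic_nonneg (α := α) zero_le_one
    positivity
  · rw [integral_map (hL.measurable _).aemeasurable (by fun_prop), hL.laplace _ w hw]
    push_cast
    rfl

/-- The expectations of test functionals of the increments along the grids, in the limit. -/
lemma IsSelfsimilarOLP.tendsto_integral_gridIncrement (hL : IsSelfsimilarOLP α L P) (hα0 : 0 < α)
    (hα1 : α < 1) {t : ℝ≥0} (ht : 0 < t) {n : ℕ} (ψ : ℝ →ᵇ ℝ) (φ : (Fin n → ℝ) →ᵇ ℝ) {w : ℝ}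
    (hw : 0 ≤ w) :
    Tendsto (fun r : ℕ => ∫ ω, ratioFunctional ψ φ w
        (gridIncrement (fun s => L s ω) t (n + 1 + r)) ∂P) atTop
      (𝓝 ((∫ y in Ioi (0 : ℝ), y ^ n * (ψ ((t / y) ^ (1 / α)) * paretoMean α φ) *
        Real.exp (-((1 + G α w) * y))) / n.factorial)) := by
  obtain ⟨C, hC, h⟩ := hL.isStableArray hα0 hα1 ht n
  refine (h.tendsto_integral_ratioFunctional hα0 hα1 ht hC hw ψ φ).congr fun r => ?_
  rw [← hL.map_gridIncrement, integral_map (hL.measurable_gridIncrement _ _).aemeasurable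
    (measurable_ratioFunctional ψ φ w).aestronglyMeasurable]

lemma tendsto_shift_atTop (n : ℕ) : Tendsto (fun r : ℕ => n + 1 + r) atTop atTop :=
  tendsto_atTop_mono (fun r => Nat.le_add_left r (n + 1)) tendsto_id

lemma IsSelfsimilarOLP.integral_flight (hL : IsSelfsimilarOLP α L P) (hα0 : 0 < α) (hα1 : α < 1)
    {t : ℝ≥0} (ht : 0 < t) (n : ℕ) (ψ : ℝ →ᵇ ℝ) :
    ∫ ω, ψ (flight L (n + 1) t ω) ∂P =
      (∫ y in Ioi (0 : ℝ), y ^ n * ψ ((t / y) ^ (1 / α)) * Real.exp (-y)) / n.factorial := by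
  have h1 := hL.tendsto_integral_gridIncrement hα0 hα1 ht ψ
    (BoundedContinuousFunction.const (Fin n → ℝ) 1) le_rfl
  simp only [ratioFunctional, BoundedContinuousFunction.const_apply, mul_one, zero_mul, neg_zero,
    Real.exp_zero, G_zero, add_zero, one_mul, paretoMean, integral_const, probReal_univ,
    smul_eq_mul] at h1
  refine tendsto_nhds_unique ?_ h1
  refine tendsto_integral_of_dominated_convergence (fun _ => ‖ψ‖) (fun r => ?_)
    (integrable_const _) (fun r => Eventually.of_forall fun ω => ψ.norm_coe_le_norm _) ?_
  · exact (ψ.continuous.measurable.comp ((measurable_topStat n).comp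
      (hL.measurable_gridIncrement _ _))).aestronglyMeasurable
  · filter_upwards [hL.ae_tendsto_topStat t] with ω hω
    exact (ψ.continuous.tendsto _).comp ((hω n).comp (tendsto_shift_atTop n))

/-- The test function `x ↦ max (1 - j |x|) 0`, a bump at `0` of width `1 / j`. -/
noncomputable def bumpAtZero (j : ℕ) : ℝ →ᵇ ℝ :=
  BoundedContinuousFunction.ofNormedAddCommGroup (fun x : ℝ => max (1 - j * |x|) 0) (by fun_prop) 1
    fun x => by
      rw [Real.norm_eq_abs, abs_of_nonneg (le_max_right _ _)]
      have : 0 ≤ (j : ℝ) * |x| := by positivity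
      exact max_le (by linarith) zero_le_one

lemma bumpAtZero_apply (j : ℕ) (x : ℝ) : bumpAtZero j x = max (1 - j * |x|) 0 := rfl

lemma bumpAtZero_le_one (j : ℕ) (x : ℝ) : bumpAtZero j x ≤ 1 := by
  have : 0 ≤ (j : ℝ) * |x| := by positivity
  rw [bumpAtZero_apply]
  exact max_le (by linarith) zero_le_one

lemma bumpAtZero_nonneg (j : ℕ) (x : ℝ) : 0 ≤ bumpAtZero j x := le_max_right _ _

lemma tendsto_bumpAtZero {x : ℝ} (hx : 0 < x) :
    Tendsto (fun j => bumpAtZero j x) atTop (𝓝 0) := by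
  refine tendsto_const_nhds.congr' ?_
  filter_upwards [(tendsto_natCast_atTop_atTop (R := ℝ)).eventually_ge_atTop (1 / x)] with j hj
  rw [bumpAtZero_apply, abs_of_pos hx, max_eq_right]
  rw [div_le_iff₀ hx] at hj
  linarith

lemma IsSelfsimilarOLP.ae_flight_pos (hL : IsSelfsimilarOLP α L P) (hα0 : 0 < α) (hα1 : α < 1)
    {t : ℝ≥0} (ht : 0 < t) (n : ℕ) : ∀ᵐ ω ∂P, 0 < flight L (n + 1) t ω := by
  have ht' : (0 : ℝ) < t := ht
  have hbound : ∀ j : ℕ, P.real {ω | 1 ≤ bumpAtZero j (flight L (n + 1) t ω)} ≤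
      (∫ y in Ioi (0 : ℝ), y ^ n * bumpAtZero j ((t / y) ^ (1 / α)) * Real.exp (-y)) /
        n.factorial := by
    intro j
    rw [← hL.integral_flight hα0 hα1 ht n (bumpAtZero j)]
    have := mul_meas_ge_le_integral_of_nonneg (μ := P)
      (f := fun ω => bumpAtZero j (flight L (n + 1) t ω))
      (Eventually.of_forall fun ω => bumpAtZero_nonneg j _)
      (Integrable.of_bound ((bumpAtZero j).continuous.measurable.comp_aemeasurable
        (hL.aemeasurable_flight n t)).aestronglyMeasurable ‖bumpAtZero j‖
        (Eventually.of_forall fun ω => (bumpAtZero j).norm_coe_le_norm _)) 1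
    rwa [one_mul] at this
  have hlim : Tendsto (fun j : ℕ =>
      (∫ y in Ioi (0 : ℝ), y ^ n * bumpAtZero j ((t / y) ^ (1 / α)) * Real.exp (-y)) /
        n.factorial) atTop (𝓝 ((∫ _y in Ioi (0 : ℝ), (0 : ℝ)) / n.factorial)) := by
    refine Tendsto.div_const ?_ _
    refine tendsto_integral_of_dominated_convergence (fun y => y ^ n * Real.exp (-(1 * y)))
      (fun j => ?_) (integrableOn_pow_mul_exp_neg one_pos n) (fun j => ?_) ?_
    · have := (bumpAtZero j).continuous.measurable
      refine Measurable.aestronglyMeasurable ?_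
      refine ((measurable_id.pow_const n).mul (this.comp ?_)).mul (by fun_prop)
      exact (measurable_const.div measurable_id).pow_const _
    · refine (ae_restrict_iff' measurableSet_Ioi).2 (Eventually.of_forall fun y hy => ?_)
      have hy0 : 0 < y := hy
      rw [one_mul, Real.norm_eq_abs, abs_of_nonneg (by
        have := bumpAtZero_nonneg j ((t / y) ^ (1 / α))
        positivity)]
      gcongr
      exact mul_le_of_le_one_right (by positivity) (bumpAtZero_le_one _ _)
    · refine (ae_restrict_iff' measurableSet_Ioi).2 (Eventually.of_forall fun y hy => ?_)
      have hy0 : 0 < y := hy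
      have h := ((tendsto_bumpAtZero (x := (t / y) ^ (1 / α)) (by positivity)).const_mul
        (y ^ n)).mul_const (Real.exp (-y))
      simpa using h
  rw [integral_zero, zero_div] at hlim
  have hzero : P.real {ω | flight L (n + 1) t ω = 0} = 0 := by
    refine le_antisymm (ge_of_tendsto' hlim fun j => le_trans ?_ (hbound j)) measureReal_nonneg
    refine measureReal_mono fun ω hω => ?_
    have hω' : flight L (n + 1) t ω = 0 := hω
    simp [hω', bumpAtZero_apply]
  rw [measureReal_eq_zero_iff] at hzero
  have hne : ∀ᵐ ω ∂P, flight L (n + 1) t ω ≠ 0 := by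
    rw [ae_iff]
    simpa using hzero
  filter_upwards [hne] with ω hω
  exact lt_of_le_of_ne (largestFlight_nonneg _ _ _) hω.symm

/-- The joint law of the ratios: the first component of the vector of ratios is independent of the
others and has the Laplace transform `1 / (1 + G α w) ^ (n + 1)`, the others are distributed as order
statistics of independent Pareto variables. -/
theorem IsSelfsimilarOLP.integral_ratioVector (hL : IsSelfsimilarOLP α L P) (hα0 : 0 < α)
    (hα1 : α < 1) {t : ℝ≥0} (ht : 0 < t) {n : ℕ} (φ : (Fin n → ℝ) →ᵇ ℝ) {w : ℝ} (hw : 0 ≤ w) :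
    ∫ ω, φ (ratioVector L n t ω).2 * Real.exp (-(w * (ratioVector L n t ω).1)) ∂P =
      paretoMean α φ * (1 / (1 + G α w)) ^ (n + 1) := by
  have hpos := hL.ae_flight_pos hα0 hα1 ht n
  have h1 := hL.tendsto_integral_gridIncrement hα0 hα1 ht (BoundedContinuousFunction.const ℝ 1) φ hw
  have hc : 0 < 1 + G α w := by linarith [G_nonneg hα0 hw]
  have hval : (∫ y in Ioi (0 : ℝ), y ^ n * ((BoundedContinuousFunction.const ℝ (1 : ℝ))
      ((t / y) ^ (1 / α)) * paretoMean α φ) * Real.exp (-((1 + G α w) * y))) / n.factorial =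
      paretoMean α φ * (1 / (1 + G α w)) ^ (n + 1) := by
    have h2 := integral_pow_mul_exp_neg hc n
    have h3 : ∀ y : ℝ, y ^ n * ((BoundedContinuousFunction.const ℝ (1 : ℝ))
      ((t / y) ^ (1 / α)) * paretoMean α φ) * Real.exp (-((1 + G α w) * y)) =
        paretoMean α φ * (y ^ n * Real.exp (-((1 + G α w) * y))) := fun y => by
      rw [BoundedContinuousFunction.const_apply]
      ring
    simp only [h3, integral_const_mul, h2]
    have hfac : (n.factorial : ℝ) ≠ 0 := by exact_mod_cast n.factorial_ne_zero
    rw [one_div, inv_pow]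
    field_simp
  rw [hval] at h1
  refine tendsto_nhds_unique ?_ h1
  refine tendsto_integral_of_dominated_convergence
    (fun _ => ‖BoundedContinuousFunction.const ℝ (1 : ℝ)‖ * ‖φ‖) (fun r => ?_)
    (integrable_const _) (fun r => ?_) ?_
  · exact ((measurable_ratioFunctional _ φ w).comp
      (hL.measurable_gridIncrement _ _)).aestronglyMeasurable
  · filter_upwards [hL.ae_regular] with ω hω
    exact abs_ratioFunctional_le _ φ hw (gridIncrement_nonneg hω.2.1 _ _)
      (by rw [Fintype.card_fin]; omega)
  · filter_upwards [hL.ae_tendsto_ratioStat n t hpos] with ω hω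
    have h2 := hω.comp (tendsto_shift_atTop n)
    have h3 := ((φ.continuous.tendsto _).comp ((continuous_snd.tendsto _).comp h2)).mul
      ((Real.continuous_exp.tendsto _).comp
        (((continuous_fst.tendsto _).comp h2).const_mul w).neg)
    refine h3.congr fun r => ?_
    simp [ratioFunctional]

end Subordinator


/-! ### The limit vector and the comparison of laws -/

section Pareto

variable {α : ℝ}

lemma paretoMeasure_Ici {x : ℝ} (hα0 : 0 < α) (hx : 1 ≤ x) :
    paretoMeasure 1 α (Ici x) = ENNReal.ofReal (1 / x ^ α) := by
  have hx0 : 0 < x := one_pos.trans_le hx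
  rw [← selfsimilarLevyMeasure_Ioi hα0 hx0, paretoMeasure, withDensity_apply _ measurableSet_Ici,
    ← Measure.restrict_congr_set Ioi_ae_eq_Ici, selfsimilarLevyMeasure,
    withDensity_apply _ measurableSet_Ioi, Measure.restrict_restrict measurableSet_Ioi,
    inter_eq_self_of_subset_left (Ioi_subset_Ioi hx0.le)]
  refine setLIntegral_congr_fun measurableSet_Ioi fun y hy => ?_
  have hy1 : 1 ≤ y := hx.trans (le_of_lt hy)
  have hy0 : 0 < y := one_pos.trans_le hy1
  rw [paretoPDF_eq, if_pos hy1, Real.one_rpow, mul_one, Real.rpow_neg hy0.le, div_eq_mul_inv,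
    add_comm 1 α]

/-- The Pareto law is the law of `U ^ (-1/α)` with `U` uniform on the unit interval. -/
lemma map_rpow_unif (hα0 : 0 < α) :
    unif.map (fun u => u ^ (-(1 / α))) = paretoMeasure 1 α := by
  have hm : Measurable fun u : ℝ => u ^ (-(1 / α)) := measurable_id.pow_const _
  have := isProbabilityMeasure_paretoMeasure one_pos hα0
  have := Measure.isProbabilityMeasure_map (μ := unif) hm.aemeasurable
  have hone : ∀ x : ℝ, 1 ≤ x →
      unif.map (fun u => u ^ (-(1 / α))) (Ici x) = ENNReal.ofReal (1 / x ^ α) := by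
    intro x hx
    have hx0 : 0 < x := one_pos.trans_le hx
    have hle : 1 / x ^ α ≤ 1 := by
      rw [div_le_one (by positivity)]
      exact Real.one_le_rpow hx hα0.le
    rw [Measure.map_apply hm measurableSet_Ici, unif,
      Measure.restrict_apply (hm measurableSet_Ici)]
    have hset : ((fun u : ℝ => u ^ (-(1 / α))) ⁻¹' Ici x ∩ Ioo 0 1 : Set ℝ) =
        Iic (1 / x ^ α) ∩ Ioo 0 1 := by
      ext u
      simp only [mem_inter_iff, mem_preimage, mem_Ici, mem_Iic]
      refine and_congr_left fun hu => ?_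
      have hu0 := hu.1
      rw [Real.rpow_neg hu0.le, ← one_div, le_one_div hx0 (by positivity),
        ← Real.rpow_le_rpow_iff (z := α) (by positivity) (by positivity) hα0,
        ← Real.rpow_mul hu0.le, one_div_mul_cancel hα0.ne', Real.rpow_one,
        Real.div_rpow zero_le_one hx0.le, Real.one_rpow]
    have hae : (Iic (1 / x ^ α) ∩ Ioo 0 1 : Set ℝ) =ᵐ[volume] Ioo 0 (1 / x ^ α) := by
      have h1 : (Iio (1 / x ^ α) ∩ Ioo 0 1 : Set ℝ) = Ioo 0 (1 / x ^ α) := by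
        ext u
        simp only [mem_inter_iff, mem_Iio, mem_Ioo]
        exact ⟨fun h => ⟨h.2.1, h.1⟩, fun h => ⟨h.2, h.1, h.2.trans_le hle⟩⟩
      rw [← h1]
      exact (Iio_ae_eq_Iic.symm).inter (ae_eq_refl _)
    rw [hset, measure_congr hae, Real.volume_Ioo, sub_zero]
  refine Measure.ext_of_Ici _ _ fun x => ?_
  rcases le_or_gt 1 x with hx | hx
  · rw [hone x hx, paretoMeasure_Ici hα0 hx]
  · have hall : ∀ μ : Measure ℝ, IsProbabilityMeasure μ →
        μ (Ici 1) = ENNReal.ofReal (1 / 1 ^ α) → μ (Ici x) = 1 := by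
      intro μ _ h
      refine le_antisymm prob_le_one ?_
      rw [Real.one_rpow, div_one, ENNReal.ofReal_one] at h
      rw [← h]
      exact measure_mono (Ici_subset_Ici.2 hx.le)
    rw [hall _ inferInstance (hone 1 le_rfl), hall _ inferInstance (paretoMeasure_Ici hα0 le_rfl)]

lemma ae_paretoMeasure_pos (hα0 : 0 < α) : ∀ᵐ y ∂(paretoMeasure 1 α), 0 < y := by
  have hm : Measurable fun u : ℝ => u ^ (-(1 / α)) := measurable_id.pow_const _
  rw [← map_rpow_unif hα0, ae_map_iff hm.aemeasurable measurableSet_Ioi, unif]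
  filter_upwards [ae_restrict_mem measurableSet_Ioo] with u hu
  exact Real.rpow_pos_of_pos hu.1 _

lemma integral_orderStat_pareto (hα0 : 0 < α) {n : ℕ} (φ : (Fin n → ℝ) →ᵇ ℝ) :
    ∫ y, φ (orderStat y) ∂(Measure.pi fun _ : Fin n => paretoMeasure 1 α) = paretoMean α φ := by
  have hm : Measurable fun u : ℝ => u ^ (-(1 / α)) := measurable_id.pow_const _
  have := isProbabilityMeasure_paretoMeasure one_pos hα0
  have hpi : (Measure.pi fun _ : Fin n => paretoMeasure 1 α) =
      (Measure.pi fun _ : Fin n => unif).map fun u j => u j ^ (-(1 / α)) := by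
    have h := Measure.pi_map_pi (ι := Fin n) (μ := fun _ => unif)
      (f := fun _ u => u ^ (-(1 / α))) (fun _ => hm.aemeasurable)
    rw [map_rpow_unif hα0] at h
    exact h.symm
  have hos : ∀ y : Fin n → ℝ, orderStat y = fun i : Fin n => topStat y i := fun y =>
    funext fun i => (topStat_eq_orderStat y i).symm
  have hφ : Continuous fun y : Fin n → ℝ => φ fun i : Fin n => topStat y i :=
    φ.continuous.comp (continuous_pi fun i => continuous_topStat _)
  simp only [hos]
  have hmap : Measurable fun (u : Fin n → ℝ) (j : Fin n) => u j ^ (-(1 / α)) :=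
    measurable_pi_lambda _ fun j => hm.comp (measurable_pi_apply j)
  rw [hpi, integral_map hmap.aemeasurable hφ.aestronglyMeasurable]
  rfl

lemma sum_orderStat {n : ℕ} (y : Fin n → ℝ) : ∑ i, orderStat y i = ∑ j, y j := by
  rw [← sum_topStat y, Fintype.card_fin, Finset.sum_range]
  simp only [topStat_eq_orderStat]

lemma measurable_orderStat {n : ℕ} : Measurable fun y : Fin n → ℝ => orderStat y := by
  refine measurable_pi_lambda _ fun i => ?_
  simp only [← topStat_eq_orderStat]
  exact measurable_topStat _

end Pareto

section Limit

variable {Ω' : Type*} [MeasurableSpace Ω'] {Q : Measure Ω'} {α : ℝ} {n : ℕ}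
  {ξ : Fin (n + 1) → Ω' → ℝ} {Y : Fin n → Ω' → ℝ} {μ : Measure ℝ}

lemma integral_limitVector [IsProbabilityMeasure Q] (hα0 : 0 < α) (hμ : IsGLaw α μ)
    (hξ : ∀ i, HasLaw (ξ i) μ Q)
    (hY : ∀ j, HasLaw (Y j) (paretoMeasure 1 α) Q) (hind : iIndepFun (Sum.elim ξ Y) Q)
    (φ : (Fin n → ℝ) →ᵇ ℝ) {w : ℝ} (hw : 0 ≤ w) :
    ∫ ω, φ (orderStat fun j => Y j ω) * Real.exp (-(w * ∑ i, ξ i ω)) ∂Q =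
      paretoMean α φ * (1 / (1 + G α w)) ^ (n + 1) := by
  have := hμ.prob
  have := isProbabilityMeasure_paretoMeasure one_pos hα0
  have hm : ∀ s, AEMeasurable (Sum.elim ξ Y s) Q := by
    rintro (i | j)
    · exact (hξ i).aemeasurable
    · exact (hY j).aemeasurable
  have hmap := (iIndepFun_iff_map_fun_eq_pi_map hm).1 hind
  let ν : Fin (n + 1) ⊕ Fin n → Measure ℝ := Sum.elim (fun _ => μ) fun _ => paretoMeasure 1 α
  have hν : (fun s => Q.map (Sum.elim ξ Y s)) = ν := by
    ext1 s
    rcases s with i | j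
    · exact (hξ i).map_eq
    · exact (hY j).map_eq
  have hνp : ∀ s, IsProbabilityMeasure (ν s) := by
    rintro (i | j)
    · exact hμ.prob
    · exact isProbabilityMeasure_paretoMeasure one_pos hα0
  rw [hν] at hmap
  have hF : Measurable fun v : Fin (n + 1) ⊕ Fin n → ℝ =>
      φ (orderStat fun j => v (.inr j)) * Real.exp (-(w * ∑ i, v (.inl i))) := by
    have h0 : Measurable fun (v : Fin (n + 1) ⊕ Fin n → ℝ) (j : Fin n) => v (.inr j) := by
      fun_prop
    exact (φ.continuous.measurable.comp (measurable_orderStat.comp h0)).mul (by fun_prop)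
  have h1 : ∫ ω, φ (orderStat fun j => Y j ω) * Real.exp (-(w * ∑ i, ξ i ω)) ∂Q =
      ∫ v, φ (orderStat fun j => v (.inr j)) * Real.exp (-(w * ∑ i, v (.inl i)))
        ∂(Measure.pi ν) := by
    rw [← hmap, integral_map (aemeasurable_pi_lambda _ hm) hF.aestronglyMeasurable]
    rfl
  have h2 := measurePreserving_sumPiEquivProdPi_symm (X := fun _ : Fin (n + 1) ⊕ Fin n => ℝ) ν
  rw [h1, ← h2.integral_comp']
  have h3 := integral_prod_mul (μ := Measure.pi fun _ : Fin (n + 1) => μ)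
    (ν := Measure.pi fun _ : Fin n => paretoMeasure 1 α)
    (fun x => ∏ i, Real.exp (-(w * x i))) fun y => φ (orderStat y)
  have h4 := integral_fintype_prod_eq_pow (ι := Fin (n + 1)) (μ := μ)
    fun x => Real.exp (-(w * x))
  rw [Fintype.card_fin, hμ.laplace w hw] at h4
  rw [integral_orderStat_pareto hα0, h4, mul_comm (_ ^ _)] at h3
  rw [← h3]
  refine integral_congr_ae (Eventually.of_forall fun z => ?_)
  change φ (orderStat z.2) * Real.exp (-(w * ∑ i, z.1 i)) = _
  simp only [← Real.exp_sum, Finset.sum_neg_distrib, ← Finset.mul_sum]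
  exact mul_comm _ _

lemma aemeasurable_limitVector (hξ : ∀ i, HasLaw (ξ i) μ Q)
    (hY : ∀ j, HasLaw (Y j) (paretoMeasure 1 α) Q) :
    AEMeasurable (fun ω => (∑ i, ξ i ω, orderStat fun j => Y j ω)) Q := by
  refine AEMeasurable.prodMk (Finset.aemeasurable_fun_sum _ fun i _ => (hξ i).aemeasurable) ?_
  exact measurable_orderStat.comp_aemeasurable
    (aemeasurable_pi_lambda _ fun j => (hY j).aemeasurable)

lemma ae_of_hasLaw {Z : Ω' → ℝ} {p : ℝ → Prop} (hZ : HasLaw Z μ Q) (h : ∀ᵐ x ∂μ, p x) :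
    ∀ᵐ ω ∂Q, p (Z ω) :=
  ae_of_ae_map hZ.aemeasurable (by rwa [hZ.map_eq])

lemma ae_limit_nonneg (hα0 : 0 < α) (hμ : IsGLaw α μ) (hξ : ∀ i, HasLaw (ξ i) μ Q)
    (hY : ∀ j, HasLaw (Y j) (paretoMeasure 1 α) Q) :
    ∀ᵐ ω ∂Q, 0 ≤ ∑ i, ξ i ω ∧ ∀ j, 0 < Y j ω := by
  have h1 : ∀ᵐ ω ∂Q, ∀ i, 0 ≤ ξ i ω :=
    ae_all_iff.2 fun i => ae_of_hasLaw (hξ i) (ae_nonneg_of_Iio hμ.nonneg)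
  have h2 : ∀ᵐ ω ∂Q, ∀ j, 0 < Y j ω :=
    ae_all_iff.2 fun j => ae_of_hasLaw (hY j) (ae_paretoMeasure_pos hα0)
  filter_upwards [h1, h2] with ω hω1 hω2
  exact ⟨Finset.sum_nonneg fun i _ => hω1 i, hω2⟩

/-- Passing from an identity in law with an almost surely positive `(1 + S)⁻¹` to distribution
functions. -/
lemma measure_le_of_identDistrib {Ω : Type*} [MeasurableSpace Ω] {P : Measure Ω} {X : Ω → ℝ}
    {S : Ω' → ℝ} (h : IdentDistrib X (fun ω => (1 + S ω)⁻¹) P Q) (hS : ∀ᵐ ω ∂Q, 0 ≤ S ω) :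
    (∀ u : ℝ, 0 < u → u ≤ 1 → P {ω | X ω ≤ u} = Q {ω | 1 / u - 1 ≤ S ω}) ∧
      P {ω | X ω ≤ 0} = 0 := by
  constructor
  · intro u hu _
    refine (h.measure_mem_eq measurableSet_Iic).trans (measure_congr (eventuallyEq_set.2 ?_))
    filter_upwards [hS] with ω hω
    change (1 + S ω)⁻¹ ≤ u ↔ 1 / u - 1 ≤ S ω
    rw [inv_le_comm₀ (by linarith) hu, one_div, sub_le_iff_le_add']
  · refine (h.measure_mem_eq measurableSet_Iic).trans (measure_eq_zero_iff_ae_notMem.2 ?_)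
    filter_upwards [hS] with ω hω
    have : 0 < (1 + S ω)⁻¹ := by positivity
    exact not_le.2 this

end Limit

section Ratios

lemma flight_div_eq {Ω : Type*} {L : ℝ≥0 → Ω → ℝ} {n : ℕ} {t : ℝ≥0} {ω : Ω}
    (h : 0 < flight L (n + 1) t ω) :
    flight L (n + 1) t ω / L t ω =
      (1 + ((ratioVector L n t ω).1 + ∑ i, (ratioVector L n t ω).2 i))⁻¹ := by
  simp only [ratioVector, sum_Icc_one_eq, Finset.sum_range_succ, ← Finset.sum_div]
  rw [Fin.sum_univ_eq_sum_range fun k => flight L (k + 1) t ω]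
  rw [← inv_div]
  congr 1
  field_simp
  ring

lemma sum_flight_div_eq {Ω : Type*} {L : ℝ≥0 → Ω → ℝ} {n : ℕ} {t : ℝ≥0} {ω : Ω} (hn : 1 ≤ n)
    (h : ∀ k, 0 < flight L (k + 1) t ω) :
    (∑ k ∈ Finset.Icc 1 n, flight L k t ω) / L t ω =
      (1 + (1 + (ratioVector L n t ω).1) / ∑ i, (ratioVector L n t ω).2 i)⁻¹ := by
  simp only [ratioVector, sum_Icc_one_eq, Finset.sum_range_succ _ n, ← Finset.sum_div]
  rw [Fin.sum_univ_eq_sum_range fun k => flight L (k + 1) t ω]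
  have hS : 0 < ∑ k ∈ Finset.range n, flight L (k + 1) t ω :=
    Finset.sum_pos (fun k _ => h k) ⟨0, Finset.mem_range.2 hn⟩
  have hX := h n
  rw [← inv_div]
  congr 1
  field_simp
  ring

variable {Ω : Type*} [MeasurableSpace Ω] {P : Measure Ω} [IsProbabilityMeasure P] {α : ℝ}
  {L : ℝ≥0 → Ω → ℝ}

lemma IsSelfsimilarOLP.identDistrib_ratioVector (hL : IsSelfsimilarOLP α L P) (hα0 : 0 < α)
    (hα1 : α < 1) {s t : ℝ≥0} (hs : 0 < s) (ht : 0 < t) (n : ℕ) :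
    IdentDistrib (ratioVector L n s) (ratioVector L n t) P P :=
  identDistrib_of_laplace (hL.aemeasurable_ratioVector n s) (hL.aemeasurable_ratioVector n t)
    (hL.ae_ratioVector_fst_nonneg n s (hL.ae_flight_pos hα0 hα1 hs n))
    (hL.ae_ratioVector_fst_nonneg n t (hL.ae_flight_pos hα0 hα1 ht n)) fun j φ => by
      rw [hL.integral_ratioVector hα0 hα1 hs φ (Nat.cast_nonneg j),
        hL.integral_ratioVector hα0 hα1 ht φ (Nat.cast_nonneg j)]

/-- The law with Laplace transform `1 / (1 + G α w)` is the law of `(L(1) - X₁(1)) / X₁(1)`. -/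
lemma IsSelfsimilarOLP.isGLaw_map (hL : IsSelfsimilarOLP α L P) (hα0 : 0 < α) (hα1 : α < 1) :
    IsGLaw α (P.map fun ω => (ratioVector L 0 1 ω).1) := by
  have hm : AEMeasurable (fun ω => (ratioVector L 0 1 ω).1) P :=
    measurable_fst.comp_aemeasurable (hL.aemeasurable_ratioVector 0 1)
  refine ⟨Measure.isProbabilityMeasure_map hm, ?_, fun w hw => ?_⟩
  · have h := (ae_map_iff hm (measurableSet_Ici (a := (0 : ℝ)))).2
      (hL.ae_ratioVector_fst_nonneg 0 1 (hL.ae_flight_pos hα0 hα1 one_pos 0))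
    rw [ae_iff] at h
    convert h using 2
    ext x
    simp
  · rw [integral_map hm (by fun_prop)]
    have h := hL.integral_ratioVector hα0 hα1 one_pos (n := 0)
      (BoundedContinuousFunction.const _ 1) hw
    simpa [paretoMean] using h

lemma IsGLaw.eq {μ ν : Measure ℝ} (hμ : IsGLaw α μ) (hν : IsGLaw α ν) : μ = ν := by
  have := hμ.prob
  have := hν.prob
  exact measure_ext_of_laplace hμ.nonneg hν.nonneg fun j => by
    rw [hμ.laplace j (Nat.cast_nonneg j), hν.laplace j (Nat.cast_nonneg j)]

end Ratios

end LevyFlights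

open LevyFlights
theorem mainTheorem2 {Ω : Type*} [MeasurableSpace Ω] (P : Measure Ω) [IsProbabilityMeasure P]
    (α : ℝ) (hα0 : 0 < α) (hα1 : α < 1) (L : ℝ≥0 → Ω → ℝ) (hL : IsSelfsimilarOLP α L P) :
    -- the law `𝒢_α` exists and is unique
    (∃! μ : Measure ℝ, IsGLaw α μ) ∧
    ∀ n : ℕ,
      -- the ratios are well defined
      (∀ t : ℝ≥0, 0 < t → ∀ᵐ ω ∂P, 0 < flight L (n + 1) t ω) ∧
      -- the law of the vector of ratios does not depend on time
      (∀ s t : ℝ≥0, 0 < s → 0 < t →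
        IdentDistrib (ratioVector L n s) (ratioVector L n t) P P) ∧
      -- comparison with independent `𝒢_α`-distributed `ξ` and Pareto(`α`)-distributed `Y`
      (∀ t : ℝ≥0, 0 < t →
        ∀ {Ω' : Type*} [MeasurableSpace Ω'] (Q : Measure Ω') [IsProbabilityMeasure Q]
          (ξ : Fin (n + 1) → Ω' → ℝ) (Y : Fin n → Ω' → ℝ) (μ : Measure ℝ),
          IsGLaw α μ →
          (∀ i, HasLaw (ξ i) μ Q) →
          (∀ j, HasLaw (Y j) (paretoMeasure 1 α) Q) →
          iIndepFun (Sum.elim ξ Y) Q →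
          IdentDistrib (ratioVector L n t)
            (fun ω' => (∑ i, ξ i ω', orderStat fun j => Y j ω')) P Q ∧
          -- the contribution of the `(n+1)`-th largest flight
          IdentDistrib (fun ω => flight L (n + 1) t ω / L t ω)
            (fun ω' => (1 + ∑ i, ξ i ω' + ∑ j, Y j ω')⁻¹) P Q ∧
          (∀ u : ℝ, 0 < u → u ≤ 1 →
            P {ω | flight L (n + 1) t ω / L t ω ≤ u} =
              Q {ω' | 1 / u - 1 ≤ ∑ i, ξ i ω' + ∑ j, Y j ω'}) ∧
          P {ω | flight L (n + 1) t ω / L t ω ≤ 0} = 0 ∧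
          -- the combined contribution of the `n` largest flights
          (1 ≤ n →
            IdentDistrib (fun ω => (∑ k ∈ Finset.Icc 1 n, flight L k t ω) / L t ω)
              (fun ω' => (1 + (1 + ∑ i, ξ i ω') / ∑ j, Y j ω')⁻¹) P Q ∧
            (∀ u : ℝ, 0 < u → u ≤ 1 →
              P {ω | (∑ k ∈ Finset.Icc 1 n, flight L k t ω) / L t ω ≤ u} =
                Q {ω' | 1 / u - 1 ≤ (1 + ∑ i, ξ i ω') / ∑ j, Y j ω'}) ∧
            P {ω | (∑ k ∈ Finset.Icc 1 n, flight L k t ω) / L t ω ≤ 0} = 0)) := by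
  refine ⟨⟨_, hL.isGLaw_map hα0 hα1, fun _ hμ => hμ.eq (hL.isGLaw_map hα0 hα1)⟩,
    fun n => ⟨fun t ht => hL.ae_flight_pos hα0 hα1 ht n,
    fun s t hs ht => hL.identDistrib_ratioVector hα0 hα1 hs ht n, ?_⟩⟩
  intro t ht Ω' _ Q _ ξ Y μ hμ hξ hY hind
  have hpos := hL.ae_flight_pos hα0 hα1 ht n
  have hnn := ae_limit_nonneg hα0 hμ hξ hY
  have hvec : IdentDistrib (ratioVector L n t)
      (fun ω' => (∑ i, ξ i ω', orderStat fun j => Y j ω')) P Q := by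
    refine identDistrib_of_laplace (hL.aemeasurable_ratioVector n t)
      (aemeasurable_limitVector hξ hY) (hL.ae_ratioVector_fst_nonneg n t hpos) ?_ fun j φ => ?_
    · filter_upwards [hnn] with ω hω using hω.1
    · rw [hL.integral_ratioVector hα0 hα1 ht φ (Nat.cast_nonneg j),
        integral_limitVector hα0 hμ hξ hY hind φ (Nat.cast_nonneg j)]
  have hflight : IdentDistrib (fun ω => flight L (n + 1) t ω / L t ω)
      (fun ω' => (1 + (∑ i, ξ i ω' + ∑ j, Y j ω'))⁻¹) P Q := by
    have h := hvec.comp (u := fun z : ℝ × (Fin n → ℝ) => (1 + (z.1 + ∑ i, z.2 i))⁻¹)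
      (by fun_prop)
    simp only [Function.comp_def, sum_orderStat] at h
    have hX : AEMeasurable (fun ω => flight L (n + 1) t ω / L t ω) P :=
      (hL.aemeasurable_flight n t).div (hL.measurable t).aemeasurable
    refine (IdentDistrib.of_ae_eq hX ?_).trans h
    filter_upwards [hpos] with ω hω using flight_div_eq hω
  have hS : ∀ᵐ ω' ∂Q, 0 ≤ ∑ i, ξ i ω' + ∑ j, Y j ω' := by
    filter_upwards [hnn] with ω' hω
    exact add_nonneg hω.1 (Finset.sum_nonneg fun j _ => (hω.2 j).le)
  obtain ⟨h1, h2⟩ := measure_le_of_identDistrib hflight hS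
  refine ⟨hvec, by simpa only [add_assoc] using hflight, h1, h2, fun hn => ?_⟩
  have hsum : IdentDistrib (fun ω => (∑ k ∈ Finset.Icc 1 n, flight L k t ω) / L t ω)
      (fun ω' => (1 + (1 + ∑ i, ξ i ω') / ∑ j, Y j ω')⁻¹) P Q := by
    have h := hvec.comp (u := fun z : ℝ × (Fin n → ℝ) => (1 + (1 + z.1) / ∑ i, z.2 i)⁻¹)
      (by fun_prop)
    simp only [Function.comp_def, sum_orderStat] at h
    have hX : AEMeasurable (fun ω => (∑ k ∈ Finset.Icc 1 n, flight L k t ω) / L t ω) P := by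
      simp only [sum_Icc_one_eq]
      exact (Finset.aemeasurable_fun_sum _ fun k _ => hL.aemeasurable_flight k t).div
        (hL.measurable t).aemeasurable
    refine (IdentDistrib.of_ae_eq hX ?_).trans h
    filter_upwards [ae_all_iff.2 fun k => hL.ae_flight_pos hα0 hα1 ht k] with ω hω
    exact sum_flight_div_eq hn hω
  have hS' : ∀ᵐ ω' ∂Q, 0 ≤ (1 + ∑ i, ξ i ω') / ∑ j, Y j ω' := by
    filter_upwards [hnn] with ω' hω
    exact div_nonneg (by linarith [hω.1]) (Finset.sum_nonneg fun j _ => (hω.2 j).le)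
  exact ⟨hsum, measure_le_of_identDistrib hsum hS'⟩
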